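/- Let $n\ge 2$ and let $M^{n+1}\subset\mathbb R^L$ be a compact connected smooth locally wedge-shaped manifold with the induced metric: every $p\in M$ has a local model, i.e. a diffeomorphism $\phi$ of $\mathbb R^L$ from a neighbourhood of $0$ onto a neighbourhood of $p$, with $\phi(0)=p$ and $D\phi_0\in O(L)$, that carries $\Omega\times 0^{L-n-1}$ to $M$ near $p$, where $\Omega$ is $\mathbb R^{n+1}$ (interior points) or a wedge domain in $\mathbb R^{n+1}$, i.e. an intersection of two closed half-spaces with wedge angle $\theta(p)\in(0,\pi]$ (boundary points). The face $\partial^FM$ and the edge $\partial^EM$ consist of the boundary points with $\theta(p)=\pi$ and $\theta(p)<\pi$ respectively; near an edge point, $\partial M$ consists of two smooth pieces $\partial^\pm M$ meeting along $\partial^EM$. Locally wedge-shaped $n$-manifolds, their faces and their edges are defined likewise. Assume that on each connected component of $\partial^EM$ one of the following holds: ($\dagger$) $\theta(q)<\pi/2$ at all points $q$ of the component; ($\ddagger$) $\theta(q)=\pi/2$ and $A_{\partial^+M}(\eta_+,v)=A_{\partial^-M}(\eta_-,v)$ for all points $q$ of the component and all $v\in T_q\partial^EM$, where $A_{\partial^\pm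 M}$ is the second fundamental form of $\partial^\pm M$ in $M$ with respect to the inward unit normal and $\eta_\pm$ is the outward unit conormal of $\partial^\pm M$ along $\partial^EM$. Then for every $p\in\partial^EM$ there are $r_0>0$, a relatively open neighbourhood $W$ of $p$ in $M$ and a function $d_p:W\to\mathbb R$ such that (i) $d_p^2$ is smooth on $W$ (locally the restriction of a smooth function on an open subset of $\mathbb R^L$), and $d_p\ge 0$ with equality only at $p$; (ii) for every $t\in(0,r_0)$ the level set $S_t=\{q\in W: d_p(q)=t\}$ is a non-empty compact smooth locally wedge-shaped hypersurface, properly embedded in $M$ (i.e. $\partial^FS_t=S_t\cap\partial^FM$ and $\partial^ES_t=S_t\cap\partial^EM$), which is strictly mean convex (its mean curvature in $M$ with respect to the unit normal pointing in the direction of decreasing $d_p$ is positive at every point, so that small Euclidean spheres about $p$ would have positive mean curvature) and meets $\partial M$ orthogonally, also along the edge (at every point of $S_t\cap\partial M$ the normals in $M$ of all smooth pieces of $\partial M$ through that point are tangent to $S_t$). -/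

import Mathlib

namespace WedgeShaped

open Set
open scoped ContDiff

/-- The ambient Euclidean space `ℝ^L`. -/
abbrev E (L : ℕ) : Type := EuclideanSpace ℝ (Fin L)

noncomputable section

/-- The `i`-th standard basis vector of `ℝ^L` (coordinates are numbered from `0`). -/
def basisVec (L i : ℕ) : E L := WithLp.toLp 2 (fun j => if (j : ℕ) = i then 1 else 0)

/-- The coordinate subspace `ℝ^m × 0^{L-m}` of `ℝ^L`. -/
def coordSubspace (L m : ℕ) : Submodule ℝ (E L) where
  carrier := {x | ∀ i : Fin L, m ≤ (i : ℕ) → x i = 0}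
  add_mem' := by
    intro a b ha hb i hi
    simp [ha i hi, hb i hi]
  zero_mem' := by
    intro i _
    simp
  smul_mem' := by
    intro c a ha i hi
    simp [ha i hi]

/-! In the standard wedge of angle `θ`, the two faces are labelled by a sign `s = 1` or `s = -1`:
the face labelled `s` is spanned by the ray of direction `(cos (θ/2), s sin (θ/2), 0)` and the
edge. -/

/-- The inward unit normal `(sin (θ/2), -s cos (θ/2), 0)` of the face labelled `s` of the standard
wedge of angle `θ`. -/
def faceNormal (L : ℕ) (θ s : ℝ) : E L :=
  Real.sin (θ / 2) • basisVec L 0 - (s * Real.cos (θ / 2)) • basisVec L 1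

/-- The outward unit conormal `-(cos (θ/2), s sin (θ/2), 0)` along the edge of the face labelled `s`
of the standard wedge of angle `θ`. -/
def edgeConormal (L : ℕ) (θ s : ℝ) : E L :=
  -(Real.cos (θ / 2) • basisVec L 0 + (s * Real.sin (θ / 2)) • basisVec L 1)

/-- The standard `m`-dimensional wedge domain `Ω_θ^m × 0^{L-m}` in `ℝ^L`, of wedge angle
`θ ∈ (0, π]`: the intersection of two closed half-spaces of `ℝ^m`.
It is the closure of `{x_0 > 0, |x_1| < tan (θ/2) x_0}` in `ℝ^m` if `θ < π`,
and the half-space `{x_0 ≥ 0}` if `θ = π`. -/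
def wedge (L m : ℕ) (θ : ℝ) : Set (E L) :=
  {x | x ∈ coordSubspace L m ∧
    0 ≤ inner ℝ (faceNormal L θ 1) x ∧ 0 ≤ inner ℝ (faceNormal L θ (-1)) x}

/-- `φ` is a local model of `M` around `p` with model set `Ω`: a diffeomorphism from an open
neighbourhood of `0` onto an open neighbourhood of `p`, which sends `0` to `p`, whose differential
at `0` is an orthogonal transformation, and which takes `Ω` to `M` inside these neighbourhoods. -/
structure IsLocalModel {L : ℕ} (M Ω : Set (E L)) (p : E L)
    (φ : OpenPartialHomeomorph (E L) (E L)) : Prop where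
  zero_mem : (0 : E L) ∈ φ.source
  map_zero : φ 0 = p
  smooth : ContDiffOn ℝ ∞ φ φ.source
  smooth_symm : ContDiffOn ℝ ∞ φ.symm φ.target
  orthogonal : ∀ u v : E L, inner ℝ (fderiv ℝ φ 0 u) (fderiv ℝ φ 0 v) = inner ℝ u v
  image_eq : φ '' (Ω ∩ φ.source) = M ∩ φ.target

/-- `p` is a boundary point of the `m`-dimensional `M` at which `M` has wedge angle `θ`. -/
def HasWedgeAngle {L : ℕ} (m : ℕ) (M : Set (E L)) (p : E L) (θ : ℝ) : Prop :=
  0 < θ ∧ θ ≤ Real.pi ∧ ∃ φ, IsLocalModel M (wedge L m θ) p φ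

/-- `M` is a (smooth) locally wedge-shaped `m`-manifold in `ℝ^L`: around each of its points it has a
local model, which is either `ℝ^m` or an `m`-dimensional wedge domain. -/
def IsLocallyWedgeShaped {L : ℕ} (m : ℕ) (M : Set (E L)) : Prop :=
  ∀ p ∈ M, (∃ φ, IsLocalModel M (coordSubspace L m : Set (E L)) p φ) ∨
    ∃ θ, HasWedgeAngle m M p θ

/-- The face `∂^F M`: the boundary points with wedge angle `π`. -/
def face {L : ℕ} (m : ℕ) (M : Set (E L)) : Set (E L) :=
  {p | p ∈ M ∧ HasWedgeAngle m M p Real.pi}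

/-- The edge `∂^E M`: the boundary points with wedge angle less than `π`. -/
def edge {L : ℕ} (m : ℕ) (M : Set (E L)) : Set (E L) :=
  {p | p ∈ M ∧ ∃ θ, θ < Real.pi ∧ HasWedgeAngle m M p θ}

/-- The second fundamental form at `φ 0`, with respect to the normal vector `ν`, of a submanifold of
`ℝ^L` that is parametrized near `φ 0` by the restriction of `φ` to a linear subspace, evaluated on
`Dφ₀ u` and `Dφ₀ w` for `u`, `w` in that subspace: this is `⟨∇_X Y, ν⟩ = ⟨D²φ₀(u, w), ν⟩`.
For a normal vector `ν` that is tangent to a manifold `M ⊆ ℝ^L` containing the submanifold, it is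
the second fundamental form of the submanifold in `M`, for the induced metric of `M`. -/
def secondFundForm {L : ℕ} (φ : E L → E L) (ν u w : E L) : ℝ :=
  inner ℝ (fderiv ℝ (fderiv ℝ φ) 0 u w) ν

/-- The value `A_{∂^s M}(η_s, v)` at `p = φ 0`, where `φ` is a local model of `M` around an edge point
`p` with wedge angle `θ`, `∂^s M` is the smooth piece of `∂M` near `p` labelled `s`, `A` is its second
fundamental form in `M` with respect to the inward unit normal, `η_s` is its outward unit conormal
along the edge and `v = Dφ₀ w` is tangent to the edge. -/
def faceForm {L : ℕ} (φ : E L → E L) (θ s : ℝ) (w : E L) : ℝ :=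
  secondFundForm φ (fderiv ℝ φ 0 (faceNormal L θ s)) (edgeConormal L θ s) w

/-- At the edge point `q`, the wedge angle is `π/2` and `A_{∂⁺M}(η₊, v) = A_{∂⁻M}(η₋, v)` for all `v`
tangent to the edge (these are the `Dφ₀ w` with `w ∈ 0² × ℝ^{m-2} × 0^{L-m}`). -/
def RightAngleCondition {L : ℕ} (m : ℕ) (M : Set (E L)) (q : E L) : Prop :=
  ∃ φ, IsLocalModel M (wedge L m (Real.pi / 2)) q φ ∧
    ∀ w : E L, w ∈ coordSubspace L m → inner ℝ (basisVec L 0) w = 0 →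
      inner ℝ (basisVec L 1) w = 0 →
      faceForm φ (Real.pi / 2) 1 w = faceForm φ (Real.pi / 2) (-1) w

/-- On each connected component of the edge of `M`, either the wedge angle is everywhere less than
`π/2`, or the wedge angle is everywhere `π/2` and `A_{∂⁺M}(η₊, v) = A_{∂⁻M}(η₋, v)` for all `v`
tangent to the edge. -/
def AngleCondition {L : ℕ} (m : ℕ) (M : Set (E L)) : Prop :=
  ∀ p ∈ edge m M,
    (∀ q ∈ connectedComponentIn (edge m M) p, ∃ θ, θ < Real.pi / 2 ∧ HasWedgeAngle m M q θ) ∨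
    (∀ q ∈ connectedComponentIn (edge m M) p, RightAngleCondition m M q)

/-- `f` is smooth on the subset `A` of `ℝ^L`: locally it is the restriction of a smooth function. -/
def SmoothOnSubset {L : ℕ} (f : E L → ℝ) (A : Set (E L)) : Prop :=
  ∀ x ∈ A, ∃ V : Set (E L), IsOpen V ∧ x ∈ V ∧
    ∃ F : E L → ℝ, ContDiffOn ℝ ∞ F V ∧ EqOn F f (A ∩ V)

/-- The linear space spanned by the tangent vectors of `S` at `x`. For a locally wedge-shaped manifold
it is the tangent space at `x` of a local extension of `S` without boundary. -/
def tangentSpan {L : ℕ} (S : Set (E L)) (x : E L) : Submodule ℝ (E L) :=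
  Submodule.span ℝ (tangentConeAt ℝ S x)

/-- `ν` is a unit normal of `S` in `M` at `x`. -/
def IsUnitNormal {L : ℕ} (M S : Set (E L)) (x ν : E L) : Prop :=
  ‖ν‖ = 1 ∧ ν ∈ tangentSpan M x ∧ ∀ w ∈ tangentSpan S x, inner ℝ ν w = 0

/-- The `n`-dimensional locally wedge-shaped manifold `S` has mean curvature `h` at `x` with respect
to the normal vector `ν`: the trace of the second fundamental form over the orthonormal basis
`Dψ₀ e_0, …, Dψ₀ e_{n-1}` of the tangent space, for a local model `ψ` of `S` around `x`. (With this
sign a round sphere has positive mean curvature with respect to the normal pointing to its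
centre.) -/
def HasMeanCurvature {L : ℕ} (n : ℕ) (S : Set (E L)) (x ν : E L) (h : ℝ) : Prop :=
  ∃ ψ : OpenPartialHomeomorph (E L) (E L),
    (IsLocalModel S (coordSubspace L n : Set (E L)) x ψ ∨
      ∃ θ, 0 < θ ∧ θ ≤ Real.pi ∧ IsLocalModel S (wedge L n θ) x ψ) ∧
    h = ∑ i ∈ Finset.range n, secondFundForm ψ ν (basisVec L i) (basisVec L i)

/-- The hypersurface `S ⊆ M`, contained in a level set of `d`, is strictly mean convex as seen from
the side where `d` is smaller: at each of its points the mean curvature with respect to the unit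
normal of `S` in `M` in the direction of which `d` decreases is positive. -/
def IsStrictlyMeanConvex {L : ℕ} (n : ℕ) (M S : Set (E L)) (d : E L → ℝ) : Prop :=
  ∀ x ∈ S, ∃ ν : E L, IsUnitNormal M S x ν ∧
    (∃ D : E L →L[ℝ] ℝ, HasFDerivWithinAt d D M x ∧ D ν < 0) ∧
    ∃ h, HasMeanCurvature n S x ν h ∧ 0 < h

/-- `ν` is the inward unit normal in `M` at the boundary point `x` of one of the smooth pieces of `∂M`
through `x` (there are two such pieces if `x` is an edge point, one if `x` is a face point). -/
def IsFaceNormal {L : ℕ} (m : ℕ) (M : Set (E L)) (x ν : E L) : Prop :=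
  ∃ θ φ, 0 < θ ∧ θ ≤ Real.pi ∧ IsLocalModel M (wedge L m θ) x φ ∧
    (ν = fderiv ℝ φ 0 (faceNormal L θ 1) ∨ ν = fderiv ℝ φ 0 (faceNormal L θ (-1)))

/-- `S ⊆ M` meets `∂M` orthogonally, also at the edge: at every common point `x`, the normals in `M` of
all smooth pieces of `∂M` through `x` are tangent to `S`. -/
def MeetsBoundaryOrthogonally {L : ℕ} (m : ℕ) (M S : Set (E L)) : Prop :=
  ∀ x ∈ S, ∀ ν, IsFaceNormal m M x ν → ν ∈ tangentSpan S x

/-- The set `{q ∈ M : d q = t}`, for a function `d` defined on the relatively open subset `M ∩ U` of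
`M`. -/
def levelSet {L : ℕ} (M U : Set (E L)) (d : E L → ℝ) (t : ℝ) : Set (E L) :=
  {q | q ∈ M ∩ U ∧ d q = t}

end

end WedgeShaped

open WedgeShaped

namespace WedgeShaped

open Set Filter Topology
open scoped ContDiff

/-! ### Linear algebra of the standard wedges -/

section Wedge

variable {L : ℕ}

/-! Work in a local model `φ` at `p`, with the metric on `ℝ^{n+1}` pulled back from `M`; at the
centre it is Euclidean. Let `a`, `b` be the inward unit normals of the two faces of the model wedge,
and let `U`, `V` be the metric gradients of the linear functions `⟨a, ·⟩`, `⟨b, ·⟩`, so that `U` and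
`V` are normal to the faces. Write `UF` for the derivative of `F` along `U`. The squared distance is
sought in the form `F = ‖x‖² + R`, where `R` has vanishing 2-jet at `0`, `UF = 0` on `{⟨a, x⟩ = 0}`
and `VF = 0` on `{⟨b, x⟩ = 0}`; then `d = √F`. Vanishing of the 2-jet keeps the Hessian close to
that of `‖x‖²`, so small level sets are strictly convex. Tangency of the gradient to the faces makes
the level sets meet the boundary orthogonally.

Construction of `R`. Solving a 2×2 linear system (`exists_edge_correction`) gives `A`, `B` with
vanishing 1-jet such that `F₀ = ‖x‖² - ⟨a, x⟩A - ⟨b, x⟩B` satisfies `UF₀ = -⟨b, x⟩ UB` on the first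
face and `VF₀ = -⟨a, x⟩ VA` on the second. These errors vanish on the edge. If the angle is acute,
`⟨b, U⟩` and `⟨a, V⟩` are nonzero near `0`, and the errors are removed separately by multiples of
`⟨b, x⟩²` and `⟨a, x⟩²` (`exists_twoFlat_of_oblique`). If the angle is right along the edge, these
coefficients vanish there, and a single term `⟨a, x⟩⟨b, x⟩C` must remove both errors. This
prescribes `C` on both faces, and the prescriptions agree on the edge if and only if `⟨a, U⟩ VA =
⟨b, V⟩ UB` there. Commuting the derivatives of `F₀` along `U` and `V` shows that this holds when the
bracket `[U, V]` lies in the span of `U`, `V` (`edge_compatibility`), and the condition (‡) on the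
second fundamental forms supplies exactly that (`bracket_eq_combination`). Since (‡) is stated in a
local model centred at each edge point, `right_angle_in_chart` first transfers it to the fixed chart
`φ`.

Level sets. At a point of a level set, a metric-orthonormal frame is chosen whose last vector is the
unit normal of the level set and in which the tangent cone of the wedge is a standard model
(`exists_adapted_frame`). Coordinates that make `F` affine on `ℝ^{n+1}` while moving points only in
the last direction preserve this model (`exists_straightening`). Hence the level set and `M` have
local models of the same type and with the same differential
(`IsSquaredDistance.exists_localModels`). Faces, edges, orthogonality and the sign of the curvature
are all read off from this. -/

lemma basisVec_eq_single {i : ℕ} (h : i < L) :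
    basisVec L i = EuclideanSpace.single (⟨i, h⟩ : Fin L) (1 : ℝ) := by
  ext j
  simp [basisVec, Fin.ext_iff]

lemma basisVec_eq_zero {i : ℕ} (h : L ≤ i) : basisVec L i = 0 := by
  ext j
  have : (j : ℕ) ≠ i := by omega
  simp [basisVec, this]

lemma inner_basisVec {i : ℕ} (h : i < L) (x : E L) : inner ℝ (basisVec L i) x = x ⟨i, h⟩ := by
  rw [basisVec_eq_single h, EuclideanSpace.inner_single_left]
  simp

lemma inner_basisVec_basisVec {i : ℕ} (h : i < L) (j : ℕ) :
    inner ℝ (basisVec L i) (basisVec L j) = if i = j then 1 else 0 := by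
  rw [inner_basisVec h]
  simp [basisVec]

lemma mem_coordSubspace {m : ℕ} {x : E L} :
    x ∈ coordSubspace L m ↔ ∀ i, m ≤ i → inner ℝ (basisVec L i) x = 0 := by
  constructor
  · intro hx i hi
    by_cases h : i < L
    · rw [inner_basisVec h]
      exact hx ⟨i, h⟩ hi
    · rw [basisVec_eq_zero (not_lt.1 h), inner_zero_left]
  · intro hx i hi
    rw [← inner_basisVec i.2, hx i hi]

lemma basisVec_mem {i m : ℕ} (h : i < m) : basisVec L i ∈ coordSubspace L m := by
  intro j hj
  have : (j : ℕ) ≠ i := by omega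
  simp [basisVec, this]

lemma mem_coordSubspace_succ {n : ℕ} {x : E L} :
    x ∈ coordSubspace L n ↔ x ∈ coordSubspace L (n + 1) ∧ inner ℝ (basisVec L n) x = 0 := by
  simp only [mem_coordSubspace]
  constructor
  · exact fun h => ⟨fun i hi => h i (by omega), h n le_rfl⟩
  · rintro ⟨h, h'⟩ i hi
    rcases hi.eq_or_lt with rfl | hi
    · exact h'
    · exact h i hi

lemma inner_faceNormal (θ s : ℝ) (x : E L) :
    inner ℝ (faceNormal L θ s) x = Real.sin (θ / 2) * inner ℝ (basisVec L 0) x -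
      s * Real.cos (θ / 2) * inner ℝ (basisVec L 1) x := by
  simp [faceNormal, inner_sub_left, inner_smul_left]

lemma faceNormal_mem {m : ℕ} (hm : 2 ≤ m) (θ s : ℝ) : faceNormal L θ s ∈ coordSubspace L m :=
  sub_mem (Submodule.smul_mem _ _ (basisVec_mem (by omega)))
    (Submodule.smul_mem _ _ (basisVec_mem (by omega)))

lemma inner_faceNormal_faceNormal (hL : 2 ≤ L) (θ s s' : ℝ) :
    inner ℝ (faceNormal L θ s) (faceNormal L θ s') =
      Real.sin (θ / 2) ^ 2 + s * s' * Real.cos (θ / 2) ^ 2 := by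
  rw [inner_faceNormal, real_inner_comm, real_inner_comm _ (basisVec L 1), inner_faceNormal,
    inner_faceNormal]
  simp only [inner_basisVec_basisVec (show 0 < L by omega),
    inner_basisVec_basisVec (show 1 < L by omega)]
  norm_num
  ring

lemma inner_faceNormal_self (hL : 2 ≤ L) (θ : ℝ) {s : ℝ} (hs : s * s = 1) :
    inner ℝ (faceNormal L θ s) (faceNormal L θ s) = 1 := by
  rw [inner_faceNormal_faceNormal hL, hs, one_mul, Real.sin_sq_add_cos_sq]

lemma inner_faceNormal_neg (hL : 2 ≤ L) (θ : ℝ) :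
    inner ℝ (faceNormal L θ 1) (faceNormal L θ (-1)) = -Real.cos θ := by
  rw [inner_faceNormal_faceNormal hL]
  have h := Real.cos_two_mul (θ / 2)
  have h' := Real.sin_sq_add_cos_sq (θ / 2)
  rw [mul_div_cancel₀ θ (two_ne_zero)] at h
  linarith

lemma faceNormal_pi (s : ℝ) : faceNormal L Real.pi s = basisVec L 0 := by
  simp [faceNormal]

/-- The half-angle is `π/4`, where sine and cosine agree. This turns (‡) into an equality of two
mixed second derivatives of the chart, each paired with the image of a face normal. -/
lemma edgeConormal_right_angle (s : ℝ) :
    edgeConormal L (Real.pi / 2) s = -faceNormal L (Real.pi / 2) (-s) := by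
  have h : Real.pi / 2 / 2 = Real.pi / 4 := by ring
  simp [edgeConormal, faceNormal, h, Real.cos_pi_div_four, Real.sin_pi_div_four]

lemma sin_half_pos {θ : ℝ} (h0 : 0 < θ) (hπ : θ ≤ Real.pi) : 0 < Real.sin (θ / 2) :=
  Real.sin_pos_of_pos_of_lt_pi (by linarith) (by linarith [Real.pi_pos])

lemma cos_half_pos {θ : ℝ} (h0 : 0 < θ) (hπ : θ < Real.pi) : 0 < Real.cos (θ / 2) :=
  Real.cos_pos_of_mem_Ioo ⟨by linarith [Real.pi_pos], by linarith⟩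

lemma mem_wedge {m : ℕ} {θ : ℝ} {x : E L} : x ∈ wedge L m θ ↔ x ∈ coordSubspace L m ∧
    0 ≤ inner ℝ (faceNormal L θ 1) x ∧ 0 ≤ inner ℝ (faceNormal L θ (-1)) x := Iff.rfl

lemma isClosed_coordSubspace (m : ℕ) : IsClosed (coordSubspace L m : Set (E L)) :=
  Submodule.closed_of_finiteDimensional _

lemma isClosed_wedge (m : ℕ) (θ : ℝ) : IsClosed (wedge L m θ) := by
  have h : ∀ s, IsClosed {x : E L | 0 ≤ inner ℝ (faceNormal L θ s) x} :=
    fun s => isClosed_le continuous_const (by fun_prop)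
  have h' : wedge L m θ = (coordSubspace L m : Set (E L)) ∩
      ({x | 0 ≤ inner ℝ (faceNormal L θ 1) x} ∩ {x | 0 ≤ inner ℝ (faceNormal L θ (-1)) x}) := by
    ext; rfl
  rw [h']
  exact (isClosed_coordSubspace m).inter ((h 1).inter (h (-1)))

lemma smul_mem_wedge {m : ℕ} {θ : ℝ} {x : E L} (hx : x ∈ wedge L m θ) {c : ℝ} (hc : 0 ≤ c) :
    c • x ∈ wedge L m θ :=
  ⟨Submodule.smul_mem _ _ hx.1, by rw [inner_smul_right]; exact mul_nonneg hc hx.2.1,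
    by rw [inner_smul_right]; exact mul_nonneg hc hx.2.2⟩

lemma zero_mem_wedge (m : ℕ) (θ : ℝ) : (0 : E L) ∈ wedge L m θ :=
  ⟨zero_mem _, by simp, by simp⟩

lemma mem_wedge_succ {n : ℕ} {θ : ℝ} {x : E L} :
    x ∈ wedge L n θ ↔ x ∈ wedge L (n + 1) θ ∧ inner ℝ (basisVec L n) x = 0 := by
  rw [mem_wedge, mem_wedge, mem_coordSubspace_succ]
  tauto

lemma inner_faceNormal_basisVec {n : ℕ} (hn : 2 ≤ n) (θ s : ℝ) :
    inner ℝ (faceNormal L θ s) (basisVec L n) = 0 := by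
  by_cases h : n < L
  · rw [inner_faceNormal, inner_basisVec_basisVec (by omega), inner_basisVec_basisVec (by omega)]
    simp [show ¬ 0 = n by omega, show ¬ 1 = n by omega]
  · rw [basisVec_eq_zero (not_lt.1 h), inner_zero_right]

/-- For `n ≥ 2` the coordinate `x_n` is an edge direction, which neither face inequality sees. This
direction is reserved for the normal of the level sets. -/
lemma add_smul_basisVec_mem_wedge_iff {n : ℕ} (hn : 2 ≤ n) {θ : ℝ} (x : E L) (c : ℝ) :
    x + c • basisVec L n ∈ wedge L (n + 1) θ ↔ x ∈ wedge L (n + 1) θ := by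
  have h : c • basisVec L n ∈ coordSubspace L (n + 1) :=
    Submodule.smul_mem _ _ (basisVec_mem (by omega))
  simp only [mem_wedge, inner_add_right, inner_smul_right, inner_faceNormal_basisVec hn, mul_zero,
    add_zero, Submodule.add_mem_iff_left _ h]

/-- Far enough in the direction of the axis of a wedge, one is inside of it. -/
lemma exists_add_smul_mem_wedge {m : ℕ} (hm : 1 ≤ m) (hL : 2 ≤ L) {θ : ℝ} (h0 : 0 < θ)
    (hπ : θ ≤ Real.pi) {x : E L} (hx : x ∈ coordSubspace L m) :
    ∃ R : ℝ, 0 ≤ R ∧ R • basisVec L 0 ∈ wedge L m θ ∧ x + R • basisVec L 0 ∈ wedge L m θ := by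
  have hs := sin_half_pos h0 hπ
  have hi : ∀ s : ℝ, inner ℝ (faceNormal L θ s) (basisVec L 0) = Real.sin (θ / 2) := by
    intro s
    rw [inner_faceNormal, inner_basisVec_basisVec (by omega), inner_basisVec_basisVec (by omega)]
    simp
  have h00 : basisVec L 0 ∈ coordSubspace L m := basisVec_mem (by omega)
  set u := inner ℝ (faceNormal L θ 1) x
  set v := inner ℝ (faceNormal L θ (-1)) x
  have hR : 0 ≤ (|u| + |v|) / Real.sin (θ / 2) := by positivity
  have hR' : (|u| + |v|) / Real.sin (θ / 2) * Real.sin (θ / 2) = |u| + |v| := by field_simp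
  refine ⟨(|u| + |v|) / Real.sin (θ / 2), hR, ?_, ?_⟩
  · refine smul_mem_wedge ⟨h00, ?_, ?_⟩ hR <;> rw [hi] <;> exact hs.le
  · refine ⟨add_mem hx (Submodule.smul_mem _ _ h00), ?_, ?_⟩ <;>
      rw [inner_add_right, inner_smul_right, hi, hR']
    · linarith [neg_abs_le u, abs_nonneg v]
    · linarith [neg_abs_le v, abs_nonneg u]

lemma span_wedge {m : ℕ} (hm : 1 ≤ m) (hL : 2 ≤ L) {θ : ℝ} (h0 : 0 < θ) (hπ : θ ≤ Real.pi) :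
    Submodule.span ℝ (wedge L m θ) = coordSubspace L m := by
  refine le_antisymm (Submodule.span_le.2 fun x hx => hx.1) fun x hx => ?_
  obtain ⟨R, -, h1, h2⟩ := exists_add_smul_mem_wedge hm hL h0 hπ hx
  have := sub_mem (Submodule.subset_span (R := ℝ) h2) (Submodule.subset_span (R := ℝ) h1)
  simpa using this

/-- Comparability of any two elements is a property of cones invariant under linear isomorphisms. It
holds for half-spaces and fails for proper wedges, and so separates faces from edges. -/
lemma sub_mem_wedge_pi_or {m : ℕ} {x y : E L} (hx : x ∈ wedge L m Real.pi)
    (hy : y ∈ wedge L m Real.pi) : x - y ∈ wedge L m Real.pi ∨ y - x ∈ wedge L m Real.pi := by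
  simp only [mem_wedge, faceNormal_pi, and_self, inner_sub_right, sub_nonneg] at *
  rcases le_total (inner ℝ (basisVec L 0) x) (inner ℝ (basisVec L 0) y) with h | h
  · exact Or.inr ⟨sub_mem hy.1 hx.1, h⟩
  · exact Or.inl ⟨sub_mem hx.1 hy.1, h⟩

/-- The two witnesses differ by `basisVec L 1`; since `cos (θ/2) > 0`, this vector violates one face
inequality and its opposite violates the other. -/
lemma exists_sub_notMem_wedge {m : ℕ} (hm : 2 ≤ m) (hL : 2 ≤ L) {θ : ℝ} (h0 : 0 < θ)
    (hπ : θ < Real.pi) : ∃ x ∈ wedge L m θ, ∃ y ∈ wedge L m θ,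
      x - y ∉ wedge L m θ ∧ y - x ∉ wedge L m θ := by
  have h1 : basisVec L 1 ∈ coordSubspace L m := basisVec_mem (by omega)
  obtain ⟨R, -, h2, h3⟩ := exists_add_smul_mem_wedge (by omega) hL h0 hπ.le h1
  have hc := cos_half_pos h0 hπ
  have hi : ∀ s : ℝ, inner ℝ (faceNormal L θ s) (basisVec L 1) = - s * Real.cos (θ / 2) := by
    intro s
    rw [inner_faceNormal, inner_basisVec_basisVec (by omega), inner_basisVec_basisVec (by omega)]
    simp
  refine ⟨_, h3, _, h2, ?_, ?_⟩
  · rintro ⟨-, h, -⟩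
    rw [add_sub_cancel_right, hi] at h
    linarith
  · rintro ⟨-, -, h⟩
    rw [sub_add_cancel_right, inner_neg_right, hi] at h
    linarith

lemma exists_neg_notMem_wedge {m : ℕ} (hm : 1 ≤ m) (hL : 2 ≤ L) {θ : ℝ} (h0 : 0 < θ)
    (hπ : θ ≤ Real.pi) : ∃ x ∈ wedge L m θ, -x ∉ wedge L m θ := by
  have hs := sin_half_pos h0 hπ
  have hi : ∀ s : ℝ, inner ℝ (faceNormal L θ s) (basisVec L 0) = Real.sin (θ / 2) := by
    intro s
    rw [inner_faceNormal, inner_basisVec_basisVec (by omega), inner_basisVec_basisVec (by omega)]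
    simp
  refine ⟨basisVec L 0, ⟨basisVec_mem (by omega), ?_, ?_⟩, fun h => ?_⟩
  · rw [hi]; exact hs.le
  · rw [hi]; exact hs.le
  · have := h.2.1
    rw [inner_neg_right, hi] at this
    linarith

end Wedge

/-! ### Local models, their differentials and tangent spaces -/

section LocalModels

variable {L : ℕ}

lemma IsLocalModel.mem_iff {M Ω : Set (E L)} {p : E L} {φ : OpenPartialHomeomorph (E L) (E L)}
    (h : IsLocalModel M Ω p φ) {x : E L} (hx : x ∈ φ.source) : φ x ∈ M ↔ x ∈ Ω := by
  constructor
  · intro hM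
    have : φ x ∈ φ '' (Ω ∩ φ.source) := h.image_eq ▸ ⟨hM, φ.map_source hx⟩
    obtain ⟨y, hy, hxy⟩ := this
    rw [← φ.injOn hy.2 hx hxy]
    exact hy.1
  · intro hΩ
    have : φ x ∈ M ∩ φ.target := h.image_eq ▸ mem_image_of_mem φ ⟨hΩ, hx⟩
    exact this.1

/-- The inverse function theorem for smooth functions, with a smooth inverse. -/
lemma exists_smooth_openPartialHomeomorph {f : E L → E L} {x₀ : E L} {B : E L ≃L[ℝ] E L}
    {s : Set (E L)} (hs : s ∈ 𝓝 x₀) (hf : ∀ᶠ x in 𝓝 x₀, ContDiffAt ℝ ∞ f x)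
    (hB : HasFDerivAt f (B : E L →L[ℝ] E L) x₀) :
    ∃ φ : OpenPartialHomeomorph (E L) (E L), (φ : E L → E L) = f ∧ x₀ ∈ φ.source ∧
      φ.source ⊆ s ∧ ContDiffOn ℝ ∞ φ φ.source ∧ ContDiffOn ℝ ∞ φ.symm φ.target := by
  have h0 : ContDiffAt ℝ ∞ f x₀ := hf.self_of_nhds
  have hn : (∞ : WithTop ℕ∞) ≠ 0 := by simp
  have hcont : ContinuousAt (fderiv ℝ f) x₀ :=
    (h0.fderiv_right (m := 0) (by simp)).continuousAt
  -- Invertibility of the derivative is an open condition, so after shrinking the source the inverse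
  -- is smooth on the whole target and not only at one point.
  have hinv : ∀ᶠ x in 𝓝 x₀, ∃ B' : E L ≃L[ℝ] E L, (B' : E L →L[ℝ] E L) = fderiv ℝ f x := by
    have := B.nhds
    rw [← hB.fderiv] at this
    exact hcont this
  obtain ⟨t, ht, hto, hxt⟩ := eventually_nhds_iff.1 (hinv.and (hf.and hs))
  refine ⟨(h0.toOpenPartialHomeomorph f hB hn).restrOpen t hto, rfl,
    ⟨h0.mem_toOpenPartialHomeomorph_source hB hn, hxt⟩, fun x hx => (ht x hx.2).2.2,
    fun x hx => (ht x hx.2).2.1.contDiffWithinAt, fun y hy => ?_⟩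
  set φ := (h0.toOpenPartialHomeomorph f hB hn).restrOpen t hto
  have hx := φ.map_target hy
  obtain ⟨⟨B', hB'⟩, hsm, -⟩ := ht _ hx.2
  refine (φ.contDiffAt_symm (f₀' := B') hy ?_ hsm).contDiffWithinAt
  rw [hB']
  exact (hsm.differentiableAt hn).hasFDerivAt

lemma exists_isLocalModel {S Ω : Set (E L)} {ψ : E L → E L} {p : E L} (O : E L ≃ₗᵢ[ℝ] E L)
    (hψ : ∀ᶠ y in 𝓝 0, ContDiffAt ℝ ∞ ψ y)
    (hO : HasFDerivAt ψ (O.toContinuousLinearEquiv : E L →L[ℝ] E L) 0) (hp : ψ 0 = p)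
    (hS : ∀ᶠ y in 𝓝 0, ψ y ∈ S ↔ y ∈ Ω) :
    ∃ φ, IsLocalModel S Ω p φ ∧ (φ : E L → E L) = ψ := by
  obtain ⟨φ, hφ, h0, hs, h1, h2⟩ := exists_smooth_openPartialHomeomorph hS hψ hO
  refine ⟨φ, ⟨h0, by rw [hφ, hp], h1, h2, ?_, ?_⟩, hφ⟩
  · intro u v
    rw [hφ, hO.fderiv]
    exact O.inner_map_map u v
  · ext q
    constructor
    · rintro ⟨y, ⟨hy, hys⟩, rfl⟩
      refine ⟨?_, φ.map_source hys⟩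
      rw [hφ]
      exact (hs hys).2 hy
    · rintro ⟨hqS, hqt⟩
      refine ⟨φ.symm q, ⟨(hs (φ.map_target hqt)).1 ?_, φ.map_target hqt⟩, φ.right_inv hqt⟩
      rw [← hφ, φ.right_inv hqt]
      exact hqS

lemma exists_equiv_hasFDerivAt {φ : OpenPartialHomeomorph (E L) (E L)}
    (h1 : ContDiffOn ℝ ∞ φ φ.source) (h2 : ContDiffOn ℝ ∞ φ.symm φ.target) {x : E L}
    (hx : x ∈ φ.source) : ∃ B : E L ≃L[ℝ] E L, HasFDerivAt φ (B : E L →L[ℝ] E L) x ∧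
      HasFDerivAt φ.symm (B.symm : E L →L[ℝ] E L) (φ x) := by
  have d1 : HasFDerivAt φ (fderiv ℝ φ x) x :=
    ((h1.contDiffAt (φ.open_source.mem_nhds hx)).differentiableAt (by simp)).hasFDerivAt
  have d2 : HasFDerivAt φ.symm (fderiv ℝ φ.symm (φ x)) (φ x) :=
    ((h2.contDiffAt (φ.open_target.mem_nhds (φ.map_source hx))).differentiableAt
      (by simp)).hasFDerivAt
  have d2' : HasFDerivAt φ (fderiv ℝ φ x) (φ.symm (φ x)) := by rwa [φ.left_inv hx]
  have e1 : (fderiv ℝ φ.symm (φ x)).comp (fderiv ℝ φ x) = ContinuousLinearMap.id ℝ (E L) :=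
    (d2.comp x d1).unique ((hasFDerivAt_id x).congr_of_eventuallyEq
      (φ.eventually_left_inverse hx))
  have e2 : (fderiv ℝ φ x).comp (fderiv ℝ φ.symm (φ x)) = ContinuousLinearMap.id ℝ (E L) :=
    (d2'.comp (φ x) d2).unique ((hasFDerivAt_id (φ x)).congr_of_eventuallyEq
      (φ.eventually_right_inverse (φ.map_source hx)))
  exact ⟨ContinuousLinearEquiv.equivOfInverse (fderiv ℝ φ x) (fderiv ℝ φ.symm (φ x))
    (fun v => congrArg (fun A : E L →L[ℝ] E L => A v) e1)
    (fun v => congrArg (fun A : E L →L[ℝ] E L => A v) e2), d1, d2⟩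

/-- The change of coordinates between two parametrizations of the same set. -/
lemma hasFDerivAt_transition {φ χ : OpenPartialHomeomorph (E L) (E L)} {M Ω Ω' : Set (E L)}
    (hφ : ∀ x ∈ φ.source, φ x ∈ M ↔ x ∈ Ω) (hχ : ∀ x ∈ χ.source, χ x ∈ M ↔ x ∈ Ω')
    {x y : E L} (hx : x ∈ φ.source) (hy : y ∈ χ.source) (hxy : φ x = χ y)
    {B C : E L ≃L[ℝ] E L} (hB : HasFDerivAt φ.symm (B.symm : E L →L[ℝ] E L) (φ x))
    (hC : HasFDerivAt χ (C : E L →L[ℝ] E L) y) :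
    HasFDerivAt (φ.symm ∘ χ) ((C.trans B.symm : E L ≃L[ℝ] E L) : E L →L[ℝ] E L) y ∧
      (φ.symm ∘ χ) y = x ∧
      ∀ᶠ z in 𝓝 y, χ z = φ ((φ.symm ∘ χ) z) ∧ ((φ.symm ∘ χ) z ∈ Ω ↔ z ∈ Ω') := by
  rw [hxy] at hB
  refine ⟨hB.comp y hC, by simp [← hxy, φ.left_inv hx], ?_⟩
  have h1 : ∀ᶠ z in 𝓝 y, χ z ∈ φ.target :=
    (χ.continuousAt hy).eventually (φ.open_target.mem_nhds (hxy ▸ φ.map_source hx))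
  filter_upwards [h1, χ.open_source.mem_nhds hy] with z hz hzs
  refine ⟨(φ.right_inv hz).symm, ?_⟩
  rw [Function.comp_apply, ← hφ _ (φ.map_target hz), φ.right_inv hz, hχ z hzs]

/-- The difference quotients along `v` lie in the cone `C`, which is closed, and hence so does their
limit. -/
lemma hasFDerivAt_mem_of_isClosed {X Y : Type*} [NormedAddCommGroup X] [NormedSpace ℝ X]
    [NormedAddCommGroup Y] [NormedSpace ℝ Y] {f : X → Y} {T : X →L[ℝ] Y} {x v : X}
    {C : Set Y} (hT : HasFDerivAt f T x) (hC : IsClosed C)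
    (hC' : ∀ y ∈ C, ∀ c : ℝ, 0 ≤ c → c • y ∈ C)
    (hf : ∀ᶠ s in 𝓝[>] (0 : ℝ), f (x + s • v) - f x ∈ C) : T v ∈ C := by
  have h1 : HasDerivAt (fun s : ℝ => x + s • v) v 0 := by
    simpa using ((hasDerivAt_id (0 : ℝ)).smul_const v).const_add x
  have h2 : HasDerivAt (fun s : ℝ => f (x + s • v)) (T v) 0 := by
    refine HasFDerivAt.comp_hasDerivAt (0 : ℝ) (f := fun s : ℝ => x + s • v) ?_ h1
    simpa using hT
  have h3 := (hasDerivAt_iff_tendsto_slope.1 h2).mono_left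
    (nhdsWithin_mono 0 (fun s (hs : 0 < s) => hs.ne') : 𝓝[>] (0 : ℝ) ≤ 𝓝[≠] 0)
  refine hC.mem_of_tendsto h3 ?_
  filter_upwards [hf, self_mem_nhdsWithin] with s hs hs0
  rw [slope_def_module]
  simpa using hC' _ hs s⁻¹ (inv_nonneg.2 (le_of_lt hs0))

/-- A closed cone with vertex `0`. -/
structure IsClosedCone (Ω : Set (E L)) : Prop where
  isClosed : IsClosed Ω
  zero_mem : (0 : E L) ∈ Ω
  smul_mem : ∀ y ∈ Ω, ∀ c : ℝ, 0 ≤ c → c • y ∈ Ω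

lemma isClosedCone_wedge (m : ℕ) (θ : ℝ) : IsClosedCone (wedge L m θ) :=
  ⟨isClosed_wedge m θ, zero_mem_wedge m θ, fun _ hy _ hc => smul_mem_wedge hy hc⟩

lemma isClosedCone_coordSubspace (m : ℕ) : IsClosedCone (coordSubspace L m : Set (E L)) :=
  ⟨isClosed_coordSubspace m, zero_mem _, fun _ hy _ _ => Submodule.smul_mem _ _ hy⟩

lemma hasFDerivAt_mem_of_mapsTo {f : E L → E L} {T : E L →L[ℝ] E L} {Ω Ω' : Set (E L)}
    (hT : HasFDerivAt f T 0) (h0 : f 0 = 0) (hΩ : IsClosedCone Ω) (hΩ' : IsClosedCone Ω')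
    (hf : ∀ᶠ y in 𝓝 0, y ∈ Ω → f y ∈ Ω') {v : E L} (hv : v ∈ Ω) : T v ∈ Ω' := by
  refine hasFDerivAt_mem_of_isClosed hT hΩ'.isClosed hΩ'.smul_mem ?_
  have h1 : Tendsto (fun s : ℝ => (0 : E L) + s • v) (𝓝[>] 0) (𝓝 0) := by
    have : Continuous (fun s : ℝ => (0 : E L) + s • v) := by fun_prop
    simpa using (this.tendsto 0).mono_left nhdsWithin_le_nhds
  filter_upwards [h1.eventually hf, self_mem_nhdsWithin] with s hs hs0
  rw [h0, sub_zero]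
  exact hs (by simpa using hΩ.smul_mem v hv s (le_of_lt hs0))

lemma IsLocalModel.exists_equiv {M Ω : Set (E L)} {p : E L}
    {φ : OpenPartialHomeomorph (E L) (E L)} (h : IsLocalModel M Ω p φ) :
    ∃ B : E L ≃ₗᵢ[ℝ] E L, HasFDerivAt φ (B.toContinuousLinearEquiv : E L →L[ℝ] E L) 0 ∧
      HasFDerivAt φ.symm (B.toContinuousLinearEquiv.symm : E L →L[ℝ] E L) (φ 0) := by
  obtain ⟨B, h1, h2⟩ := exists_equiv_hasFDerivAt h.smooth h.smooth_symm h.zero_mem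
  have hB : ∀ u, ‖B u‖ = ‖u‖ := by
    intro u
    have := h.orthogonal u u
    rw [h1.fderiv] at this
    rw [← sq_eq_sq₀ (norm_nonneg _) (norm_nonneg _), ← real_inner_self_eq_norm_sq,
      ← real_inner_self_eq_norm_sq]
    exact this
  exact ⟨⟨B.toLinearEquiv, hB⟩, h1, h2⟩

/-- Two local models around the same point differ, to first order, by an isometry between the model
cones. -/
lemma IsLocalModel.exists_isometry {M Ω Ω' : Set (E L)} {p : E L}
    {φ χ : OpenPartialHomeomorph (E L) (E L)} (hφ : IsLocalModel M Ω p φ)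
    (hχ : IsLocalModel M Ω' p χ) (hΩ : IsClosedCone Ω) (hΩ' : IsClosedCone Ω') :
    ∃ T : E L ≃ₗᵢ[ℝ] E L, (∀ v, T v ∈ Ω ↔ v ∈ Ω') ∧
      ∀ v, fderiv ℝ χ 0 v = fderiv ℝ φ 0 (T v) := by
  obtain ⟨B, hB, hB'⟩ := hφ.exists_equiv
  obtain ⟨C, hC, hC'⟩ := hχ.exists_equiv
  have h0 : φ 0 = χ 0 := hφ.map_zero.trans hχ.map_zero.symm
  obtain ⟨d1, e1, f1⟩ := hasFDerivAt_transition (fun x hx => hφ.mem_iff hx)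
    (fun x hx => hχ.mem_iff hx) hφ.zero_mem hχ.zero_mem h0 hB' hC
  obtain ⟨d2, e2, f2⟩ := hasFDerivAt_transition (fun x hx => hχ.mem_iff hx)
    (fun x hx => hφ.mem_iff hx) hχ.zero_mem hφ.zero_mem h0.symm hC' hB
  refine ⟨C.trans B.symm, fun v => ⟨fun hv => ?_, fun hv => ?_⟩, fun v => ?_⟩
  · have := hasFDerivAt_mem_of_mapsTo d2 e2 hΩ hΩ' (f2.mono fun y hy => hy.2.2) hv
    simpa using this
  · exact hasFDerivAt_mem_of_mapsTo d1 e1 hΩ' hΩ (f1.mono fun y hy => hy.2.2) hv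
  · rw [hC.fderiv, hB.fderiv]
    simp

lemma IsLocalModel.not_hasWedgeAngle {m : ℕ} (hm : 1 ≤ m) (hL : 2 ≤ L) {M : Set (E L)}
    {p : E L} {φ : OpenPartialHomeomorph (E L) (E L)}
    (hφ : IsLocalModel M (coordSubspace L m : Set (E L)) p φ) {θ : ℝ} :
    ¬ HasWedgeAngle m M p θ := by
  rintro ⟨h0, hπ, χ, hχ⟩
  obtain ⟨T, hT, -⟩ := hφ.exists_isometry hχ (isClosedCone_coordSubspace m)
    (isClosedCone_wedge m θ)
  obtain ⟨x, hx, hx'⟩ := exists_neg_notMem_wedge (L := L) hm hL h0 hπ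
  refine hx' ((hT _).1 ?_)
  rw [map_neg]
  exact neg_mem ((hT x).2 hx)

/-- The differential of the change between two local models is a linear isometry carrying one cone
onto the other, so the comparability property of the half-space would pass to a proper wedge. -/
lemma HasWedgeAngle.eq_pi {m : ℕ} (hm : 2 ≤ m) (hL : 2 ≤ L) {M : Set (E L)} {p : E L} {θ : ℝ}
    (h : HasWedgeAngle m M p θ) (h' : HasWedgeAngle m M p Real.pi) : θ = Real.pi := by
  obtain ⟨h0, hπ, φ, hφ⟩ := h
  obtain ⟨-, -, χ, hχ⟩ := h'
  by_contra hne
  obtain ⟨T, hT, -⟩ := hχ.exists_isometry hφ (isClosedCone_wedge m Real.pi)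
    (isClosedCone_wedge m θ)
  obtain ⟨x, hx, y, hy, h1, h2⟩ := exists_sub_notMem_wedge (L := L) hm hL h0
    (lt_of_le_of_ne hπ hne)
  rcases sub_mem_wedge_pi_or ((hT x).2 hx) ((hT y).2 hy) with h | h
  · rw [← map_sub, hT] at h
    exact h1 h
  · rw [← map_sub, hT] at h
    exact h2 h

/-- Pulled back by the chart, a tangent vector is a limit of vectors in the span of `Ω`, which is
closed in finite dimension. Conversely each `v ∈ Ω` is tangent to `Ω` at `0` along the segment from
`0` to `v`. -/
lemma tangentSpan_eq_map {S Ω : Set (E L)} {x : E L} {ψ : OpenPartialHomeomorph (E L) (E L)}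
    (h : IsLocalModel S Ω x ψ) (hΩ : IsClosedCone Ω) :
    tangentSpan S x = (Submodule.span ℝ Ω).map (fderiv ℝ ψ 0 : E L →ₗ[ℝ] E L) := by
  obtain ⟨B, hB, hB'⟩ := h.exists_equiv
  have hx : x ∈ ψ.target := h.map_zero ▸ ψ.map_source h.zero_mem
  have hx0 : ψ.symm x = 0 := by rw [← h.map_zero, ψ.left_inv h.zero_mem]
  rw [hB.fderiv]
  apply le_antisymm
  · refine Submodule.span_le.2 fun w hw => ?_
    rw [← tangentConeAt_inter_nhds (ψ.open_target.mem_nhds hx)] at hw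
    rw [h.map_zero] at hB'
    have h1 := (hB'.hasFDerivWithinAt (s := S ∩ ψ.target)).mapsTo_tangent_cone hw
    have h2 : ψ.symm '' (S ∩ ψ.target) ⊆ (Submodule.span ℝ Ω : Set (E L)) := by
      rintro _ ⟨q, hq, rfl⟩
      refine Submodule.subset_span ?_
      rw [← h.mem_iff (ψ.map_target hq.2), ψ.right_inv hq.2]
      exact hq.1
    have h3 := tangentConeAt_mono h2 h1
    rw [hx0] at h3
    obtain ⟨α, l, hl, c, d, -, hd, hcd⟩ := exists_fun_of_mem_tangentConeAt h3
    have h4 := (Submodule.closed_of_finiteDimensional (Submodule.span ℝ Ω)).mem_of_tendsto hcd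
      (hd.mono fun n hn => Submodule.smul_mem _ _ (by simpa using hn))
    exact ⟨_, h4, B.apply_symm_apply w⟩
  · rw [Submodule.map_span, Submodule.span_le]
    rintro _ ⟨v, hv, rfl⟩
    refine Submodule.subset_span ?_
    have h1 : v ∈ tangentConeAt ℝ (Ω ∩ ψ.source) 0 := by
      rw [tangentConeAt_inter_nhds (ψ.open_source.mem_nhds h.zero_mem)]
      have : segment ℝ 0 v ⊆ Ω := by
        rw [segment_eq_image']
        rintro _ ⟨s, hs, rfl⟩
        simpa using hΩ.smul_mem v hv s hs.1
      simpa using mem_tangentConeAt_of_segment_subset this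
    have h2 := (hB.hasFDerivWithinAt (s := Ω ∩ ψ.source)).mapsTo_tangent_cone h1
    rw [h.image_eq, h.map_zero] at h2
    exact tangentConeAt_mono inter_subset_left h2

/-- Orthonormal frames adapted to a subspace, with some prescribed vectors. -/
lemma exists_isometry_of_orthonormal {m : ℕ} (hmL : m ≤ L) {W : Submodule ℝ (E L)}
    (hW : Module.finrank ℝ W = m) {s : Set (Fin m)} {v : Fin m → E L} (hv : ∀ i, v i ∈ W)
    (hs : ∀ i ∈ s, ∀ j ∈ s, inner ℝ (v i) (v j) = if i = j then 1 else 0) :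
    ∃ O : E L ≃ₗᵢ[ℝ] E L, (∀ i ∈ s, O (basisVec L i) = v i) ∧
      ∀ y, O y ∈ W ↔ y ∈ coordSubspace L m := by
  classical
  have h1 : Orthonormal ℝ (s.domRestrict fun i => (⟨v i, hv i⟩ : W)) := by
    rw [orthonormal_iff_ite]
    rintro ⟨i, hi⟩ ⟨j, hj⟩
    simpa [Submodule.coe_inner] using hs i hi j hj
  obtain ⟨b, hb⟩ := h1.exists_orthonormalBasis_extension_of_card_eq (by simpa using hW)
  let w : Fin L → E L := fun i => if h : (i : ℕ) < m then (b ⟨i, h⟩ : E L) else 0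
  have h2 : Orthonormal ℝ (({i | (i : ℕ) < m} : Set (Fin L)).domRestrict w) := by
    rw [orthonormal_iff_ite]
    rintro ⟨i, hi⟩ ⟨j, hj⟩
    have := orthonormal_iff_ite.1 b.orthonormal ⟨i, hi⟩ ⟨j, hj⟩
    simp only [mem_ofPred_eq] at hi hj
    simp only [domRestrict_apply, w, dif_pos hi, dif_pos hj, ← Submodule.coe_inner, this]
    simp [Fin.ext_iff]
  obtain ⟨c, hc⟩ := h2.exists_orthonormalBasis_extension_of_card_eq (by simp)
  let O : E L ≃ₗᵢ[ℝ] E L := c.repr.symm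
  have hO : ∀ (i : ℕ) (hi : i < m), O (basisVec L i) = b ⟨i, hi⟩ := by
    intro i hi
    have hiL : i < L := hi.trans_le hmL
    rw [basisVec_eq_single hiL]
    simp only [O, OrthonormalBasis.repr_symm_single]
    rw [hc ⟨i, hiL⟩ hi]
    simp [w, hi]
  have hle : (coordSubspace L m).map (O.toLinearEquiv : E L →ₗ[ℝ] E L) ≤ W := by
    rintro _ ⟨y, hy, rfl⟩
    have hy' : y = ∑ i : Fin L, y i • basisVec L i := by
      ext j
      simp [basisVec, Fin.val_inj]
    rw [hy']
    simp only [LinearEquiv.coe_coe, map_sum, map_smul]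
    refine sum_mem fun i _ => ?_
    by_cases hi : (i : ℕ) < m
    · refine W.smul_mem _ ?_
      have := hO i hi
      simp only [LinearIsometryEquiv.coe_toLinearEquiv]
      rw [this]
      exact Subtype.coe_prop _
    · rw [hy i (not_lt.1 hi), zero_smul]
      exact zero_mem _
  refine ⟨O, fun i hi => by rw [hO i i.2, hb i hi], fun y => ⟨fun hy => ?_, fun hy => hle ⟨y, hy, rfl⟩⟩⟩
  have h3 : ∀ x : W, O.symm x ∈ coordSubspace L m := by
    intro x
    have hx : x = ∑ i, (b.repr x i) • b i := (b.sum_repr x).symm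
    have hx' : (x : E L) = ∑ i, (b.repr x i) • (b i : E L) := by
      conv_lhs => rw [hx]
      simp
    rw [hx', map_sum]
    refine sum_mem fun i _ => ?_
    rw [map_smul, ← hO i i.2, O.symm_apply_apply]
    exact Submodule.smul_mem _ _ (basisVec_mem i.2)
  simpa using h3 ⟨O y, hy⟩

lemma finrank_coordSubspace {m : ℕ} (hm : m ≤ L) :
    Module.finrank ℝ (coordSubspace L m) = m := by
  have h : (Submodule.span ℝ (Set.range fun i : Fin m => basisVec L i)) = coordSubspace L m := by
    apply le_antisymm
    · rw [Submodule.span_le]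
      rintro _ ⟨i, rfl⟩
      exact basisVec_mem i.2
    · intro y hy
      have hy' : y = ∑ i : Fin L, y i • basisVec L i := by
        ext j
        simp [basisVec, Fin.val_inj]
      rw [hy']
      refine sum_mem fun i _ => ?_
      by_cases hi : (i : ℕ) < m
      · exact Submodule.smul_mem _ _ (Submodule.subset_span ⟨⟨i, hi⟩, rfl⟩)
      · rw [hy i (not_lt.1 hi), zero_smul]
        exact zero_mem _
  rw [← h, finrank_span_eq_card, Fintype.card_fin]
  have : Orthonormal ℝ fun i : Fin m => basisVec L i := by
    rw [orthonormal_iff_ite]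
    intro i j
    rw [inner_basisVec_basisVec (i.2.trans_le hm)]
    simp [Fin.ext_iff]
  exact this.linearIndependent

end LocalModels

/-! ### Functions with vanishing 1-jet or 2-jet -/

section Flat

variable {X : Type*} [NormedAddCommGroup X] [InnerProductSpace ℝ X]

/-- The `1`-jet of the `C²` function `f` at `0` vanishes. -/
structure IsOneFlat (f : X → ℝ) : Prop where
  contDiffAt : ContDiffAt ℝ 2 f 0
  map_zero : f 0 = 0
  fderiv_zero : fderiv ℝ f 0 = 0

/-- The `2`-jet of the `C²` function `f` at `0` vanishes. -/
structure IsTwoFlat (f : X → ℝ) : Prop extends IsOneFlat f where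
  fderiv_fderiv_zero : fderiv ℝ (fderiv ℝ f) 0 = 0

lemma differentiableAt_fderiv {Y : Type*} [NormedAddCommGroup Y] [NormedSpace ℝ Y] {f : X → Y}
    {x : X} (h : ContDiffAt ℝ 2 f x) : DifferentiableAt ℝ (fderiv ℝ f) x :=
  (h.fderiv_right (m := 1) (by norm_num)).differentiableAt (by simp)

lemma eventually_differentiableAt {Y : Type*} [NormedAddCommGroup Y] [NormedSpace ℝ Y] {f : X → Y}
    {x : X} (h : ContDiffAt ℝ 2 f x) : ∀ᶠ y in 𝓝 x, DifferentiableAt ℝ f y :=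
  (h.eventually (by simp)).mono fun _ hy => hy.differentiableAt (by simp)

lemma IsOneFlat.mul {f g : X → ℝ} (hf : IsOneFlat f) (hg : ContDiffAt ℝ 2 g 0) :
    IsOneFlat (fun x => f x * g x) where
  contDiffAt := hf.contDiffAt.mul hg
  map_zero := by simp [hf.map_zero]
  fderiv_zero := by
    rw [fderiv_fun_mul (hf.contDiffAt.differentiableAt (by simp))
      (hg.differentiableAt (by simp)), hf.map_zero, hf.fderiv_zero]
    simp

lemma isOneFlat_mul {f g : X → ℝ} (hf : ContDiffAt ℝ 2 f 0) (hg : ContDiffAt ℝ 2 g 0)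
    (hf0 : f 0 = 0) (hg0 : g 0 = 0) : IsOneFlat (fun x => f x * g x) where
  contDiffAt := hf.mul hg
  map_zero := by simp [hf0]
  fderiv_zero := by
    rw [fderiv_fun_mul (hf.differentiableAt (by simp)) (hg.differentiableAt (by simp)), hf0, hg0]
    simp

lemma IsOneFlat.sub {f g : X → ℝ} (hf : IsOneFlat f) (hg : IsOneFlat g) :
    IsOneFlat (fun x => f x - g x) where
  contDiffAt := hf.contDiffAt.sub hg.contDiffAt
  map_zero := by simp [hf.map_zero, hg.map_zero]
  fderiv_zero := by
    rw [fderiv_fun_sub (hf.contDiffAt.differentiableAt (by simp))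
      (hg.contDiffAt.differentiableAt (by simp)), hf.fderiv_zero, hg.fderiv_zero, sub_zero]

lemma IsTwoFlat.add {f g : X → ℝ} (hf : IsTwoFlat f) (hg : IsTwoFlat g) :
    IsTwoFlat (fun x => f x + g x) where
  contDiffAt := hf.contDiffAt.add hg.contDiffAt
  map_zero := by simp [hf.map_zero, hg.map_zero]
  fderiv_zero := by
    rw [fderiv_fun_add (hf.contDiffAt.differentiableAt (by simp))
      (hg.contDiffAt.differentiableAt (by simp)), hf.fderiv_zero, hg.fderiv_zero, zero_add]
  fderiv_fderiv_zero := by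
    have : fderiv ℝ (fun x => f x + g x) =ᶠ[𝓝 0] fun x => fderiv ℝ f x + fderiv ℝ g x := by
      filter_upwards [eventually_differentiableAt hf.contDiffAt,
        eventually_differentiableAt hg.contDiffAt] with x h1 h2
      rw [fderiv_fun_add h1 h2]
    rw [this.fderiv_eq, fderiv_fun_add (differentiableAt_fderiv hf.contDiffAt)
      (differentiableAt_fderiv hg.contDiffAt), hf.fderiv_fderiv_zero, hg.fderiv_fderiv_zero,
      zero_add]

lemma IsTwoFlat.neg {f : X → ℝ} (hf : IsTwoFlat f) : IsTwoFlat (fun x => -f x) where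
  contDiffAt := hf.contDiffAt.neg
  map_zero := by simp [hf.map_zero]
  fderiv_zero := by rw [fderiv_fun_neg, hf.fderiv_zero, neg_zero]
  fderiv_fderiv_zero := by
    have : fderiv ℝ (fun x => -f x) = fun x => -fderiv ℝ f x := funext fun x => fderiv_fun_neg
    rw [this, fderiv_fun_neg, hf.fderiv_fderiv_zero, neg_zero]

/-- In the product rule for the second derivative every term contains one of `f 0`, `g 0` or the
derivative of `f` at `0`. -/
lemma IsOneFlat.isTwoFlat_mul {f g : X → ℝ} (hf : IsOneFlat f) (hg : ContDiffAt ℝ 2 g 0)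
    (hg0 : g 0 = 0) : IsTwoFlat (fun x => f x * g x) where
  toIsOneFlat := hf.mul hg
  fderiv_fderiv_zero := by
    have : fderiv ℝ (fun x => f x * g x) =ᶠ[𝓝 0]
        fun x => f x • fderiv ℝ g x + g x • fderiv ℝ f x := by
      filter_upwards [eventually_differentiableAt hf.contDiffAt,
        eventually_differentiableAt hg] with x h1 h2
      rw [fderiv_fun_mul h1 h2]
    have df := hf.contDiffAt.differentiableAt (by simp)
    have dg := hg.differentiableAt (by simp)
    have df' := differentiableAt_fderiv hf.contDiffAt
    have dg' := differentiableAt_fderiv hg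
    rw [this.fderiv_eq, fderiv_fun_add (df.fun_smul dg') (dg.fun_smul df'), fderiv_fun_smul df dg',
      fderiv_fun_smul dg df', hf.map_zero, hf.fderiv_zero, hg0]
    ext; simp

lemma isOneFlat_inner {f g : X → X} (hf : ContDiffAt ℝ 2 f 0) (hg : ContDiffAt ℝ 2 g 0)
    (hf0 : f 0 = 0) (hg0 : g 0 = 0) : IsOneFlat (fun x => inner ℝ (f x) (g x)) where
  contDiffAt := hf.inner ℝ hg
  map_zero := by simp [hf0]
  fderiv_zero := by
    ext v
    rw [fderiv_inner_apply ℝ (hf.differentiableAt (by simp)) (hg.differentiableAt (by simp)), hf0,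
      hg0]
    simp

lemma contDiffOn_fderiv_apply {Y : Type*} [NormedAddCommGroup Y] [NormedSpace ℝ Y]
    {s : Set X} (hs : IsOpen s) {f : X → Y} {U : X → X} (hf : ContDiffOn ℝ ∞ f s)
    (hU : ContDiffOn ℝ ∞ U s) : ContDiffOn ℝ ∞ (fun x => fderiv ℝ f x (U x)) s :=
  (hf.fderiv_of_isOpen hs (by simp)).clm_apply hU

end Flat

/-! ### Correction of the squared norm at an oblique edge -/

section Construction

variable {X : Type*} [NormedAddCommGroup X] [InnerProductSpace ℝ X]

lemma _root_.ContDiffOn.contDiffAt_two {Y : Type*} [NormedAddCommGroup Y] [NormedSpace ℝ Y]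
    {s : Set X} {f : X → Y} (hf : ContDiffOn ℝ ∞ f s) (hs : IsOpen s) {x : X} (hx : x ∈ s) :
    ContDiffAt ℝ 2 f x :=
  (hf.contDiffAt (hs.mem_nhds hx)).of_le (WithTop.coe_le_coe.2 (le_top : (2 : ℕ∞) ≤ ⊤))

/-- First order correction of `‖x‖²` at the edge `⟪a, x⟫ = ⟪b, x⟫ = 0`. -/
lemma exists_edge_correction {s : Set X} (hs : IsOpen s) (h0 : (0 : X) ∈ s) {U V : X → X}
    {a b : X} (hU : ContDiffOn ℝ ∞ U s) (hV : ContDiffOn ℝ ∞ V s) (hU0 : U 0 = a) (hV0 : V 0 = b)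
    (hΔ : ∀ x ∈ s, inner ℝ a (U x) * inner ℝ b (V x) - inner ℝ b (U x) * inner ℝ a (V x) ≠ 0) :
    ∃ A B : X → ℝ, ContDiffOn ℝ ∞ A s ∧ ContDiffOn ℝ ∞ B s ∧ IsOneFlat A ∧ IsOneFlat B ∧
      (∀ x ∈ s, inner ℝ a (U x) * A x + inner ℝ b (U x) * B x = 2 * inner ℝ x (U x - a)) ∧
      (∀ x ∈ s, inner ℝ a (V x) * A x + inner ℝ b (V x) * B x = 2 * inner ℝ x (V x - b)) := by
  set Δ : X → ℝ := fun x =>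
    inner ℝ a (U x) * inner ℝ b (V x) - inner ℝ b (U x) * inner ℝ a (V x)
  have hi : ∀ (c : X) (W : X → X), ContDiffOn ℝ ∞ W s →
      ContDiffOn ℝ ∞ (fun x => inner ℝ c (W x)) s := fun c W hW => contDiffOn_const.inner ℝ hW
  have hr : ∀ (c : X) (W : X → X), ContDiffOn ℝ ∞ W s →
      ContDiffOn ℝ ∞ (fun x => inner ℝ x (W x - c)) s :=
    fun c W hW => contDiffOn_id.inner ℝ (hW.sub contDiffOn_const)
  have hr' : ∀ (c : X) (W : X → X), ContDiffOn ℝ ∞ W s → W 0 = c →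
      IsOneFlat (fun x => inner ℝ x (W x - c)) := fun c W hW hW0 =>
    isOneFlat_inner contDiffAt_id ((hW.sub contDiffOn_const).contDiffAt_two hs h0) rfl
      (by simp [hW0])
  have hΔs : ContDiffOn ℝ ∞ Δ s := ((hi a U hU).mul (hi b V hV)).sub ((hi b U hU).mul (hi a V hV))
  have hc : ∀ (c : X) (W : X → X), ContDiffOn ℝ ∞ W s →
      ContDiffOn ℝ ∞ (fun x => 2 * inner ℝ c (W x) / Δ x) s := fun c W hW =>
    (contDiffOn_const.mul (hi c W hW)).div hΔs hΔ
  -- Cramer's rule with determinant `Δ`. The right-hand sides `⟨x, U - a⟩` and `⟨x, V - b⟩` are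
  -- products of two factors vanishing at `0`, hence have vanishing 1-jet, and so do `A` and `B`.
  refine ⟨fun x => inner ℝ x (U x - a) * (2 * inner ℝ b (V x) / Δ x) -
      inner ℝ x (V x - b) * (2 * inner ℝ b (U x) / Δ x),
    fun x => inner ℝ x (V x - b) * (2 * inner ℝ a (U x) / Δ x) -
      inner ℝ x (U x - a) * (2 * inner ℝ a (V x) / Δ x), ?_, ?_, ?_, ?_, ?_, ?_⟩
  · exact ((hr a U hU).mul (hc b V hV)).sub ((hr b V hV).mul (hc b U hU))
  · exact ((hr b V hV).mul (hc a U hU)).sub ((hr a U hU).mul (hc a V hV))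
  · exact ((hr' a U hU hU0).mul ((hc b V hV).contDiffAt_two hs h0)).sub
      ((hr' b V hV hV0).mul ((hc b U hU).contDiffAt_two hs h0))
  · exact ((hr' b V hV hV0).mul ((hc a U hU).contDiffAt_two hs h0)).sub
      ((hr' a U hU hU0).mul ((hc a V hV).contDiffAt_two hs h0))
  · intro x hx
    have : Δ x ≠ 0 := hΔ x hx
    field_simp
    simp only [Δ]
    ring
  · intro x hx
    have : Δ x ≠ 0 := hΔ x hx
    field_simp
    simp only [Δ]
    ring

lemma fderiv_norm_sq_sub_apply {A B : X → ℝ} {a b x : X} (hA : DifferentiableAt ℝ A x)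
    (hB : DifferentiableAt ℝ B x) (y : X) :
    fderiv ℝ (fun x => ‖x‖ ^ 2 - inner ℝ a x * A x - inner ℝ b x * B x) x y =
      2 * inner ℝ x y - (inner ℝ a y * A x + inner ℝ a x * fderiv ℝ A x y) -
        (inner ℝ b y * B x + inner ℝ b x * fderiv ℝ B x y) := by
  have h1 : HasFDerivAt (fun x : X => ‖x‖ ^ 2) (2 • innerSL ℝ x) x := hasStrictFDerivAt_norm_sq x |>.hasFDerivAt
  have h2 : ∀ c : X, HasFDerivAt (fun x : X => inner ℝ c x) (innerSL ℝ c) x :=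
    fun c => (innerSL ℝ c).hasFDerivAt
  have := (h1.sub ((h2 a).mul hA.hasFDerivAt)).sub ((h2 b).mul hB.hasFDerivAt)
  rw [HasFDerivAt.fderiv (f := fun x => ‖x‖ ^ 2 - inner ℝ a x * A x - inner ℝ b x * B x) this]
  simp
  ring

/-- A function with prescribed `2`-jet whose derivatives in the directions `U` and `V` vanish on the
hyperplanes orthogonal to `a` and `b`, in the case of an oblique angle. -/
lemma exists_twoFlat_of_oblique {s : Set X} (hs : IsOpen s) (h0 : (0 : X) ∈ s) {U V : X → X}
    {a b : X} (hU : ContDiffOn ℝ ∞ U s) (hV : ContDiffOn ℝ ∞ V s) (hU0 : U 0 = a) (hV0 : V 0 = b)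
    (hΔ : ∀ x ∈ s, inner ℝ a (U x) * inner ℝ b (V x) - inner ℝ b (U x) * inner ℝ a (V x) ≠ 0)
    (hα : ∀ x ∈ s, inner ℝ a (U x) ≠ 0) (hβ : ∀ x ∈ s, inner ℝ b (V x) ≠ 0)
    (hγ : ∀ x ∈ s, inner ℝ b (U x) ≠ 0) (hγ' : ∀ x ∈ s, inner ℝ a (V x) ≠ 0) :
    ∃ R : X → ℝ, ContDiffOn ℝ ∞ R s ∧ IsTwoFlat R ∧
      (∀ x ∈ s, inner ℝ a x = 0 → 2 * inner ℝ x (U x) + fderiv ℝ R x (U x) = 0) ∧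
      (∀ x ∈ s, inner ℝ b x = 0 → 2 * inner ℝ x (V x) + fderiv ℝ R x (V x) = 0) := by
  obtain ⟨A, B, hA, hB, fA, fB, e1, e2⟩ := exists_edge_correction hs h0 hU hV hU0 hV0 hΔ
  have hi : ∀ (c : X) (W : X → X), ContDiffOn ℝ ∞ W s →
      ContDiffOn ℝ ∞ (fun x => inner ℝ c (W x)) s := fun c W hW => contDiffOn_const.inner ℝ hW
  have hl : ∀ c : X, ContDiffOn ℝ ∞ (fun x => inner ℝ c x) s := fun c => hi c _ contDiffOn_id
  have hl2 : ∀ c : X, ContDiffAt ℝ 2 (fun x => inner ℝ c x) (0 : X) :=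
    fun c => (hl c).contDiffAt_two hs h0
  -- On `{⟨a, x⟩ = 0}` the error left by `A` and `B` is `-⟨b, x⟩ UB`, while `⟨b, x⟩² P` contributes
  -- `2⟨b, x⟩⟨b, U⟩ P` and a term of second order in `⟨b, x⟩`. The choice of `P` cancels the error;
  -- dividing by `⟨b, U⟩` is where obliqueness enters.
  set P : X → ℝ := fun x => fderiv ℝ B x (U x) / (2 * inner ℝ b (U x))
  set Q : X → ℝ := fun x => fderiv ℝ A x (V x) / (2 * inner ℝ a (V x))
  have hP : ContDiffOn ℝ ∞ P s := (contDiffOn_fderiv_apply hs hB hU).div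
    (contDiffOn_const.mul (hi b U hU)) fun x hx => mul_ne_zero two_ne_zero (hγ x hx)
  have hQ : ContDiffOn ℝ ∞ Q s := (contDiffOn_fderiv_apply hs hA hV).div
    (contDiffOn_const.mul (hi a V hV)) fun x hx => mul_ne_zero two_ne_zero (hγ' x hx)
  -- The remaining term is `⟨b, x⟩² UP`. On `{⟨a, x⟩ = 0}` the derivative of `⟨a, x⟩ P'` along `U`
  -- is `⟨a, U⟩ P' = -UP`, which removes it.
  set P' : X → ℝ := fun x => -(fderiv ℝ P x (U x) / inner ℝ a (U x))
  set Q' : X → ℝ := fun x => -(fderiv ℝ Q x (V x) / inner ℝ b (V x))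
  have hP' : ContDiffOn ℝ ∞ P' s := ((contDiffOn_fderiv_apply hs hP hU).div (hi a U hU) hα).neg
  have hQ' : ContDiffOn ℝ ∞ Q' s := ((contDiffOn_fderiv_apply hs hQ hV).div (hi b V hV) hβ).neg
  have hP0 : P 0 = 0 := by simp [P, fB.fderiv_zero]
  have hQ0 : Q 0 = 0 := by simp [Q, fA.fderiv_zero]
  -- The correction for one face carries the square of the linear function defining the other, so
  -- its first derivative vanishes on that other face and the two corrections do not interfere.
  let R : X → ℝ := fun x => -(A x * inner ℝ a x) + -(B x * inner ℝ b x) +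
    (inner ℝ b x * inner ℝ b x) * (P x + inner ℝ a x * P' x) +
    (inner ℝ a x * inner ℝ a x) * (Q x + inner ℝ b x * Q' x)
  have fa : ∀ c : X, IsOneFlat (fun x => inner ℝ c x * inner ℝ c x) := fun c =>
    isOneFlat_mul (hl2 c) (hl2 c) (by simp) (by simp)
  have hPP : ContDiffOn ℝ ∞ (fun x => P x + inner ℝ a x * P' x) s := hP.add ((hl a).mul hP')
  have hQQ : ContDiffOn ℝ ∞ (fun x => Q x + inner ℝ b x * Q' x) s := hQ.add ((hl b).mul hQ')
  have hD : ∀ x ∈ s, ∀ y, fderiv ℝ R x y =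
      -(fderiv ℝ A x y * inner ℝ a x + A x * inner ℝ a y) -
      (fderiv ℝ B x y * inner ℝ b x + B x * inner ℝ b y) +
      (2 * inner ℝ b x * inner ℝ b y * (P x + inner ℝ a x * P' x) + inner ℝ b x * inner ℝ b x *
        (fderiv ℝ P x y + inner ℝ a y * P' x + inner ℝ a x * fderiv ℝ P' x y)) +
      (2 * inner ℝ a x * inner ℝ a y * (Q x + inner ℝ b x * Q' x) + inner ℝ a x * inner ℝ a x *
        (fderiv ℝ Q x y + inner ℝ b y * Q' x + inner ℝ b x * fderiv ℝ Q' x y)) := by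
    intro x hx y
    have d : ∀ {f : X → ℝ}, ContDiffOn ℝ ∞ f s → HasFDerivAt f (fderiv ℝ f x) x := fun hf =>
      ((hf.contDiffAt_two hs hx).differentiableAt (by simp)).hasFDerivAt
    have dl : ∀ c : X, HasFDerivAt (fun x : X => inner ℝ c x) (innerSL ℝ c) x :=
      fun c => (innerSL ℝ c).hasFDerivAt
    have := ((((d hA).mul (dl a)).neg.add ((d hB).mul (dl b)).neg).add
      (((dl b).mul (dl b)).mul ((d hP).add ((dl a).mul (d hP'))))).add
      (((dl a).mul (dl a)).mul ((d hQ).add ((dl b).mul (d hQ'))))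
    rw [HasFDerivAt.fderiv (f := R) this]
    simp
    ring
  refine ⟨R, ?_, ?_, fun x hx hax => ?_, fun x hx hbx => ?_⟩
  · exact ((((hA.mul (hl a)).neg.add (hB.mul (hl b)).neg).add (((hl b).mul (hl b)).mul hPP))).add
      (((hl a).mul (hl a)).mul hQQ)
  · refine (((fA.isTwoFlat_mul (hl2 a) (by simp)).neg.add
      (fB.isTwoFlat_mul (hl2 b) (by simp)).neg).add
      ((fa b).isTwoFlat_mul (hPP.contDiffAt_two hs h0) ?_)).add
      ((fa a).isTwoFlat_mul (hQQ.contDiffAt_two hs h0) ?_)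
    · simp [hP0]
    · simp [hQ0]
  · have e := e1 x hx
    rw [inner_sub_right, real_inner_comm a x, hax] at e
    have h1 : P x * (2 * inner ℝ b (U x)) = fderiv ℝ B x (U x) :=
      div_mul_cancel₀ _ (mul_ne_zero two_ne_zero (hγ x hx))
    have h2 : P' x * inner ℝ a (U x) = -fderiv ℝ P x (U x) := by
      rw [neg_mul, div_mul_cancel₀ _ (hα x hx)]
    rw [hD x hx, hax]
    linear_combination -e + inner ℝ b x * h1 + inner ℝ b x ^ 2 * h2
  · have e := e2 x hx
    rw [inner_sub_right, real_inner_comm b x, hbx] at e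
    have h1 : Q x * (2 * inner ℝ a (V x)) = fderiv ℝ A x (V x) :=
      div_mul_cancel₀ _ (mul_ne_zero two_ne_zero (hγ' x hx))
    have h2 : Q' x * inner ℝ b (V x) = -fderiv ℝ Q x (V x) := by
      rw [neg_mul, div_mul_cancel₀ _ (hβ x hx)]
    rw [hD x hx, hbx]
    linear_combination -e + inner ℝ a x * h1 + inner ℝ a x ^ 2 * h2

end Construction

/-! ### Correction of the squared norm at a right-angled edge -/

section RightAngle

variable {X : Type*} [NormedAddCommGroup X] [InnerProductSpace ℝ X]

lemma _root_.ContDiffOn.differentiableAt_of_isOpen {Y : Type*} [NormedAddCommGroup Y]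
    [NormedSpace ℝ Y] {s : Set X} {f : X → Y} (hf : ContDiffOn ℝ ∞ f s) (hs : IsOpen s) {x : X}
    (hx : x ∈ s) : DifferentiableAt ℝ f x :=
  (hf.contDiffAt_two hs hx).differentiableAt (by simp)

/-- The compatibility of the second order corrections along the edge, at a right angle. -/
lemma edge_compatibility {s : Set X} (hs : IsOpen s) {U V : X → X}
    {a b : X} (hU : ContDiffOn ℝ ∞ U s) (hV : ContDiffOn ℝ ∞ V s) {A B : X → ℝ}
    (hA : ContDiffOn ℝ ∞ A s) (hB : ContDiffOn ℝ ∞ B s)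
    (e1 : ∀ x ∈ s, inner ℝ a (U x) * A x + inner ℝ b (U x) * B x = 2 * inner ℝ x (U x - a))
    (e2 : ∀ x ∈ s, inner ℝ a (V x) * A x + inner ℝ b (V x) * B x = 2 * inner ℝ x (V x - b))
    {x : X} (hx : x ∈ s) (hax : inner ℝ a x = 0) (hbx : inner ℝ b x = 0)
    (hγ : inner ℝ b (U x) = 0) (hγ' : inner ℝ a (V x) = 0)
    (hbr : ∃ l m : ℝ, fderiv ℝ V x (U x) - fderiv ℝ U x (V x) = l • U x + m • V x) :
    inner ℝ a (U x) * fderiv ℝ A x (V x) = inner ℝ b (V x) * fderiv ℝ B x (U x) := by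
  let F : X → ℝ := fun x => ‖x‖ ^ 2 - inner ℝ a x * A x - inner ℝ b x * B x
  have hl : ∀ c : X, ContDiffOn ℝ ∞ (fun x => inner ℝ c x) s :=
    fun c => contDiffOn_const.inner ℝ contDiffOn_id
  have hF : ContDiffOn ℝ ∞ F s :=
    ((contDiff_norm_sq ℝ).contDiffOn.sub ((hl a).mul hA)).sub ((hl b).mul hB)
  -- The linear system for `A` and `B` replaces `2⟨y, U⟩` by `2⟨a, y⟩`. The derivative of `F` along
  -- `U` is thereby a combination of the two functions that define the faces, and can be
  -- differentiated once more on the edge.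
  have kU : ∀ y ∈ s, fderiv ℝ F y (U y) =
      2 * inner ℝ a y - inner ℝ a y * fderiv ℝ A y (U y) - inner ℝ b y * fderiv ℝ B y (U y) := by
    intro y hy
    have e := e1 y hy
    rw [fderiv_norm_sq_sub_apply (hA.differentiableAt_of_isOpen hs hy) (hB.differentiableAt_of_isOpen hs hy)]
    rw [inner_sub_right, real_inner_comm a y] at e
    linear_combination -e
  have kV : ∀ y ∈ s, fderiv ℝ F y (V y) =
      2 * inner ℝ b y - inner ℝ a y * fderiv ℝ A y (V y) - inner ℝ b y * fderiv ℝ B y (V y) := by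
    intro y hy
    have e := e2 y hy
    rw [fderiv_norm_sq_sub_apply (hA.differentiableAt_of_isOpen hs hy) (hB.differentiableAt_of_isOpen hs hy)]
    rw [inner_sub_right, real_inner_comm b y] at e
    linear_combination -e
  have dl : ∀ c : X, HasFDerivAt (fun x : X => inner ℝ c x) (innerSL ℝ c) x :=
    fun c => (innerSL ℝ c).hasFDerivAt
  have hFF : HasFDerivAt (fderiv ℝ F) (fderiv ℝ (fderiv ℝ F) x) x :=
    (differentiableAt_fderiv (hF.contDiffAt_two hs hx)).hasFDerivAt
  have key : ∀ (W : X → X) (c : X), ContDiffOn ℝ ∞ W s →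
      (∀ y ∈ s, fderiv ℝ F y (W y) =
        2 * inner ℝ c y - inner ℝ a y * fderiv ℝ A y (W y) - inner ℝ b y * fderiv ℝ B y (W y)) →
      ∀ v, fderiv ℝ (fderiv ℝ F) x v (W x) + fderiv ℝ F x (fderiv ℝ W x v) =
        2 * inner ℝ c v - inner ℝ a v * fderiv ℝ A x (W x) -
          inner ℝ b v * fderiv ℝ B x (W x) := by
    intro W c hW hk v
    have h1 : HasFDerivAt (fun y => fderiv ℝ F y (W y)) _ x :=
      hFF.clm_apply (hW.differentiableAt_of_isOpen hs hx).hasFDerivAt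
    have h2 : HasFDerivAt (fun y => 2 * inner ℝ c y - inner ℝ a y * fderiv ℝ A y (W y) -
        inner ℝ b y * fderiv ℝ B y (W y)) _ x :=
      (((dl c).const_mul 2).sub
        ((dl a).mul ((contDiffOn_fderiv_apply hs hA hW).differentiableAt_of_isOpen hs hx).hasFDerivAt)).sub
        ((dl b).mul ((contDiffOn_fderiv_apply hs hB hW).differentiableAt_of_isOpen hs hx).hasFDerivAt)
    have h3 := h1.unique (h2.congr_of_eventuallyEq
      ((hs.eventually_mem hx).mono fun y hy => hk y hy))
    have h4 := congrArg (fun T : X →L[ℝ] ℝ => T v) h3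
    simp [hax, hbx] at h4
    linarith
  -- Differentiate `VF` along `U` and `UF` along `V`. In the difference the Hessian of `F` cancels
  -- and the bracket of `U` and `V` applied to `F` remains; it vanishes because `UF = VF = 0` on the
  -- edge.
  have k1 := key V b hV kV (U x)
  have k2 := key U a hU kU (V x)
  have hsymm : fderiv ℝ (fderiv ℝ F) x (U x) (V x) = fderiv ℝ (fderiv ℝ F) x (V x) (U x) :=
    ((hF.contDiffAt_two hs hx).isSymmSndFDerivAt (by simp)) _ _
  obtain ⟨l, m, hlm⟩ := hbr
  have hb := congrArg (fderiv ℝ F x) hlm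
  rw [map_sub, map_add, map_smul, map_smul, kU x hx, kV x hx, hax, hbx] at hb
  simp only [hγ, hγ', smul_eq_mul] at k1 k2 hb
  linear_combination k1 - k2 - hsymm - hb

/-- A function with prescribed `2`-jet whose derivatives in the directions `U` and `V` vanish on the
hyperplanes orthogonal to `a` and `b`, in the case of a right angle. -/
lemma exists_twoFlat_of_right_angle {s : Set X} (hs : IsOpen s) (h0 : (0 : X) ∈ s) {U V : X → X}
    {a b : X} (hU : ContDiffOn ℝ ∞ U s) (hV : ContDiffOn ℝ ∞ V s) (hU0 : U 0 = a) (hV0 : V 0 = b)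
    (hΔ : ∀ x ∈ s, inner ℝ a (U x) * inner ℝ b (V x) - inner ℝ b (U x) * inner ℝ a (V x) ≠ 0)
    (hα : ∀ x ∈ s, inner ℝ a (U x) ≠ 0) (hβ : ∀ x ∈ s, inner ℝ b (V x) ≠ 0)
    (hbb : inner ℝ b b = (1 : ℝ)) (hab : inner ℝ a b = (0 : ℝ))
    (hsa : ∀ x ∈ s, x - (inner ℝ a x : ℝ) • a ∈ s) (hsb : ∀ x ∈ s, x - (inner ℝ b x : ℝ) • b ∈ s)
    {K : Submodule ℝ X} (hb : b ∈ K)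
    (hedge : ∀ x ∈ s, x ∈ K → inner ℝ a x = 0 → inner ℝ b x = 0 →
      inner ℝ b (U x) = 0 ∧ inner ℝ a (V x) = 0 ∧
      ∃ l m : ℝ, fderiv ℝ V x (U x) - fderiv ℝ U x (V x) = l • U x + m • V x) :
    ∃ R : X → ℝ, ContDiffOn ℝ ∞ R s ∧ IsTwoFlat R ∧
      (∀ x ∈ s, x ∈ K → inner ℝ a x = 0 → 2 * inner ℝ x (U x) + fderiv ℝ R x (U x) = 0) ∧
      (∀ x ∈ s, x ∈ K → inner ℝ b x = 0 → 2 * inner ℝ x (V x) + fderiv ℝ R x (V x) = 0) := by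
  obtain ⟨A, B, hA, hB, fA, fB, e1, e2⟩ := exists_edge_correction hs h0 hU hV hU0 hV0 hΔ
  have hba : inner ℝ b a = (0 : ℝ) := by rw [real_inner_comm, hab]
  have hi : ∀ (c : X) (W : X → X), ContDiffOn ℝ ∞ W s →
      ContDiffOn ℝ ∞ (fun x => inner ℝ c (W x)) s := fun c W hW => contDiffOn_const.inner ℝ hW
  have hl : ∀ c : X, ContDiffOn ℝ ∞ (fun x => inner ℝ c x) s := fun c => hi c _ contDiffOn_id
  have hl2 : ∀ c : X, ContDiffAt ℝ 2 (fun x => inner ℝ c x) (0 : X) :=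
    fun c => (hl c).contDiffAt_two hs h0
  -- The term `⟨a, x⟩⟨b, x⟩ C` contributes `⟨a, U⟩⟨b, x⟩ C` to the derivative along `U` on the first
  -- face, so `C` must equal `P` there; symmetrically it must equal `Q` on the second face.
  set P : X → ℝ := fun x => fderiv ℝ B x (U x) / inner ℝ a (U x)
  set Q : X → ℝ := fun x => fderiv ℝ A x (V x) / inner ℝ b (V x)
  have hP : ContDiffOn ℝ ∞ P s := (contDiffOn_fderiv_apply hs hB hU).div (hi a U hU) hα
  have hQ : ContDiffOn ℝ ∞ Q s := (contDiffOn_fderiv_apply hs hA hV).div (hi b V hV) hβ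
  have hPQ : ∀ x ∈ s, x ∈ K → inner ℝ a x = 0 → inner ℝ b x = 0 → P x = Q x := by
    intro x hx hxK hax hbx
    obtain ⟨h1, h2, h3⟩ := hedge x hx hxK hax hbx
    have := edge_compatibility hs hU hV hA hB e1 e2 hx hax hbx h1 h2 h3
    rw [div_eq_div_iff (hα x hx) (hβ x hx)]
    linarith
  let pa : X → X := fun x => x - (inner ℝ a x : ℝ) • a
  let pb : X → X := fun x => x - (inner ℝ b x : ℝ) • b
  have hpa : ContDiffOn ℝ ∞ pa s := contDiffOn_id.sub ((hl a).smul contDiffOn_const)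
  have hpb : ContDiffOn ℝ ∞ pb s := contDiffOn_id.sub ((hl b).smul contDiffOn_const)
  -- A common extension of `P` from the first face and of `Q` from the second, by inclusion and
  -- exclusion: `pa` and `pb` are the orthogonal projections onto the two hyperplanes. On the first
  -- face, `P (pa (pb x))` cancels `Q (pb x)` because `P = Q` on the edge.
  let C : X → ℝ := fun x => P (pa x) + Q (pb x) - P (pa (pb x))
  have hC : ContDiffOn ℝ ∞ C s := ((hP.comp hpa hsa).add (hQ.comp hpb hsb)).sub
    (hP.comp (hpa.comp hpb hsb) fun x hx => hsa _ (hsb x hx))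
  have hP0 : P 0 = 0 := by simp [P, fB.fderiv_zero]
  have hQ0 : Q 0 = 0 := by simp [Q, fA.fderiv_zero]
  have hC0 : C 0 = 0 := by simp [C, pa, pb, hP0, hQ0]
  let R : X → ℝ := fun x => -(A x * inner ℝ a x) + -(B x * inner ℝ b x) +
    (inner ℝ a x * inner ℝ b x) * C x
  have hD : ∀ x ∈ s, ∀ y, fderiv ℝ R x y =
      -(fderiv ℝ A x y * inner ℝ a x + A x * inner ℝ a y) -
      (fderiv ℝ B x y * inner ℝ b x + B x * inner ℝ b y) +
      ((inner ℝ a y * inner ℝ b x + inner ℝ a x * inner ℝ b y) * C x +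
        inner ℝ a x * inner ℝ b x * fderiv ℝ C x y) := by
    intro x hx y
    have d : ∀ {f : X → ℝ}, ContDiffOn ℝ ∞ f s → HasFDerivAt f (fderiv ℝ f x) x := fun hf =>
      ((hf.contDiffAt_two hs hx).differentiableAt (by simp)).hasFDerivAt
    have dl : ∀ c : X, HasFDerivAt (fun x : X => inner ℝ c x) (innerSL ℝ c) x :=
      fun c => (innerSL ℝ c).hasFDerivAt
    have := (((d hA).mul (dl a)).neg.add ((d hB).mul (dl b)).neg).add
      (((dl a).mul (dl b)).mul (d hC))
    rw [HasFDerivAt.fderiv (f := R) this]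
    simp
    ring
  refine ⟨R, ?_, ?_, fun x hx hxK hax => ?_, fun x hx hxK hbx => ?_⟩
  · exact ((hA.mul (hl a)).neg.add (hB.mul (hl b)).neg).add (((hl a).mul (hl b)).mul hC)
  · exact ((fA.isTwoFlat_mul (hl2 a) (by simp)).neg.add
      (fB.isTwoFlat_mul (hl2 b) (by simp)).neg).add
      ((isOneFlat_mul (hl2 a) (hl2 b) (by simp) (by simp)).isTwoFlat_mul
        (hC.contDiffAt_two hs h0) hC0)
  · have e := e1 x hx
    rw [inner_sub_right, real_inner_comm a x, hax] at e
    have hCx : C x = P x := by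
      have h1 : pa x = x := by simp [pa, hax]
      have h2 : pa (pb x) = pb x := by simp [pa, pb, inner_sub_right, inner_smul_right, hax, hab]
      -- The projection `pb` preserves `{⟨a, x⟩ = 0}` since `a` and `b` are orthogonal, and
      -- preserves `K` since `b ∈ K`. Thus `pb x` is an edge point at which the compatibility is
      -- available.
      have h3 : P (pb x) = Q (pb x) := hPQ _ (hsb x hx) (sub_mem hxK (K.smul_mem _ hb))
        (by simp [pb, inner_sub_right, inner_smul_right, hax, hab])
        (by simp only [pb, inner_sub_right, inner_smul_right, hbb]; ring)
      simp only [C, h1, h2, h3]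
      ring
    have h1 : P x * inner ℝ a (U x) = fderiv ℝ B x (U x) := div_mul_cancel₀ _ (hα x hx)
    rw [hD x hx, hax, hCx]
    linear_combination -e + inner ℝ b x * h1
  · have e := e2 x hx
    rw [inner_sub_right, real_inner_comm b x, hbx] at e
    have hCx : C x = Q x := by
      have h1 : pb x = x := by simp [pb, hbx]
      simp only [C, h1]
      ring
    have h1 : Q x * inner ℝ b (V x) = fderiv ℝ A x (V x) := div_mul_cancel₀ _ (hβ x hx)
    rw [hD x hx, hbx, hCx]
    linear_combination -e + inner ℝ a x * h1

end RightAngle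

/-! ### Faces and edges in terms of model cones -/

section ModelCone

variable {L : ℕ}

/-- The model sets of locally wedge-shaped `m`-manifolds: `ℝ^m` and the wedge domains. -/
def modelCone (L m : ℕ) : Option ℝ → Set (E L)
  | none => (coordSubspace L m : Set (E L))
  | some θ => wedge L m θ

/-- A wedge angle, if there is one, is in `(0, π]`. -/
def IsAngle (o : Option ℝ) : Prop := ∀ θ, o = some θ → 0 < θ ∧ θ ≤ Real.pi

lemma isClosedCone_modelCone (m : ℕ) (o : Option ℝ) : IsClosedCone (modelCone L m o) := by
  cases o with
  | none => exact isClosedCone_coordSubspace m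
  | some θ => exact isClosedCone_wedge m θ

lemma span_modelCone {m : ℕ} (hm : 1 ≤ m) (hL : 2 ≤ L) {o : Option ℝ} (ho : IsAngle o) :
    Submodule.span ℝ (modelCone L m o) = coordSubspace L m := by
  cases o with
  | none => exact Submodule.span_eq _
  | some θ => exact span_wedge hm hL (ho θ rfl).1 (ho θ rfl).2

lemma modelCone_subset (m : ℕ) (o : Option ℝ) :
    modelCone L m o ⊆ (coordSubspace L m : Set (E L)) := by
  cases o with
  | none => exact Subset.rfl
  | some θ => exact fun x hx => hx.1

/-- This slicing gives a level set a model with the same index `o` as the model of `M`. -/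
lemma mem_modelCone_succ {n : ℕ} {o : Option ℝ} {x : E L} :
    x ∈ modelCone L n o ↔ x ∈ modelCone L (n + 1) o ∧ inner ℝ (basisVec L n) x = 0 := by
  cases o with
  | none => exact mem_coordSubspace_succ
  | some θ => exact mem_wedge_succ

lemma add_smul_basisVec_mem_modelCone_iff {n : ℕ} (hn : 2 ≤ n) {o : Option ℝ} (x : E L) (c : ℝ) :
    x + c • basisVec L n ∈ modelCone L (n + 1) o ↔ x ∈ modelCone L (n + 1) o := by
  cases o with
  | none =>
    exact Submodule.add_mem_iff_left _ (Submodule.smul_mem _ _ (basisVec_mem (by omega)))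
  | some θ => exact add_smul_basisVec_mem_wedge_iff hn x c

lemma IsLocalModel.mem {M : Set (E L)} {m : ℕ} {o : Option ℝ} {p : E L}
    {φ : OpenPartialHomeomorph (E L) (E L)} (h : IsLocalModel M (modelCone L m o) p φ) :
    p ∈ M := by
  rw [← h.map_zero, h.mem_iff h.zero_mem]
  exact (isClosedCone_modelCone m o).zero_mem

lemma IsLocalModel.hasWedgeAngle {M : Set (E L)} {m : ℕ} {θ : ℝ} {p : E L}
    {φ : OpenPartialHomeomorph (E L) (E L)} (h : IsLocalModel M (modelCone L m (some θ)) p φ)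
    (ho : IsAngle (some θ)) : HasWedgeAngle m M p θ :=
  ⟨(ho θ rfl).1, (ho θ rfl).2, φ, h⟩

/-- Membership in the face asks for some local model, but by the uniqueness of the type any single
model decides it. -/
lemma IsLocalModel.mem_face_iff {M : Set (E L)} {m : ℕ} (hm : 2 ≤ m) (hL : 2 ≤ L)
    {o : Option ℝ} (ho : IsAngle o) {p : E L} {φ : OpenPartialHomeomorph (E L) (E L)}
    (h : IsLocalModel M (modelCone L m o) p φ) : p ∈ face m M ↔ o = some Real.pi := by
  constructor
  · rintro ⟨-, hp⟩
    cases o with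
    | none => exact absurd hp (IsLocalModel.not_hasWedgeAngle (by omega) hL h)
    | some θ => rw [(h.hasWedgeAngle ho).eq_pi hm hL hp]
  · rintro rfl
    exact ⟨h.mem, h.hasWedgeAngle ho⟩

lemma IsLocalModel.mem_edge_iff {M : Set (E L)} {m : ℕ} (hm : 2 ≤ m) (hL : 2 ≤ L)
    {o : Option ℝ} (ho : IsAngle o) {p : E L} {φ : OpenPartialHomeomorph (E L) (E L)}
    (h : IsLocalModel M (modelCone L m o) p φ) :
    p ∈ edge m M ↔ ∃ θ, θ < Real.pi ∧ o = some θ := by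
  constructor
  · rintro ⟨-, θ', hθ', hp⟩
    cases o with
    | none => exact absurd hp (IsLocalModel.not_hasWedgeAngle (by omega) hL h)
    | some θ =>
      refine ⟨θ, lt_of_le_of_ne (ho θ rfl).2 ?_, rfl⟩
      rintro rfl
      exact hθ'.ne (hp.eq_pi hm hL (h.hasWedgeAngle ho))
  · rintro ⟨θ, hθ, rfl⟩
    exact ⟨h.mem, θ, hθ, h.hasWedgeAngle ho⟩

end ModelCone

/-! ### Orthonormal frames adapted to one or two normals -/

section Frames

variable {L : ℕ}

lemma finrank_map_coordSubspace {m : ℕ} (hm : m ≤ L) (B : E L ≃L[ℝ] E L) :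
    Module.finrank ℝ ((coordSubspace L m).map (B.toLinearEquiv : E L →ₗ[ℝ] E L)) = m := by
  rw [LinearEquiv.finrank_map_eq, finrank_coordSubspace hm]

lemma mem_map_coordSubspace {m : ℕ} {B : E L ≃L[ℝ] E L} {y : E L} :
    y ∈ (coordSubspace L m).map (B.toLinearEquiv : E L →ₗ[ℝ] E L) ↔
      B.symm y ∈ coordSubspace L m := by
  constructor
  · rintro ⟨x, hx, rfl⟩
    simpa using hx
  · exact fun h => ⟨_, h, by simp⟩

/-- A frame for a subspace whose last vector is `ν`. -/
lemma exists_frame {n : ℕ} (hL : n + 1 ≤ L) (B : E L ≃L[ℝ] E L) {ν : E L}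
    (hν : B.symm ν ∈ coordSubspace L (n + 1)) (hν1 : ‖ν‖ = 1) :
    ∃ O : E L ≃ₗᵢ[ℝ] E L, O (basisVec L n) = ν ∧
      ∀ y, B.symm (O y) ∈ coordSubspace L (n + 1) ↔ y ∈ coordSubspace L (n + 1) := by
  obtain ⟨O, h1, h2⟩ := exists_isometry_of_orthonormal hL (finrank_map_coordSubspace hL B)
    (s := {Fin.last n}) (v := fun _ => ν) (fun _ => mem_map_coordSubspace.2 hν) (by simp [hν1])
  exact ⟨O, h1 _ rfl, fun y => mem_map_coordSubspace.symm.trans (h2 y)⟩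

/-- A frame for a subspace whose first vector is `f` and whose last vector is `ν`. -/
lemma exists_frame_one {n : ℕ} (hn : 1 ≤ n) (hL : n + 1 ≤ L) (B : E L ≃L[ℝ] E L) {ν f : E L}
    (hν : B.symm ν ∈ coordSubspace L (n + 1)) (hν1 : ‖ν‖ = 1)
    (hf : B.symm f ∈ coordSubspace L (n + 1)) (hf1 : ‖f‖ = 1)
    (hfν : inner ℝ f ν = (0 : ℝ)) :
    ∃ O : E L ≃ₗᵢ[ℝ] E L, O (basisVec L n) = ν ∧ O (basisVec L 0) = f ∧
      ∀ y, B.symm (O y) ∈ coordSubspace L (n + 1) ↔ y ∈ coordSubspace L (n + 1) := by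
  have hνf : inner ℝ ν f = (0 : ℝ) := by rw [real_inner_comm, hfν]
  have hne : (0 : Fin (n + 1)) ≠ Fin.last n := by
    simp only [ne_eq, Fin.ext_iff, Fin.val_zero, Fin.val_last]; omega
  obtain ⟨O, h1, h2⟩ := exists_isometry_of_orthonormal hL (finrank_map_coordSubspace hL B)
    (s := {0, Fin.last n}) (v := fun i => if i = 0 then f else ν)
    (fun i => mem_map_coordSubspace.2 (by beta_reduce; split_ifs <;> assumption))
    (by
      rintro i (rfl | rfl) j (rfl | rfl) <;> simp [hne, hne.symm, hν1, hf1, hfν, hνf])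
  refine ⟨O, ?_, ?_, fun y => mem_map_coordSubspace.symm.trans (h2 y)⟩
  · simpa [hne.symm] using h1 (Fin.last n) (by simp)
  · simpa using h1 0 (by simp)

/-- A frame for a subspace whose first two vectors are `f` and `g` and whose last vector is `ν`. -/
lemma exists_frame_two {n : ℕ} (hn : 2 ≤ n) (hL : n + 1 ≤ L) (B : E L ≃L[ℝ] E L) {ν f g : E L}
    (hν : B.symm ν ∈ coordSubspace L (n + 1)) (hν1 : ‖ν‖ = 1)
    (hf : B.symm f ∈ coordSubspace L (n + 1)) (hf1 : ‖f‖ = 1)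
    (hg : B.symm g ∈ coordSubspace L (n + 1)) (hg1 : ‖g‖ = 1)
    (hfν : inner ℝ f ν = (0 : ℝ)) (hgν : inner ℝ g ν = (0 : ℝ)) (hfg : inner ℝ f g = (0 : ℝ)) :
    ∃ O : E L ≃ₗᵢ[ℝ] E L, O (basisVec L n) = ν ∧ O (basisVec L 0) = f ∧ O (basisVec L 1) = g ∧
      ∀ y, B.symm (O y) ∈ coordSubspace L (n + 1) ↔ y ∈ coordSubspace L (n + 1) := by
  have hνf : inner ℝ ν f = (0 : ℝ) := by rw [real_inner_comm, hfν]
  have hνg : inner ℝ ν g = (0 : ℝ) := by rw [real_inner_comm, hgν]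
  have hgf : inner ℝ g f = (0 : ℝ) := by rw [real_inner_comm, hfg]
  let i1 : Fin (n + 1) := ⟨1, by omega⟩
  have h01 : (0 : Fin (n + 1)) ≠ i1 := by simp [i1, Fin.ext_iff]
  have h0n : (0 : Fin (n + 1)) ≠ Fin.last n := by
    simp only [ne_eq, Fin.ext_iff, Fin.val_zero, Fin.val_last]; omega
  have h1n : i1 ≠ Fin.last n := by
    simp only [i1, ne_eq, Fin.ext_iff, Fin.val_last]; omega
  obtain ⟨O, h1, h2⟩ := exists_isometry_of_orthonormal hL (finrank_map_coordSubspace hL B)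
    (s := {0, i1, Fin.last n}) (v := fun i => if i = 0 then f else if i = i1 then g else ν)
    (fun i => mem_map_coordSubspace.2 (by beta_reduce; split_ifs <;> assumption))
    (by
      rintro i (rfl | rfl | rfl) j (rfl | rfl | rfl) <;>
        simp [h01, h01.symm, h0n, h0n.symm, h1n, h1n.symm, hν1, hf1, hg1, hfν, hνf, hgν, hνg, hfg,
          hgf])
  refine ⟨O, ?_, ?_, ?_, fun y => mem_map_coordSubspace.symm.trans (h2 y)⟩
  · simpa [h0n.symm, h1n.symm] using h1 (Fin.last n) (by simp)
  · simpa using h1 0 (by simp)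
  · simpa [h01.symm] using h1 i1 (by simp)

/-- Two linearly independent unit vectors are the face normals of a rotated wedge. -/
lemma exists_angle_of_unit {N N' : E L} (h1 : ‖N‖ = 1) (h1' : ‖N'‖ = 1)
    (hlt : |inner ℝ N N'| < (1 : ℝ)) :
    ∃ θ : ℝ, 0 < θ ∧ θ < Real.pi ∧ ∃ c d : ℝ, ‖c • (N + N')‖ = 1 ∧ ‖d • (N' - N)‖ = 1 ∧
      (inner ℝ (c • (N + N')) (d • (N' - N)) : ℝ) = 0 ∧
      Real.sin (θ / 2) * c = 1 / 2 ∧ Real.cos (θ / 2) * d = 1 / 2 := by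
  obtain ⟨hl, hr⟩ := abs_lt.1 hlt
  obtain ⟨γ, hγ⟩ : ∃ γ : ℝ, inner ℝ N N' = γ := ⟨_, rfl⟩
  have hγ' : inner ℝ N' N = γ := by rw [real_inner_comm, hγ]
  rw [hγ] at hl hr
  have hNN : inner ℝ N N = (1 : ℝ) := by rw [real_inner_self_eq_norm_sq, h1, one_pow]
  have hNN' : inner ℝ N' N' = (1 : ℝ) := by rw [real_inner_self_eq_norm_sq, h1', one_pow]
  -- The inward unit normals of a wedge of angle `θ` have inner product `-cos θ`.
  set θ := Real.arccos (-γ)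
  have h0 : 0 < θ := Real.arccos_pos.2 (by linarith)
  have hπ : θ < Real.pi := by
    refine lt_of_le_of_ne (Real.arccos_le_pi _) fun h => ?_
    have := Real.arccos_eq_pi.1 h
    linarith
  have hcos : Real.cos θ = -γ := Real.cos_arccos (by linarith) (by linarith)
  have hs := sin_half_pos h0 hπ.le
  have hc := cos_half_pos h0 hπ
  have h2 := Real.cos_two_mul (θ / 2)
  have h3 := Real.sin_sq_add_cos_sq (θ / 2)
  rw [mul_div_cancel₀ θ two_ne_zero, hcos] at h2
  have hnorm : ∀ v : E L, inner ℝ v v = (1 : ℝ) → ‖v‖ = 1 := fun v hv => by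
    rw [norm_eq_sqrt_real_inner, hv, Real.sqrt_one]
  -- These are the normalising constants: `‖N + N'‖ = 2 sin (θ/2)` and `‖N' - N‖ = 2 cos (θ/2)`.
  refine ⟨θ, h0, hπ, 1 / (2 * Real.sin (θ / 2)), 1 / (2 * Real.cos (θ / 2)), hnorm _ ?_, hnorm _ ?_,
    ?_, ?_, ?_⟩
  · simp only [real_inner_smul_left, inner_smul_right, inner_add_left, inner_add_right, hNN, hNN',
      hγ, hγ']
    field_simp
    linarith
  · simp only [real_inner_smul_left, inner_smul_right, inner_sub_left, inner_sub_right, hNN, hNN',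
      hγ, hγ']
    field_simp
    linarith
  · simp only [real_inner_smul_left, inner_smul_right, inner_sub_right, inner_add_left, hNN, hNN',
      hγ, hγ']
    ring
  · field_simp
  · field_simp

end Frames

/-! ### The induced metric in a chart and its gradients -/

section Metric

variable {L : ℕ}

lemma contDiff_adjoint {n : WithTop ℕ∞} :
    ContDiff ℝ n (fun A : E L →L[ℝ] E L => ContinuousLinearMap.adjoint A) := by
  let T : (E L →L[ℝ] E L) →ₗ[ℝ] (E L →L[ℝ] E L) :=
    { toFun := fun A => ContinuousLinearMap.adjoint A
      map_add' := fun A B => map_add _ A B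
      map_smul' := fun c A => by simp }
  exact (LinearMap.toContinuousLinearMap T).contDiff

/-- The metric on `coordSubspace L m` induced by the injective linear map `A`, extended by the
Euclidean metric on the orthogonal complement. -/
noncomputable def metricOp (m : ℕ) (A : E L →L[ℝ] E L) : E L →L[ℝ] E L :=
  (ContinuousLinearMap.adjoint (A * (coordSubspace L m).starProjection)) *
    (A * (coordSubspace L m).starProjection) + (1 - (coordSubspace L m).starProjection)

/-- The linear map which raises indices by the metric of `coordSubspace L m` induced by `A`. -/
noncomputable def raiseIndex (m : ℕ) (A : E L →L[ℝ] E L) : E L →L[ℝ] E L :=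
  Ring.inverse (metricOp m A) * (coordSubspace L m).starProjection

lemma inner_metricOp (m : ℕ) (A : E L →L[ℝ] E L) (u v : E L) :
    inner ℝ (metricOp m A u) v =
      inner ℝ (A ((coordSubspace L m).starProjection u)) (A ((coordSubspace L m).starProjection v)) +
      inner ℝ (u - (coordSubspace L m).starProjection u) v := by
  simp [metricOp, inner_add_left, ContinuousLinearMap.adjoint_inner_left]

/-- With `P` the orthogonal projection onto the coordinate subspace, the associated quadratic form
is `‖B P u‖² + ‖u - P u‖²`, which is positive definite. The identity on the complement is included
so that the operator is invertible on all of `ℝ^L`, where inversion depends smoothly on `A`. -/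
lemma isUnit_metricOp (m : ℕ) (B : E L ≃L[ℝ] E L) :
    IsUnit (metricOp m (B : E L →L[ℝ] E L)) := by
  set K := coordSubspace L m
  have hinj : Function.Injective (metricOp m (B : E L →L[ℝ] E L)) := by
    rw [injective_iff_map_eq_zero]
    intro u hu
    have h1 := inner_metricOp m (B : E L →L[ℝ] E L) u u
    have h2 : inner ℝ (u - K.starProjection u) u =
        ‖u - K.starProjection u‖ ^ 2 := by
      have h3 : inner ℝ (u - K.starProjection u) (K.starProjection u) = (0 : ℝ) :=
        K.starProjection_inner_eq_zero u _ (K.starProjection_apply_mem u)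
      rw [← real_inner_self_eq_norm_sq, inner_sub_right (u - K.starProjection u), h3, sub_zero]
    rw [hu, inner_zero_left, h2, real_inner_self_eq_norm_sq] at h1
    have h4 : ‖u - K.starProjection u‖ = 0 := by
      nlinarith [norm_nonneg (u - K.starProjection u), sq_nonneg ‖B (K.starProjection u)‖,
        sq_nonneg ‖(B : E L →L[ℝ] E L) (K.starProjection u)‖]
    have h5 : ‖(B : E L →L[ℝ] E L) (K.starProjection u)‖ = 0 := by
      rw [h4] at h1
      nlinarith [norm_nonneg ((B : E L →L[ℝ] E L) (K.starProjection u))]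
    have h6 : K.starProjection u = 0 := by
      have := norm_eq_zero.1 h5
      exact (map_eq_zero_iff B B.injective).1 this
    rw [h6, sub_zero, norm_eq_zero] at h4
    exact h4
  rw [ContinuousLinearMap.isUnit_iff_bijective]
  exact ⟨hinj, LinearMap.surjective_of_injective
    (f := (metricOp m (B : E L →L[ℝ] E L) : E L →ₗ[ℝ] E L)) hinj⟩

lemma metricOp_raiseIndex (m : ℕ) (B : E L ≃L[ℝ] E L) (c : E L) :
    metricOp m (B : E L →L[ℝ] E L) (raiseIndex m (B : E L →L[ℝ] E L) c) =
      (coordSubspace L m).starProjection c := by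
  have h := Ring.mul_inverse_cancel _ (isUnit_metricOp m B)
  rw [raiseIndex, mul_apply_eq_comp, ← mul_apply_eq_comp, h,
    one_apply_eq_self]

/-- Pairing the equation that defines `u` with the component `u - P u` orthogonal to the subspace
leaves `‖u - P u‖² = 0`. -/
lemma raiseIndex_mem (m : ℕ) (B : E L ≃L[ℝ] E L) (c : E L) :
    raiseIndex m (B : E L →L[ℝ] E L) c ∈ coordSubspace L m := by
  set K := coordSubspace L m
  set u := raiseIndex m (B : E L →L[ℝ] E L) c
  have h0 : K.starProjection (u - K.starProjection u) = 0 := by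
    rw [map_sub, K.starProjection_eq_self_iff.2 (K.starProjection_apply_mem u), sub_self]
  have h1 := inner_metricOp m (B : E L →L[ℝ] E L) u (u - K.starProjection u)
  rw [metricOp_raiseIndex, h0, map_zero, inner_zero_right, zero_add, real_inner_comm,
    K.starProjection_inner_eq_zero u _ (K.starProjection_apply_mem c)] at h1
  have h2 : u - K.starProjection u = 0 := inner_self_eq_zero.1 h1.symm
  exact K.starProjection_eq_self_iff.1 (sub_eq_zero.1 h2).symm

/-- This is the defining property of the metric gradient of the linear function `⟨c, ·⟩`; the
gradient of a face function is the metric normal of that face. -/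
lemma inner_raiseIndex (m : ℕ) (B : E L ≃L[ℝ] E L) (c : E L) {v : E L}
    (hv : v ∈ coordSubspace L m) :
    inner ℝ (B v) (B (raiseIndex m (B : E L →L[ℝ] E L) c)) = inner ℝ c v := by
  set K := coordSubspace L m
  have hu : K.starProjection (raiseIndex m (B : E L →L[ℝ] E L) c) =
      raiseIndex m (B : E L →L[ℝ] E L) c := K.starProjection_eq_self_iff.2 (raiseIndex_mem m B c)
  have hv' : K.starProjection v = v := K.starProjection_eq_self_iff.2 hv
  have h1 := inner_metricOp m (B : E L →L[ℝ] E L) (raiseIndex m (B : E L →L[ℝ] E L) c) v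
  rw [metricOp_raiseIndex, hu, hv', sub_self, inner_zero_left, add_zero] at h1
  rw [real_inner_comm]
  refine h1.symm.trans ?_
  have h2 : inner ℝ (c - K.starProjection c) v = (0 : ℝ) := K.starProjection_inner_eq_zero c v hv
  rw [inner_sub_left] at h2
  linarith

lemma eq_of_inner_map_eq {m : ℕ} (B : E L ≃L[ℝ] E L) {u u' : E L}
    (hu : u ∈ coordSubspace L m) (hu' : u' ∈ coordSubspace L m)
    (h : ∀ v ∈ coordSubspace L m, inner ℝ (B v) (B u) = inner ℝ (B v) (B u')) : u = u' := by
  have h1 := h _ (sub_mem hu hu')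
  rw [← sub_eq_zero, ← inner_sub_right, ← map_sub, inner_self_eq_zero,
    map_eq_zero_iff B B.injective] at h1
  exact sub_eq_zero.1 h1

/-- At the centre of a local model the differential is orthogonal, so the metric gradient there is
the Euclidean one. This gives `U 0 = a` and `V 0 = b`. -/
lemma raiseIndex_isometry (m : ℕ) (B : E L ≃ₗᵢ[ℝ] E L) {c : E L} (hc : c ∈ coordSubspace L m) :
    raiseIndex m (B.toContinuousLinearEquiv : E L →L[ℝ] E L) c = c := by
  refine eq_of_inner_map_eq B.toContinuousLinearEquiv (raiseIndex_mem m _ c) hc fun v hv => ?_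
  rw [inner_raiseIndex m B.toContinuousLinearEquiv c hv, real_inner_comm]
  exact (B.inner_map_map v c).symm

lemma contDiffAt_raiseIndex (m : ℕ) (B : E L ≃L[ℝ] E L) {n : WithTop ℕ∞} :
    ContDiffAt ℝ n (fun A : E L →L[ℝ] E L => raiseIndex m A) (B : E L →L[ℝ] E L) := by
  have h1 : ContDiff ℝ n (fun A : E L →L[ℝ] E L => metricOp m A) := by
    have h : ContDiff ℝ n (fun A : E L →L[ℝ] E L => A * (coordSubspace L m).starProjection) :=
      contDiff_id.mul contDiff_const
    exact ((contDiff_adjoint.comp h).mul h).add contDiff_const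
  obtain ⟨w, hw⟩ := isUnit_metricOp m B
  have h2 : ContDiffAt ℝ n Ring.inverse (metricOp m (B : E L →L[ℝ] E L)) := by
    rw [← hw]
    exact contDiffAt_ringInverse ℝ w
  exact (h2.comp (B : E L →L[ℝ] E L) h1.contDiffAt).mul contDiffAt_const

lemma contDiffOn_raiseIndex (m : ℕ) {φ : OpenPartialHomeomorph (E L) (E L)}
    (h1 : ContDiffOn ℝ ∞ φ φ.source) (h2 : ContDiffOn ℝ ∞ φ.symm φ.target) :
    ContDiffOn ℝ ∞ (fun x => raiseIndex m (fderiv ℝ φ x)) φ.source := by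
  intro x hx
  obtain ⟨B, hB, -⟩ := exists_equiv_hasFDerivAt h1 h2 hx
  have h3 : ContDiffAt ℝ ∞ (fderiv ℝ φ) x :=
    (h1.fderiv_of_isOpen φ.open_source (by simp)).contDiffAt (φ.open_source.mem_nhds hx)
  have h4 := contDiffAt_raiseIndex m B (n := ∞)
  rw [← hB.fderiv] at h4
  exact (h4.comp x h3).contDiffWithinAt

end Metric

/-! ### Tangent cones of a wedge in frames orthonormal for the metric -/

section AdaptedFrames

variable {L : ℕ}

/-- A face inequality that is strict at `x` stays strict under small displacements, so only the
inequalities that are equalities at `x` constrain `v`. -/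
lemma eventually_add_mem_wedge_iff {m : ℕ} {θ : ℝ} {x : E L} (hx : x ∈ wedge L m θ) :
    ∀ᶠ v in 𝓝 (0 : E L), x + v ∈ wedge L m θ ↔ v ∈ coordSubspace L m ∧
      (inner ℝ (faceNormal L θ 1) x = 0 → 0 ≤ inner ℝ (faceNormal L θ 1) v) ∧
      (inner ℝ (faceNormal L θ (-1)) x = 0 → 0 ≤ inner ℝ (faceNormal L θ (-1)) v) := by
  have h : ∀ c : E L, 0 ≤ inner ℝ c x → ∀ᶠ v in 𝓝 (0 : E L),
      0 ≤ inner ℝ c (x + v) ↔ (inner ℝ c x = 0 → 0 ≤ inner ℝ c v) := by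
    intro c hc
    rcases hc.eq_or_lt with h0 | h0
    · refine Eventually.of_forall fun v => ?_
      rw [inner_add_right, ← h0, zero_add]
      simp
    · have h1 : ContinuousAt (fun v : E L => inner ℝ c (x + v)) 0 := by fun_prop
      have h2 : ∀ᶠ v in 𝓝 (0 : E L), 0 < inner ℝ c (x + v) :=
        h1.eventually (lt_mem_nhds (by simpa using h0))
      filter_upwards [h2] with v hv
      exact ⟨fun _ h3 => absurd h3 h0.ne', fun _ => hv.le⟩
  filter_upwards [h _ hx.2.1, h _ hx.2.2] with v h1 h2
  rw [mem_wedge, h1, h2, Submodule.add_mem_iff_right _ hx.1]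

/-- The first frame vector is the normalised metric normal `B U` of the face. It is orthogonal to
`ν` by assumption, so the two extend to a common frame. -/
lemma exists_adapted_frame_halfspace {n : ℕ} (hn : 2 ≤ n) (hL : n + 1 ≤ L)
    (B : E L ≃L[ℝ] E L) {a U ν : E L}
    (hU : U ∈ coordSubspace L (n + 1)) (hU0 : U ≠ 0)
    (hUB : ∀ v ∈ coordSubspace L (n + 1), inner ℝ (B v) (B U) = inner ℝ a v)
    (hν : B.symm ν ∈ coordSubspace L (n + 1)) (hν1 : ‖ν‖ = 1) (hUν : inner ℝ (B U) ν = (0 : ℝ)) :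
    ∃ O : E L ≃ₗᵢ[ℝ] E L, O (basisVec L n) = ν ∧
      (∀ y, B.symm (O y) ∈ coordSubspace L (n + 1) ↔ y ∈ coordSubspace L (n + 1)) ∧
      ∀ v, v ∈ coordSubspace L (n + 1) ∧ 0 ≤ inner ℝ a v ↔
        O.symm (B v) ∈ wedge L (n + 1) Real.pi := by
  have hBU : 0 < ‖B U‖ := norm_pos_iff.2 fun h => hU0 ((map_eq_zero_iff B B.injective).1 h)
  obtain ⟨O, h1, h2, h3⟩ := exists_frame_one (f := ‖B U‖⁻¹ • B U) (by omega) hL B hν hν1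
    (by rw [map_smul, B.symm_apply_apply]; exact Submodule.smul_mem _ _ hU)
    (by rw [norm_smul, norm_inv, norm_norm, inv_mul_cancel₀ hBU.ne'])
    (by rw [real_inner_smul_left, hUν, mul_zero])
  refine ⟨O, h1, h3, fun v => ?_⟩
  have h4 : O.symm (B v) ∈ coordSubspace L (n + 1) ↔ v ∈ coordSubspace L (n + 1) := by
    rw [← h3]; simp
  simp only [mem_wedge, h4, faceNormal_pi, and_self]
  refine and_congr_right fun hv => ?_
  have h5 : inner ℝ (basisVec L 0) (O.symm (B v)) = ‖B U‖⁻¹ * inner ℝ a v := by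
    rw [← O.inner_map_map, O.apply_symm_apply, h2, real_inner_smul_left, real_inner_comm,
      hUB v hv]
  rw [h5]
  exact (mul_nonneg_iff_of_pos_left (inv_pos.2 hBU)).symm

/-- The first two frame vectors are the normalised sum and difference of the metric unit normals of
the faces, so that those normals become the standard face normals. The new angle `θ` is measured by
the metric. -/
lemma exists_adapted_frame_edge {n : ℕ} (hn : 2 ≤ n) (hL : n + 1 ≤ L)
    (B : E L ≃L[ℝ] E L) {a b U V ν : E L}
    (hU : U ∈ coordSubspace L (n + 1)) (hV : V ∈ coordSubspace L (n + 1))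
    (hUV : LinearIndependent ℝ ![U, V])
    (hUB : ∀ v ∈ coordSubspace L (n + 1), inner ℝ (B v) (B U) = inner ℝ a v)
    (hVB : ∀ v ∈ coordSubspace L (n + 1), inner ℝ (B v) (B V) = inner ℝ b v)
    (hν : B.symm ν ∈ coordSubspace L (n + 1)) (hν1 : ‖ν‖ = 1) (hUν : inner ℝ (B U) ν = (0 : ℝ))
    (hVν : inner ℝ (B V) ν = (0 : ℝ)) :
    ∃ θ : ℝ, 0 < θ ∧ θ < Real.pi ∧ ∃ O : E L ≃ₗᵢ[ℝ] E L, O (basisVec L n) = ν ∧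
      (∀ y, B.symm (O y) ∈ coordSubspace L (n + 1) ↔ y ∈ coordSubspace L (n + 1)) ∧
      ∀ v, v ∈ coordSubspace L (n + 1) ∧ 0 ≤ inner ℝ a v ∧ 0 ≤ inner ℝ b v ↔
        O.symm (B v) ∈ wedge L (n + 1) θ := by
  have hU0 : U ≠ 0 := by simpa using hUV.ne_zero 0
  have hV0 : V ≠ 0 := by simpa using hUV.ne_zero 1
  have hBU : 0 < ‖B U‖ := norm_pos_iff.2 fun h => hU0 ((map_eq_zero_iff B B.injective).1 h)
  have hBV : 0 < ‖B V‖ := norm_pos_iff.2 fun h => hV0 ((map_eq_zero_iff B B.injective).1 h)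
  set N := ‖B U‖⁻¹ • B U
  set N' := ‖B V‖⁻¹ • B V
  have hN1 : ‖N‖ = 1 := by
    simp only [N]; rw [norm_smul, norm_inv, norm_norm, inv_mul_cancel₀ hBU.ne']
  have hN1' : ‖N'‖ = 1 := by
    simp only [N']; rw [norm_smul, norm_inv, norm_norm, inv_mul_cancel₀ hBV.ne']
  have hN : B.symm N ∈ coordSubspace L (n + 1) := by
    simp only [N]; rw [map_smul, B.symm_apply_apply]; exact Submodule.smul_mem _ _ hU
  have hN' : B.symm N' ∈ coordSubspace L (n + 1) := by
    simp only [N']; rw [map_smul, B.symm_apply_apply]; exact Submodule.smul_mem _ _ hV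
  -- Strictness in the Cauchy-Schwarz inequality: equality would make `U` and `V` proportional.
  have hlt : |inner ℝ N N'| < (1 : ℝ) := by
    have hle := abs_real_inner_le_norm N N'
    rw [hN1, hN1', one_mul] at hle
    refine lt_of_le_of_ne hle fun heq => ?_
    have h1 : |inner ℝ N N'| = ‖N‖ * ‖N'‖ := by rw [heq, hN1, hN1', one_mul]
    have hN0 : N ≠ 0 := by rw [← norm_pos_iff, hN1]; exact one_pos
    have htfae : ‖(inner ℝ N N' : ℝ)‖ = ‖N‖ * ‖N'‖ ↔ N = 0 ∨ ∃ r : ℝ, N' = r • N :=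
      (norm_inner_eq_norm_tfae ℝ N N').out 0 2
    obtain ⟨r, hr⟩ := (htfae.1 h1).resolve_left hN0
    have h2 : V = (‖B V‖ * r * ‖B U‖⁻¹) • U := by
      apply B.injective
      have h3 : B V = ‖B V‖ • N' := by
        simp only [N']; rw [smul_smul, mul_inv_cancel₀ hBV.ne', one_smul]
      calc B V = ‖B V‖ • (r • N) := by rw [← hr, ← h3]
        _ = B ((‖B V‖ * r * ‖B U‖⁻¹) • U) := by
          rw [map_smul]
          simp only [N, smul_smul, mul_assoc]
    have h4 := (LinearIndependent.pair_iff.1 hUV (-(‖B V‖ * r * ‖B U‖⁻¹)) 1 (by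
      rw [one_smul, neg_smul]
      nth_rewrite 2 [h2]
      simp)).2
    exact one_ne_zero h4
  obtain ⟨θ, h0, hπ, c, d, k1, k2, k3, k4, k5⟩ := exists_angle_of_unit hN1 hN1' hlt
  have hNν : inner ℝ N ν = (0 : ℝ) := by simp only [N]; rw [real_inner_smul_left, hUν, mul_zero]
  have hNν' : inner ℝ N' ν = (0 : ℝ) := by simp only [N']; rw [real_inner_smul_left, hVν, mul_zero]
  obtain ⟨O, h1, h2, h3, h4⟩ := exists_frame_two (f := c • (N + N')) (g := d • (N' - N)) hn hL B hν
    hν1 (by rw [map_smul, map_add]; exact Submodule.smul_mem _ _ (add_mem hN hN')) k1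
    (by rw [map_smul, map_sub]; exact Submodule.smul_mem _ _ (sub_mem hN' hN)) k2
    (by rw [real_inner_smul_left, inner_add_left, hNν, hNν']; simp)
    (by rw [real_inner_smul_left, inner_sub_left, hNν, hNν']; simp) k3
  refine ⟨θ, h0, hπ, O, h1, h4, fun v => ?_⟩
  have h5 : O.symm (B v) ∈ coordSubspace L (n + 1) ↔ v ∈ coordSubspace L (n + 1) := by
    rw [← h4]; simp
  rw [mem_wedge, h5]
  refine and_congr_right fun hv => ?_
  have hO : ∀ s : ℝ, O (faceNormal L θ s) = (1 / 2 : ℝ) • (N + N') - (s / 2) • (N' - N) := by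
    intro s
    rw [faceNormal, map_sub, map_smul, map_smul, h2, h3, smul_smul, smul_smul, k4, mul_assoc, k5]
    congr 2
    ring
  have h6 : O (faceNormal L θ 1) = N := by rw [hO]; module
  have h7 : O (faceNormal L θ (-1)) = N' := by rw [hO]; module
  rw [← O.inner_map_map (faceNormal L θ 1), ← O.inner_map_map (faceNormal L θ (-1)), O.apply_symm_apply, h6, h7]
  simp only [N, N']
  rw [real_inner_smul_left, real_inner_smul_left, real_inner_comm (B v) (B U), hUB v hv,
    real_inner_comm (B v) (B V), hVB v hv, mul_nonneg_iff_of_pos_left (inv_pos.2 hBU),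
    mul_nonneg_iff_of_pos_left (inv_pos.2 hBV)]

lemma linearIndependent_faceNormal {m : ℕ} (hm : 2 ≤ m) (hL : 2 ≤ L) {θ : ℝ} (h0 : 0 < θ)
    (hπ : θ < Real.pi) (B : E L ≃L[ℝ] E L) {U V : E L}
    (hUB : ∀ v ∈ coordSubspace L m, inner ℝ (B v) (B U) = inner ℝ (faceNormal L θ 1) v)
    (hVB : ∀ v ∈ coordSubspace L m, inner ℝ (B v) (B V) = inner ℝ (faceNormal L θ (-1)) v) :
    LinearIndependent ℝ ![U, V] := by
  have hs := sin_half_pos h0 hπ.le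
  have hc := cos_half_pos h0 hπ
  rw [LinearIndependent.pair_iff]
  intro k l hkl
  have h1 : ∀ v ∈ coordSubspace L m,
      k * inner ℝ (faceNormal L θ 1) v + l * inner ℝ (faceNormal L θ (-1)) v = 0 := by
    intro v hv
    rw [← hUB v hv, ← hVB v hv, ← inner_smul_right, ← inner_smul_right, ← inner_add_right,
      ← map_smul, ← map_smul, ← map_add, hkl, map_zero, inner_zero_right]
  have e0 := h1 _ (basisVec_mem (show 0 < m by omega))
  have e1 := h1 _ (basisVec_mem (show 1 < m by omega))
  simp only [inner_faceNormal, inner_basisVec_basisVec (show 0 < L by omega),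
    inner_basisVec_basisVec (show 1 < L by omega)] at e0 e1
  norm_num at e0 e1
  have e0' : (k + l) * Real.sin (θ / 2) = 0 := by linarith
  have e1' : (l - k) * Real.cos (θ / 2) = 0 := by linarith
  have f0 := (mul_eq_zero.1 e0').resolve_right hs.ne'
  have f1 := (mul_eq_zero.1 e1').resolve_right hc.ne'
  constructor <;> linarith

/-- At every point of a wedge there is a frame, orthonormal for a given metric, in which the tangent
cone of the wedge is a model cone. -/
lemma exists_adapted_frame {n : ℕ} (hn : 2 ≤ n) (hL : n + 1 ≤ L) {θ : ℝ} (h0 : 0 < θ)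
    (hπ : θ < Real.pi) (B : E L ≃L[ℝ] E L) {U V ν x : E L}
    (hU : U ∈ coordSubspace L (n + 1)) (hV : V ∈ coordSubspace L (n + 1))
    (hUB : ∀ v ∈ coordSubspace L (n + 1), inner ℝ (B v) (B U) = inner ℝ (faceNormal L θ 1) v)
    (hVB : ∀ v ∈ coordSubspace L (n + 1), inner ℝ (B v) (B V) = inner ℝ (faceNormal L θ (-1)) v)
    (hx : x ∈ wedge L (n + 1) θ)
    (hν : B.symm ν ∈ coordSubspace L (n + 1)) (hν1 : ‖ν‖ = 1)
    (hUν : inner ℝ (faceNormal L θ 1) x = 0 → inner ℝ (B U) ν = (0 : ℝ))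
    (hVν : inner ℝ (faceNormal L θ (-1)) x = 0 → inner ℝ (B V) ν = (0 : ℝ)) :
    ∃ (o : Option ℝ) (O : E L ≃ₗᵢ[ℝ] E L), IsAngle o ∧ O (basisVec L n) = ν ∧
      (∀ y, B.symm (O y) ∈ coordSubspace L (n + 1) ↔ y ∈ coordSubspace L (n + 1)) ∧
      (∀ᶠ v in 𝓝 (0 : E L), x + v ∈ wedge L (n + 1) θ ↔
        O.symm (B v) ∈ modelCone L (n + 1) o) ∧
      ((∃ θ', θ' < Real.pi ∧ o = some θ') ↔
        inner ℝ (faceNormal L θ 1) x = 0 ∧ inner ℝ (faceNormal L θ (-1)) x = 0) := by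
  have hlin := linearIndependent_faceNormal (by omega) (by omega) h0 hπ B hUB hVB
  have hU0 : U ≠ 0 := by simpa using hlin.ne_zero 0
  have hV0 : V ≠ 0 := by simpa using hlin.ne_zero 1
  have hloc := eventually_add_mem_wedge_iff hx
  have hpi : IsAngle (some Real.pi) := by
    intro θ' h
    obtain rfl : Real.pi = θ' := by simpa using h
    exact ⟨Real.pi_pos, le_rfl⟩
  by_cases ha : inner ℝ (faceNormal L θ 1) x = (0 : ℝ) <;>
    by_cases hb : inner ℝ (faceNormal L θ (-1)) x = (0 : ℝ)
  · obtain ⟨θ', h0', hπ', O, h1, h2, h3⟩ := exists_adapted_frame_edge hn hL B hU hV hlin hUB hVB hν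
      hν1 (hUν ha) (hVν hb)
    refine ⟨some θ', O, ?_, h1, h2, hloc.mono fun v hv => ?_, ?_⟩
    · intro θ'' h
      obtain rfl : θ' = θ'' := by simpa using h
      exact ⟨h0', hπ'.le⟩
    · rw [hv, modelCone, ← h3]
      simp [ha, hb]
    · exact iff_of_true ⟨θ', hπ', rfl⟩ ⟨ha, hb⟩
  · obtain ⟨O, h1, h2, h3⟩ := exists_adapted_frame_halfspace hn hL B hU hU0 hUB hν hν1 (hUν ha)
    refine ⟨some Real.pi, O, hpi, h1, h2, hloc.mono fun v hv => ?_, ?_⟩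
    · rw [hv, modelCone, ← h3]
      simp [ha, hb]
    · simp [hb]
  · obtain ⟨O, h1, h2, h3⟩ := exists_adapted_frame_halfspace hn hL B hV hV0 hVB hν hν1 (hVν hb)
    refine ⟨some Real.pi, O, hpi, h1, h2, hloc.mono fun v hv => ?_, ?_⟩
    · rw [hv, modelCone, ← h3]
      simp [ha, hb]
    · simp [ha]
  · obtain ⟨O, h1, h2⟩ := exists_frame hL B hν hν1
    refine ⟨none, O, by simp [IsAngle], h1, h2, hloc.mono fun v hv => ?_, by simp [ha]⟩
    have h5 : O.symm (B v) ∈ coordSubspace L (n + 1) ↔ v ∈ coordSubspace L (n + 1) := by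
      rw [← h2]; simp
    rw [hv, modelCone, SetLike.mem_coe, h5]
    simp [ha, hb]

end AdaptedFrames

/-! ### Second derivatives: chain rule and a vanishing criterion -/

section SecondDerivatives

variable {X Y Z : Type*} [NormedAddCommGroup X] [NormedSpace ℝ X] [NormedAddCommGroup Y]
  [NormedSpace ℝ Y] [NormedAddCommGroup Z] [NormedSpace ℝ Z]

lemma hasFDerivAt_fderiv {f : X → Y} {x : X} (h : ContDiffAt ℝ 2 f x) :
    HasFDerivAt (fderiv ℝ f) (fderiv ℝ (fderiv ℝ f) x) x :=
  ((h.fderiv_right (m := 1) (by norm_num)).differentiableAt (by simp)).hasFDerivAt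

/-- The chain rule for second derivatives. -/
lemma fderiv_fderiv_comp {f : Y → Z} {g : X → Y} {x : X} (hf : ContDiffAt ℝ 2 f (g x))
    (hg : ContDiffAt ℝ 2 g x) (u w : X) :
    fderiv ℝ (fderiv ℝ (f ∘ g)) x u w =
      fderiv ℝ (fderiv ℝ f) (g x) (fderiv ℝ g x u) (fderiv ℝ g x w) +
        fderiv ℝ f (g x) (fderiv ℝ (fderiv ℝ g) x u w) := by
  have h1 : fderiv ℝ (f ∘ g) =ᶠ[𝓝 x] fun y => (fderiv ℝ f (g y)).comp (fderiv ℝ g y) := by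
    filter_upwards [hg.continuousAt.eventually (hf.eventually (by simp)),
      hg.eventually (by simp)] with y h1 h2
    exact fderiv_comp y (h1.differentiableAt (by simp)) (h2.differentiableAt (by simp))
  have h2 : HasFDerivAt (fun y => fderiv ℝ f (g y))
      ((fderiv ℝ (fderiv ℝ f) (g x)).comp (fderiv ℝ g x)) x :=
    (hasFDerivAt_fderiv hf).comp x (hg.differentiableAt (by simp)).hasFDerivAt
  rw [h1.fderiv_eq, (h2.clm_comp (hasFDerivAt_fderiv hg)).fderiv]
  simp [add_comm]

lemma fderiv_fderiv_clm_comp (T : Y →L[ℝ] Z) {g : X → Y} {x : X} (hg : ContDiffAt ℝ 2 g x)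
    (u w : X) : fderiv ℝ (fderiv ℝ (fun y => T (g y))) x u w = T (fderiv ℝ (fderiv ℝ g) x u w) := by
  have h := fderiv_fderiv_comp T.contDiff.contDiffAt hg u w (f := T)
  have h0 : fderiv ℝ (T : Y → Z) = fun _ => T := funext fun y => T.fderiv
  rw [h0, fderiv_fun_const] at h
  simpa [Function.comp_def] using h

lemma hasDerivAt_fderiv_apply {f : X → Y} {x : X} (h : ContDiffAt ℝ 2 f x) (u w : X) :
    HasDerivAt (fun s : ℝ => fderiv ℝ f (x + s • u) w) (fderiv ℝ (fderiv ℝ f) x u w) 0 := by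
  have h1 : HasDerivAt (fun s : ℝ => x + s • u) u 0 := by
    simpa using ((hasDerivAt_id (0 : ℝ)).smul_const u).const_add x
  have h2 : HasDerivAt (fun s : ℝ => fderiv ℝ f (x + s • u)) (fderiv ℝ (fderiv ℝ f) x u) 0 := by
    refine HasFDerivAt.comp_hasDerivAt (0 : ℝ) (f := fun s : ℝ => x + s • u) ?_ h1
    simpa using hasFDerivAt_fderiv h
  simpa using h2.clm_apply (hasDerivAt_const (0 : ℝ) w)

/-- A function which is nonnegative on the half-space bounded by `W`, vanishes on `W` and has
vanishing derivative at a point of `W` has no mixed second derivative there. -/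
lemma fderiv_fderiv_eq_zero_of_nonneg {f : X → ℝ} (hf : ContDiffAt ℝ 2 f 0) {W : Submodule ℝ X}
    {u : X} (h1 : ∀ᶠ y in 𝓝 (0 : X), ∀ w ∈ W, ∀ s : ℝ, 0 ≤ s → y = w + s • u → 0 ≤ f y)
    (h2 : ∀ᶠ y in 𝓝 (0 : X), y ∈ W → f y = 0) (h3 : fderiv ℝ f 0 u = 0) {w : X} (hw : w ∈ W) :
    fderiv ℝ (fderiv ℝ f) 0 u w = 0 := by
  -- By symmetry it suffices to differentiate, along `w`, the first derivative in the direction `u`.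
  rw [(hf.isSymmSndFDerivAt (by simp)).eq u w]
  have hd := hasDerivAt_fderiv_apply hf w u
  have hc : Tendsto (fun t : ℝ => (0 : X) + t • w) (𝓝 0) (𝓝 0) := by
    have : Continuous fun t : ℝ => (0 : X) + t • w := by fun_prop
    simpa using this.tendsto 0
  -- At points of `W` near `0` the function vanishes and is nonnegative on the side of `u`, so its
  -- derivative along `u` is nonnegative. At `0` this derivative is zero, hence minimal.
  have hmin : IsLocalMin (fun t : ℝ => fderiv ℝ f (0 + t • w) u) 0 := by
    filter_upwards [hc.eventually h1.eventually_nhds, hc.eventually h2,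
      hc.eventually (hf.eventually (by simp))] with t ht1 ht2 ht3
    simp only [zero_smul, add_zero, h3]
    simp only [zero_add] at ht1 ht2 ht3 ⊢
    have hdiff := (ht3.differentiableAt (by simp)).hasFDerivAt
    refine hasFDerivAt_mem_of_isClosed hdiff (isClosed_Ici (a := (0 : ℝ)))
      (fun y hy c hc => mul_nonneg hc hy) ?_
    have hs : Tendsto (fun s : ℝ => t • w + s • u) (𝓝[>] 0) (𝓝 (t • w)) := by
      have : Continuous fun s : ℝ => t • w + s • u := by fun_prop
      simpa using (this.tendsto 0).mono_left nhdsWithin_le_nhds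
    filter_upwards [hs.eventually ht1, self_mem_nhdsWithin] with s hs1 hs2
    rw [ht2 (W.smul_mem t hw), sub_zero]
    exact hs1 _ (W.smul_mem t hw) s (le_of_lt hs2) rfl
  exact hmin.hasDerivAt_eq_zero hd

end SecondDerivatives

/-! ### Recentred charts and the edge in a chart -/

section Charts

variable {L : ℕ}

/-- The recentred chart is `y ↦ φ (x + B⁻¹ O y)`: precomposing with `B⁻¹ O` makes its differential
at `0` the isometry `O`, as a local model requires. -/
lemma exists_localModel_of_frame {M Ω Ω' : Set (E L)} {p : E L}
    {φ : OpenPartialHomeomorph (E L) (E L)} (hφ : IsLocalModel M Ω p φ) {x : E L}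
    (hx : x ∈ φ.source) {B : E L ≃L[ℝ] E L} (hB : HasFDerivAt φ (B : E L →L[ℝ] E L) x)
    (O : E L ≃ₗᵢ[ℝ] E L) (hloc : ∀ᶠ v in 𝓝 (0 : E L), x + v ∈ Ω ↔ O.symm (B v) ∈ Ω') :
    ∃ χ, IsLocalModel M Ω' (φ x) χ ∧
      HasFDerivAt χ (O.toContinuousLinearEquiv : E L →L[ℝ] E L) 0 := by
  let A : E L →L[ℝ] E L := (O.toContinuousLinearEquiv.trans B.symm : E L ≃L[ℝ] E L)
  have hA : ∀ y, A y = B.symm (O y) := fun _ => rfl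
  have hA0 : Tendsto A (𝓝 0) (𝓝 0) := by simpa using A.continuous.tendsto 0
  have hg0 : Tendsto (fun y => x + A y) (𝓝 0) (𝓝 x) := by simpa using hA0.const_add x
  have hd : HasFDerivAt (fun y => x + A y) A 0 := A.hasFDerivAt.const_add x
  have hO : HasFDerivAt (fun y => φ (x + A y)) (O.toContinuousLinearEquiv : E L →L[ℝ] E L) 0 := by
    have h1 : HasFDerivAt φ (B : E L →L[ℝ] E L) (x + A 0) := by simpa using hB
    refine (h1.comp (0 : E L) hd).congr_fderiv ?_
    ext1 y
    simp [hA]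
  have hsm : ∀ᶠ y in 𝓝 0, ContDiffAt ℝ ∞ (fun y => φ (x + A y)) y := by
    filter_upwards [hg0.eventually (φ.open_source.mem_nhds hx)] with y hy
    exact (hφ.smooth.contDiffAt (φ.open_source.mem_nhds hy)).comp y
      (contDiffAt_const.add A.contDiff.contDiffAt)
  have hiff : ∀ᶠ y in 𝓝 0, φ (x + A y) ∈ M ↔ y ∈ Ω' := by
    filter_upwards [hg0.eventually (φ.open_source.mem_nhds hx), hA0.eventually hloc] with y hy hy'
    rw [hφ.mem_iff hy, hy', hA]
    simp
  obtain ⟨χ, h1, h2⟩ := exists_isLocalModel (p := φ x) O hsm hO (by simp) hiff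
  exact ⟨χ, h1, by rw [h2]; exact hO⟩

/-- The edge in a chart. -/
lemma mem_edge_iff_of_mem_wedge {n : ℕ} (hn : 2 ≤ n) (hL : n + 1 ≤ L) {M : Set (E L)} {p : E L}
    {θ : ℝ} (h0 : 0 < θ) (hπ : θ < Real.pi) {φ : OpenPartialHomeomorph (E L) (E L)}
    (hφ : IsLocalModel M (wedge L (n + 1) θ) p φ) {x : E L} (hx : x ∈ φ.source)
    (hxw : x ∈ wedge L (n + 1) θ) : φ x ∈ edge (n + 1) M ↔
      inner ℝ (faceNormal L θ 1) x = 0 ∧ inner ℝ (faceNormal L θ (-1)) x = 0 := by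
  obtain ⟨B, hB, -⟩ := exists_equiv_hasFDerivAt hφ.smooth hφ.smooth_symm hx
  have hn' : basisVec L n ∈ coordSubspace L (n + 1) := basisVec_mem (by omega)
  have hne : B (basisVec L n) ≠ 0 := by
    rw [Ne, map_eq_zero_iff B B.injective]
    intro h
    have := inner_basisVec_basisVec (L := L) (i := n) (by omega) n
    rw [h] at this
    simp at this
  -- Here only the type of the model matters. The last frame vector may be the image of any edge
  -- direction, which is metrically orthogonal to both face normals.
  have horth : ∀ s, inner ℝ (B (raiseIndex (n + 1) (B : E L →L[ℝ] E L) (faceNormal L θ s)))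
      (‖B (basisVec L n)‖⁻¹ • B (basisVec L n)) = (0 : ℝ) := by
    intro s
    rw [real_inner_smul_right, real_inner_comm, inner_raiseIndex _ _ _ hn',
      inner_faceNormal_basisVec hn, mul_zero]
  obtain ⟨o, O, ho, -, -, hloc, hiff⟩ := exists_adapted_frame hn hL h0 hπ B
    (raiseIndex_mem _ _ _) (raiseIndex_mem _ _ _)
    (fun v hv => inner_raiseIndex (n + 1) B (faceNormal L θ 1) hv)
    (fun v hv => inner_raiseIndex (n + 1) B (faceNormal L θ (-1)) hv) hxw
    (ν := ‖B (basisVec L n)‖⁻¹ • B (basisVec L n))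
    (by rw [map_smul, B.symm_apply_apply]; exact Submodule.smul_mem _ _ hn')
    (by rw [norm_smul, norm_inv, norm_norm, inv_mul_cancel₀ (norm_ne_zero_iff.2 hne)])
    (fun _ => horth 1) (fun _ => horth (-1))
  obtain ⟨χ, hχ, -⟩ := exists_localModel_of_frame hφ hx hB O hloc
  rw [hχ.mem_edge_iff (by omega) (by omega) ho, hiff]

/-- The edge directions of the wedge. -/
def edgeSpace (L m : ℕ) : Submodule ℝ (E L) where
  carrier := {w | w ∈ coordSubspace L m ∧ inner ℝ (basisVec L 0) w = 0 ∧
    inner ℝ (basisVec L 1) w = 0}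
  add_mem' := by
    rintro a b ⟨ha, ha0, ha1⟩ ⟨hb, hb0, hb1⟩
    exact ⟨add_mem ha hb, by simp [inner_add_right, ha0, hb0], by simp [inner_add_right, ha1, hb1]⟩
  zero_mem' := ⟨zero_mem _, by simp, by simp⟩
  smul_mem' := by
    rintro c a ⟨ha, ha0, ha1⟩
    exact ⟨Submodule.smul_mem _ _ ha, by simp [inner_smul_right, ha0],
      by simp [inner_smul_right, ha1]⟩

lemma mem_edgeSpace_iff {m : ℕ} {θ : ℝ} (h0 : 0 < θ) (hπ : θ < Real.pi) {w : E L} :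
    w ∈ edgeSpace L m ↔ w ∈ coordSubspace L m ∧ inner ℝ (faceNormal L θ 1) w = 0 ∧
      inner ℝ (faceNormal L θ (-1)) w = 0 := by
  have hs := sin_half_pos h0 hπ.le
  have hc := cos_half_pos h0 hπ
  refine and_congr_right fun _ => ?_
  rw [inner_faceNormal, inner_faceNormal]
  constructor
  · rintro ⟨h1, h2⟩
    rw [h1, h2]
    simp
  · rintro ⟨h1, h2⟩
    constructor
    · refine (mul_eq_zero.1 (?_ : Real.sin (θ / 2) * _ = 0)).resolve_left hs.ne'
      linarith
    · refine (mul_eq_zero.1 (?_ : Real.cos (θ / 2) * _ = 0)).resolve_left hc.ne'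
      linarith

/-- Describing the edge directions as the largest subspace in the wedge shows that every linear map
preserving the wedge preserves them. -/
lemma mem_edgeSpace_iff_mem_wedge {m : ℕ} {θ : ℝ} (h0 : 0 < θ) (hπ : θ < Real.pi) {w : E L} :
    w ∈ edgeSpace L m ↔ w ∈ wedge L m θ ∧ -w ∈ wedge L m θ := by
  rw [mem_edgeSpace_iff h0 hπ, mem_wedge, mem_wedge, inner_neg_right, inner_neg_right, neg_mem_iff]
  constructor
  · rintro ⟨h1, h2, h3⟩
    simp [h1, h2, h3]
  · rintro ⟨⟨h1, h2, h3⟩, -, h4, h5⟩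
    exact ⟨h1, by linarith, by linarith⟩

lemma sub_mem_wedge_iff {m : ℕ} {θ : ℝ} (h0 : 0 < θ) (hπ : θ < Real.pi) {w x : E L}
    (hw : w ∈ edgeSpace L m) : x - w ∈ wedge L m θ ↔ x ∈ wedge L m θ := by
  obtain ⟨h1, h2, h3⟩ := (mem_edgeSpace_iff h0 hπ).1 hw
  rw [mem_wedge, mem_wedge, inner_sub_right, inner_sub_right, h2, h3, sub_zero, sub_zero,
    Submodule.sub_mem_iff_left _ h1]

/-- Edge points in a chart are in the connected component of the edge of the centre. -/
lemma mem_connectedComponentIn_edge {n : ℕ} (hn : 2 ≤ n) (hL : n + 1 ≤ L) {M : Set (E L)}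
    {p : E L} {θ : ℝ} (h0 : 0 < θ) (hπ : θ < Real.pi) {φ : OpenPartialHomeomorph (E L) (E L)}
    (hφ : IsLocalModel M (wedge L (n + 1) θ) p φ) {r : ℝ} (hr : Metric.ball 0 r ⊆ φ.source)
    {x : E L} (hx : x ∈ Metric.ball 0 r) (hxe : x ∈ edgeSpace L (n + 1)) :
    φ x ∈ connectedComponentIn (edge (n + 1) M) p := by
  have hball : ∀ s ∈ Icc (0 : ℝ) 1, s • x ∈ Metric.ball (0 : E L) r := by
    intro s hs
    rw [mem_ball_zero_iff] at hx ⊢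
    rw [norm_smul, Real.norm_of_nonneg hs.1]
    nlinarith [norm_nonneg x, hs.1, hs.2]
  have hmem : ∀ s ∈ Icc (0 : ℝ) 1, φ (s • x) ∈ edge (n + 1) M := by
    intro s hs
    have h1 : s • x ∈ edgeSpace L (n + 1) := Submodule.smul_mem _ _ hxe
    rw [mem_edge_iff_of_mem_wedge hn hL h0 hπ hφ (hr (hball s hs))
      ((mem_edgeSpace_iff_mem_wedge h0 hπ).1 h1).1]
    exact ((mem_edgeSpace_iff h0 hπ).1 h1).2
  have hpre : IsPreconnected ((fun s : ℝ => φ (s • x)) '' Icc 0 1) := by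
    refine isPreconnected_Icc.image _ fun s hs => ContinuousAt.continuousWithinAt ?_
    exact ContinuousAt.comp (g := φ) (φ.continuousAt (hr (hball s hs))) (by fun_prop)
  have h1 := hpre.subset_connectedComponentIn (x := p)
    ⟨0, by simp, by simp [hφ.map_zero]⟩ (by rintro _ ⟨s, hs, rfl⟩; exact hmem s hs)
  exact h1 ⟨1, by simp, by simp⟩

end Charts

/-! ### Transfer of the right-angle condition to a fixed chart -/

section RightAngleTransfer

variable {L : ℕ}

/-- Every vector of the coordinate subspace is a difference of two elements of the wedge. -/
lemma mem_coordSubspace_of_equiv {m : ℕ} (hm : 1 ≤ m) (hL : 2 ≤ L) {θ : ℝ} (h0 : 0 < θ)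
    (hπ : θ ≤ Real.pi) {T : E L ≃L[ℝ] E L} (hT : ∀ y ∈ wedge L m θ, T y ∈ wedge L m θ) {y : E L}
    (hy : y ∈ coordSubspace L m) : T y ∈ coordSubspace L m := by
  obtain ⟨R, -, h1, h2⟩ := exists_add_smul_mem_wedge hm hL h0 hπ hy
  have h3 := sub_mem (hT _ h2).1 (hT _ h1).1
  rwa [← map_sub, add_sub_cancel_right] at h3

lemma mem_edgeSpace_of_equiv {m : ℕ} {θ : ℝ} (h0 : 0 < θ)
    (hπ : θ < Real.pi) {T : E L ≃L[ℝ] E L} (hT : ∀ y ∈ wedge L m θ, T y ∈ wedge L m θ) {y : E L}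
    (hy : y ∈ edgeSpace L m) : T y ∈ edgeSpace L m := by
  rw [mem_edgeSpace_iff_mem_wedge h0 hπ] at hy ⊢
  exact ⟨hT _ hy.1, by rw [← map_neg]; exact hT _ hy.2⟩

lemma right_angle_pos : (0 : ℝ) < Real.pi / 2 := by linarith [Real.pi_pos]

lemma right_angle_lt : Real.pi / 2 < Real.pi := by linarith [Real.pi_pos]

lemma inner_faceNormal_right_angle (hL : 2 ≤ L) :
    inner ℝ (faceNormal L (Real.pi / 2) 1) (faceNormal L (Real.pi / 2) (-1)) = (0 : ℝ) := by
  rw [inner_faceNormal_neg hL, Real.cos_pi_div_two, neg_zero]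

/-- The components of a vector in the normal plane of the edge and along the edge. -/
lemma exists_edge_decomposition {m : ℕ} (hm : 2 ≤ m) (hL : 2 ≤ L) {y : E L}
    (hy : y ∈ coordSubspace L m) : ∃ w ∈ edgeSpace L m,
      y = (inner ℝ (faceNormal L (Real.pi / 2) 1) y : ℝ) • faceNormal L (Real.pi / 2) 1 +
        (inner ℝ (faceNormal L (Real.pi / 2) (-1)) y : ℝ) • faceNormal L (Real.pi / 2) (-1) +
        w := by
  have h1 := inner_faceNormal_right_angle hL
  have h1' := h1
  rw [real_inner_comm] at h1'
  have h2 := inner_faceNormal_self hL (Real.pi / 2) (s := 1) (by norm_num)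
  have h3 := inner_faceNormal_self hL (Real.pi / 2) (s := -1) (by norm_num)
  refine ⟨y - ((inner ℝ (faceNormal L (Real.pi / 2) 1) y : ℝ) • faceNormal L (Real.pi / 2) 1 +
    (inner ℝ (faceNormal L (Real.pi / 2) (-1)) y : ℝ) • faceNormal L (Real.pi / 2) (-1)), ?_,
    by abel⟩
  rw [mem_edgeSpace_iff right_angle_pos right_angle_lt]
  refine ⟨sub_mem hy (add_mem (Submodule.smul_mem _ _ (faceNormal_mem hm _ _))
    (Submodule.smul_mem _ _ (faceNormal_mem hm _ _))), ?_, ?_⟩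
  · simp only [inner_sub_right, inner_add_right, inner_smul_right, h1, h2]
    ring
  · simp only [inner_sub_right, inner_add_right, inner_smul_right, h1', h3]
    ring

/-- A linear automorphism of the right-angled wedge preserves or exchanges its faces. -/
lemma exists_perm_of_equiv {m : ℕ} (hm : 2 ≤ m) (hL : 2 ≤ L) {T : E L ≃L[ℝ] E L}
    (hT : ∀ y ∈ wedge L m (Real.pi / 2), T y ∈ wedge L m (Real.pi / 2))
    (hT' : ∀ y ∈ wedge L m (Real.pi / 2), T.symm y ∈ wedge L m (Real.pi / 2)) :
    ∃ u₁ u₂ : E L,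
      ((u₁ = faceNormal L (Real.pi / 2) 1 ∧ u₂ = faceNormal L (Real.pi / 2) (-1)) ∨
        (u₁ = faceNormal L (Real.pi / 2) (-1) ∧ u₂ = faceNormal L (Real.pi / 2) 1)) ∧
      0 < inner ℝ (faceNormal L (Real.pi / 2) 1) (T u₁) ∧
      0 < inner ℝ (faceNormal L (Real.pi / 2) (-1)) (T u₂) ∧
      inner ℝ (faceNormal L (Real.pi / 2) 1) (T u₂) = 0 ∧
      inner ℝ (faceNormal L (Real.pi / 2) (-1)) (T u₁) = 0 := by
  have h1 := inner_faceNormal_right_angle hL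
  have h1' := h1
  rw [real_inner_comm] at h1'
  have h2 := inner_faceNormal_self hL (Real.pi / 2) (s := 1) (by norm_num)
  have h3 := inner_faceNormal_self hL (Real.pi / 2) (s := -1) (by norm_num)
  have hm1 := faceNormal_mem (L := L) hm (Real.pi / 2) 1
  have hm2 := faceNormal_mem (L := L) hm (Real.pi / 2) (-1)
  set a := faceNormal L (Real.pi / 2) 1
  set b := faceNormal L (Real.pi / 2) (-1)
  have ha : a ∈ wedge L m (Real.pi / 2) := ⟨hm1, h2.symm ▸ zero_le_one, h1'.ge⟩
  have hb : b ∈ wedge L m (Real.pi / 2) := ⟨hm2, h1.ge, h3.symm ▸ zero_le_one⟩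
  obtain ⟨-, p1, p2⟩ := hT a ha
  obtain ⟨-, q1, q2⟩ := hT b hb
  obtain ⟨-, r1, r2⟩ := hT' a ha
  obtain ⟨-, s1, s2⟩ := hT' b hb
  -- Modulo the edge directions, `T` and its inverse are 2×2 matrices in the basis `a`, `b`; this is
  -- the formula for their product.
  have key : ∀ y ∈ coordSubspace L m, ∀ c : E L, (c = a ∨ c = b) →
      inner ℝ c y = inner ℝ a (T.symm y) * inner ℝ c (T a) + inner ℝ b (T.symm y) * inner ℝ c (T b) := by
    intro y hy c hc
    obtain ⟨w, hw, hyw⟩ := exists_edge_decomposition hm hL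
      (mem_coordSubspace_of_equiv (T := T.symm) (by omega) hL right_angle_pos right_angle_lt.le
        hT' hy)
    have hTw := (mem_edgeSpace_iff right_angle_pos right_angle_lt).1
      (mem_edgeSpace_of_equiv right_angle_pos right_angle_lt hT hw)
    have h4 := congrArg T hyw
    rw [T.apply_symm_apply, map_add, map_add, map_smul, map_smul] at h4
    have h5 : inner ℝ c (T w) = (0 : ℝ) := by
      rcases hc with rfl | rfl
      · exact hTw.2.1
      · exact hTw.2.2
    nth_rewrite 1 [h4]
    rw [inner_add_right, inner_add_right, inner_smul_right, inner_smul_right, h5, add_zero]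
  have e1 := key a hm1 a (Or.inl rfl)
  have e2 := key a hm1 b (Or.inr rfl)
  have e3 := key b hm2 a (Or.inl rfl)
  have e4 := key b hm2 b (Or.inr rfl)
  change (0 : ℝ) ≤ inner ℝ a _ at p1 q1 r1 s1
  change (0 : ℝ) ≤ inner ℝ b _ at p2 q2 r2 s2
  rw [h2] at e1
  rw [h1'] at e2
  rw [h1] at e3
  rw [h3] at e4
  -- Both matrices have nonnegative entries. An off-diagonal entry of their product is a sum of
  -- nonnegative terms equal to zero, so each term vanishes; thus the matrix of `T` is diagonal or
  -- antidiagonal.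
  have f1 : inner ℝ a (T.symm a) * inner ℝ b (T a) = 0 := by nlinarith [mul_nonneg r1 p2, mul_nonneg r2 q2]
  have f2 : inner ℝ b (T.symm a) * inner ℝ b (T b) = 0 := by nlinarith [mul_nonneg r1 p2, mul_nonneg r2 q2]
  have f3 : inner ℝ a (T.symm b) * inner ℝ a (T a) = 0 := by nlinarith [mul_nonneg s1 p1, mul_nonneg s2 q1]
  have f4 : inner ℝ b (T.symm b) * inner ℝ a (T b) = 0 := by nlinarith [mul_nonneg s1 p1, mul_nonneg s2 q1]
  by_cases hp : inner ℝ b (T a) = (0 : ℝ)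
  · rw [hp, mul_zero, zero_add] at e4
    have g1 : inner ℝ b (T b) ≠ (0 : ℝ) := by rintro h; rw [h, mul_zero] at e4; norm_num at e4
    have g2 : inner ℝ b (T.symm b) ≠ (0 : ℝ) := by rintro h; rw [h, zero_mul] at e4; norm_num at e4
    have g3 := (mul_eq_zero.1 f4).resolve_left g2
    have g4 : inner ℝ a (T a) ≠ (0 : ℝ) := by
      rintro h; rw [h, g3, mul_zero, mul_zero] at e1; norm_num at e1
    exact ⟨a, b, Or.inl ⟨rfl, rfl⟩, lt_of_le_of_ne p1 g4.symm, lt_of_le_of_ne q2 g1.symm, g3, hp⟩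
  · have g1 := (mul_eq_zero.1 f1).resolve_right hp
    rw [g1, zero_mul, zero_add] at e1
    have g2 : inner ℝ a (T b) ≠ (0 : ℝ) := by rintro h; rw [h, mul_zero] at e1; norm_num at e1
    have g3 : inner ℝ b (T.symm a) ≠ (0 : ℝ) := by rintro h; rw [h, zero_mul] at e1; norm_num at e1
    have g4 := (mul_eq_zero.1 f2).resolve_left g3
    have g5 := (mul_eq_zero.1 f4).resolve_right g2
    rw [g5, zero_mul, add_zero] at e4
    have g6 : inner ℝ a (T.symm b) ≠ (0 : ℝ) := by rintro h; rw [h, zero_mul] at e4; norm_num at e4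
    have g7 := (mul_eq_zero.1 f3).resolve_left g6
    exact ⟨b, a, Or.inr ⟨rfl, rfl⟩, lt_of_le_of_ne q1 g2.symm, lt_of_le_of_ne p2 (Ne.symm hp), g7, g4⟩

/-- The right angle condition at an edge point, expressed in any chart. -/
lemma right_angle_in_chart {n : ℕ} (hn : 2 ≤ n) (hL : n + 1 ≤ L) {M : Set (E L)} {p : E L}
    {φ : OpenPartialHomeomorph (E L) (E L)}
    (hφ : IsLocalModel M (wedge L (n + 1) (Real.pi / 2)) p φ) {x : E L} (hx : x ∈ φ.source)
    (hxe : x ∈ edgeSpace L (n + 1)) (hq : RightAngleCondition (n + 1) M (φ x))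
    {B : E L ≃L[ℝ] E L} (hB : HasFDerivAt φ (B : E L →L[ℝ] E L) x) {U V : E L}
    (hU : U ∈ coordSubspace L (n + 1)) (hV : V ∈ coordSubspace L (n + 1))
    (hUB : ∀ v ∈ coordSubspace L (n + 1),
      inner ℝ (B v) (B U) = inner ℝ (faceNormal L (Real.pi / 2) 1) v)
    (hVB : ∀ v ∈ coordSubspace L (n + 1),
      inner ℝ (B v) (B V) = inner ℝ (faceNormal L (Real.pi / 2) (-1)) v) :
    inner ℝ (faceNormal L (Real.pi / 2) (-1)) U = (0 : ℝ) ∧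
      ∀ w ∈ edgeSpace L (n + 1), (inner ℝ (fderiv ℝ (fderiv ℝ φ) x U w) (B V) : ℝ) =
        inner ℝ (fderiv ℝ (fderiv ℝ φ) x V w) (B U) := by
  have hL2 : 2 ≤ L := by omega
  have hm : 2 ≤ n + 1 := by omega
  obtain ⟨χ, hχ, hform⟩ := hq
  obtain ⟨C, hC, hC'⟩ := hχ.exists_equiv
  obtain ⟨B', hB', hBs⟩ := exists_equiv_hasFDerivAt hφ.smooth hφ.smooth_symm hx
  obtain rfl : B = B' := ContinuousLinearEquiv.ext (funext fun v =>
    congrArg (fun A : E L →L[ℝ] E L => A v) (hB.unique hB'))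
  obtain ⟨d1, e1, f1⟩ := hasFDerivAt_transition (fun x hx => hφ.mem_iff hx)
    (fun x hx => hχ.mem_iff hx) hx hχ.zero_mem hχ.map_zero.symm hBs hC
  obtain ⟨d2, e2, f2⟩ := hasFDerivAt_transition (fun x hx => hχ.mem_iff hx)
    (fun x hx => hφ.mem_iff hx) hχ.zero_mem hx hχ.map_zero hC' hB
  set h : E L → E L := φ.symm ∘ χ
  set T : E L ≃L[ℝ] E L := C.toContinuousLinearEquiv.trans B.symm
  have hBT : ∀ y, B (T y) = C y := fun y => B.apply_symm_apply _
  have hsc : ∀ (z y : E L), Tendsto (fun s : ℝ => z + s • y) (𝓝[>] 0) (𝓝 z) := by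
    intro z y
    have : Continuous fun s : ℝ => z + s • y := by fun_prop
    simpa using (this.tendsto 0).mono_left nhdsWithin_le_nhds
  -- The chart `φ` is not centred at the point `φ x`, but `x` lies on the edge, so translation by
  -- `x` preserves the wedge.
  have hT : ∀ y ∈ wedge L (n + 1) (Real.pi / 2), T y ∈ wedge L (n + 1) (Real.pi / 2) := by
    intro y hy
    refine hasFDerivAt_mem_of_isClosed d1 (isClosed_wedge _ _)
      (fun y hy c hc => smul_mem_wedge hy hc) ?_
    filter_upwards [(hsc 0 y).eventually f1, self_mem_nhdsWithin] with s hs hs0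
    rw [e1, sub_mem_wedge_iff right_angle_pos right_angle_lt hxe, hs.2, zero_add]
    exact smul_mem_wedge hy (le_of_lt hs0)
  have hT' : ∀ y ∈ wedge L (n + 1) (Real.pi / 2), T.symm y ∈ wedge L (n + 1) (Real.pi / 2) := by
    intro y hy
    refine hasFDerivAt_mem_of_isClosed (v := y) (T := ((B.trans
      C.toContinuousLinearEquiv.symm : E L ≃L[ℝ] E L) : E L →L[ℝ] E L)) d2 (isClosed_wedge _ _) (fun y hy c hc => smul_mem_wedge hy hc) ?_
    filter_upwards [(hsc x y).eventually f2, self_mem_nhdsWithin] with s hs hs0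
    rw [e2, sub_zero, hs.2, ← sub_mem_wedge_iff right_angle_pos right_angle_lt hxe,
      add_sub_cancel_left]
    exact smul_mem_wedge hy (le_of_lt hs0)
  obtain ⟨u₁, u₂, hu, hp, hq, hp', hq'⟩ := exists_perm_of_equiv hm hL2 hT hT'
  -- Edge points of `M` are defined independently of the chart, so the coordinate change maps edge
  -- to edge, which differentiation of the cone condition alone would not give.
  have hedge : ∀ᶠ y in 𝓝 (0 : E L), y ∈ edgeSpace L (n + 1) → h y ∈ edgeSpace L (n + 1) := by
    have hsrc : ∀ᶠ y in 𝓝 (0 : E L), h y ∈ φ.source := by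
      have : ContinuousAt h 0 := d1.continuousAt
      refine this.eventually (φ.open_source.mem_nhds ?_)
      rw [e1]; exact hx
    filter_upwards [f1, hsrc, χ.open_source.mem_nhds hχ.zero_mem] with y hy hys hyχ hye
    have hyw := ((mem_edgeSpace_iff_mem_wedge right_angle_pos right_angle_lt).1 hye).1
    have h1 := (mem_edge_iff_of_mem_wedge hn hL right_angle_pos right_angle_lt hχ hyχ hyw).2
      ((mem_edgeSpace_iff right_angle_pos right_angle_lt).1 hye).2
    rw [hy.1, mem_edge_iff_of_mem_wedge hn hL right_angle_pos right_angle_lt hφ hys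
      (hy.2.2 hyw)] at h1
    exact (mem_edgeSpace_iff right_angle_pos right_angle_lt).2 ⟨(hy.2.2 hyw).1, h1⟩
  have hh : ContDiffAt ℝ 2 h 0 := by
    have h1 : ContDiffAt ℝ 2 χ 0 := hχ.smooth.contDiffAt_two χ.open_source hχ.zero_mem
    refine ContDiffAt.comp (0 : E L) ?_ h1
    refine hφ.smooth_symm.contDiffAt_two φ.open_target ?_
    rw [hχ.map_zero]
    exact φ.map_source hx
  -- The second derivatives of the coordinate change that vanish.
  have hvan : ∀ c u : E L, u ∈ wedge L (n + 1) (Real.pi / 2) →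
      (∀ y ∈ wedge L (n + 1) (Real.pi / 2), 0 ≤ inner ℝ c y) →
      (∀ y ∈ edgeSpace L (n + 1), inner ℝ c y = (0 : ℝ)) → inner ℝ c (T u) = (0 : ℝ) →
      ∀ w ∈ edgeSpace L (n + 1), inner ℝ c (fderiv ℝ (fderiv ℝ h) 0 u w) = (0 : ℝ) := by
    intro c u hu hc1 hc2 hc3 w hw
    have h1 := fderiv_fderiv_clm_comp (innerSL ℝ c) hh u w
    rw [innerSL_apply_apply] at h1
    rw [← h1]
    have hcont : ContDiffAt ℝ 2 (fun y => innerSL ℝ c (h y)) 0 :=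
      (innerSL ℝ c).contDiff.contDiffAt.comp 0 hh
    refine fderiv_fderiv_eq_zero_of_nonneg hcont ?_ ?_ ?_ hw
    · filter_upwards [f1] with y hy w' hw' s hs hys
      refine hc1 _ (hy.2.2 ?_)
      rw [hys, show w' + s • u = s • u - -w' by abel,
        sub_mem_wedge_iff right_angle_pos right_angle_lt (neg_mem hw')]
      exact smul_mem_wedge hu hs
    · filter_upwards [hedge] with y hy hye
      exact hc2 _ (hy hye)
    · have : HasFDerivAt (fun y => innerSL ℝ c (h y)) _ 0 := (innerSL ℝ c).hasFDerivAt.comp 0 d1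
      rw [this.fderiv]
      exact hc3
  have hmem : ∀ u ∈ wedge L (n + 1) (Real.pi / 2), ∀ w ∈ edgeSpace L (n + 1),
      fderiv ℝ (fderiv ℝ h) 0 u w ∈ coordSubspace L (n + 1) := by
    intro u hu w hw
    rw [mem_coordSubspace]
    intro i hi
    exact hvan _ u hu (fun y hy => (mem_coordSubspace.1 hy.1 i hi).ge)
      (fun y hy => mem_coordSubspace.1 hy.1 i hi) (mem_coordSubspace.1 (hT u hu).1 i hi) w hw
  -- At a right angle each conormal is minus the other face normal, so (‡) says that these two mixed
  -- second derivatives of `χ` agree. The statement is symmetric in the two faces, so it is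
  -- unaffected if `T` exchanges them.
  have hu12 : u₁ ∈ wedge L (n + 1) (Real.pi / 2) ∧ u₂ ∈ wedge L (n + 1) (Real.pi / 2) ∧
      (∀ w ∈ edgeSpace L (n + 1), (inner ℝ (fderiv ℝ (fderiv ℝ χ) 0 u₂ w) (C u₁) : ℝ) =
        inner ℝ (fderiv ℝ (fderiv ℝ χ) 0 u₁ w) (C u₂)) ∧
      ∀ y ∈ coordSubspace L (n + 1), ∃ w ∈ edgeSpace L (n + 1),
        y = (inner ℝ u₁ y : ℝ) • u₁ + (inner ℝ u₂ y : ℝ) • u₂ + w := by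
    have h1 := inner_faceNormal_right_angle hL2
    have h1' := h1
    rw [real_inner_comm] at h1'
    have h2 := inner_faceNormal_self hL2 (Real.pi / 2) (s := 1) (by norm_num)
    have h3 := inner_faceNormal_self hL2 (Real.pi / 2) (s := -1) (by norm_num)
    have hm1 := faceNormal_mem (L := L) hm (Real.pi / 2) 1
    have hm2 := faceNormal_mem (L := L) hm (Real.pi / 2) (-1)
    have ha : faceNormal L (Real.pi / 2) 1 ∈ wedge L (n + 1) (Real.pi / 2) :=
      ⟨hm1, h2.symm ▸ zero_le_one, h1'.ge⟩
    have hb : faceNormal L (Real.pi / 2) (-1) ∈ wedge L (n + 1) (Real.pi / 2) :=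
      ⟨hm2, h1.ge, h3.symm ▸ zero_le_one⟩
    have hf : ∀ w ∈ edgeSpace L (n + 1),
        (inner ℝ (fderiv ℝ (fderiv ℝ χ) 0 (faceNormal L (Real.pi / 2) (-1)) w)
          (C (faceNormal L (Real.pi / 2) 1)) : ℝ) =
        inner ℝ (fderiv ℝ (fderiv ℝ χ) 0 (faceNormal L (Real.pi / 2) 1) w)
          (C (faceNormal L (Real.pi / 2) (-1))) := by
      intro w hw
      have := hform w hw.1 hw.2.1 hw.2.2
      simp only [faceForm, secondFundForm, edgeConormal_right_angle, hC.fderiv, map_neg, neg_neg,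
        neg_apply, inner_neg_left, neg_inj] at this
      exact this
    rcases hu with ⟨rfl, rfl⟩ | ⟨rfl, rfl⟩
    · exact ⟨ha, hb, hf, fun y hy => exists_edge_decomposition hm hL2 hy⟩
    · refine ⟨hb, ha, fun w hw => (hf w hw).symm, fun y hy => ?_⟩
      obtain ⟨w, hw, h⟩ := exists_edge_decomposition hm hL2 hy
      exact ⟨w, hw, by rw [add_comm (_ • _) (_ • _)]; exact h⟩
  obtain ⟨hw1, hw2, hf, hdec⟩ := hu12
  have hTsK : ∀ v ∈ coordSubspace L (n + 1), T.symm v ∈ coordSubspace L (n + 1) := fun v hv =>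
    mem_coordSubspace_of_equiv (T := T.symm) (by omega) hL2 right_angle_pos right_angle_lt.le hT' hv
  have hTe : ∀ w ∈ edgeSpace L (n + 1), T w ∈ edgeSpace L (n + 1) := fun w hw =>
    mem_edgeSpace_of_equiv right_angle_pos right_angle_lt hT hw
  -- The isometry `C = B T` carries the orthonormal normals `u₁`, `u₂` to metric normals of the
  -- faces in the chart `φ`, so `U` is a multiple of `T u₁`. Pairing with a general `v` determines
  -- the factor.
  have hU' : U = (inner ℝ (faceNormal L (Real.pi / 2) 1) (T u₁) : ℝ) • T u₁ := by
    refine eq_of_inner_map_eq B hU (Submodule.smul_mem _ _ (hT _ hw1).1) fun v hv => ?_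
    obtain ⟨w, hw, hvw⟩ := hdec _ (hTsK v hv)
    have h1 := congrArg T hvw
    rw [T.apply_symm_apply, map_add, map_add, map_smul, map_smul] at h1
    have h2 : inner ℝ (faceNormal L (Real.pi / 2) 1) (T w) = (0 : ℝ) :=
      ((mem_edgeSpace_iff right_angle_pos right_angle_lt).1 (hTe w hw)).2.1
    have h3 : inner ℝ (B v) (C u₁) = inner ℝ u₁ (T.symm v) := by
      rw [← T.apply_symm_apply v, hBT, C.inner_map_map, T.apply_symm_apply, real_inner_comm]
    rw [hUB v hv, map_smul, inner_smul_right, hBT, h3]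
    nth_rewrite 1 [h1]
    rw [inner_add_right, inner_add_right, inner_smul_right, inner_smul_right, h2, hp']
    ring
  have hV' : V = (inner ℝ (faceNormal L (Real.pi / 2) (-1)) (T u₂) : ℝ) • T u₂ := by
    refine eq_of_inner_map_eq B hV (Submodule.smul_mem _ _ (hT _ hw2).1) fun v hv => ?_
    obtain ⟨w, hw, hvw⟩ := hdec _ (hTsK v hv)
    have h1 := congrArg T hvw
    rw [T.apply_symm_apply, map_add, map_add, map_smul, map_smul] at h1
    have h2 : inner ℝ (faceNormal L (Real.pi / 2) (-1)) (T w) = (0 : ℝ) :=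
      ((mem_edgeSpace_iff right_angle_pos right_angle_lt).1 (hTe w hw)).2.2
    have h3 : inner ℝ (B v) (C u₂) = inner ℝ u₂ (T.symm v) := by
      rw [← T.apply_symm_apply v, hBT, C.inner_map_map, T.apply_symm_apply, real_inner_comm]
    rw [hVB v hv, map_smul, inner_smul_right, hBT, h3]
    nth_rewrite 1 [h1]
    rw [inner_add_right, inner_add_right, inner_smul_right, inner_smul_right, h2, hq']
    ring
  set P : ℝ := inner ℝ (faceNormal L (Real.pi / 2) 1) (T u₁)
  set Q : ℝ := inner ℝ (faceNormal L (Real.pi / 2) (-1)) (T u₂)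
  refine ⟨by rw [hU', inner_smul_right, hq', mul_zero], fun w hw => ?_⟩
  set w' := T.symm w
  have hw' : w' ∈ edgeSpace L (n + 1) :=
    mem_edgeSpace_of_equiv (T := T.symm) right_angle_pos right_angle_lt hT' hw
  have hTw' : T w' = w := T.apply_symm_apply w
  -- The chain rule for `χ = φ ∘ h`. The term with the second derivative of `h` disappears after
  -- pairing with the normal of the face to which `T u` is tangent, by `hvan`.
  have hsnd : ∀ u : E L, fderiv ℝ (fderiv ℝ χ) 0 u w' =
      fderiv ℝ (fderiv ℝ φ) x (T u) w + B (fderiv ℝ (fderiv ℝ h) 0 u w') := by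
    intro u
    have h1 : χ =ᶠ[𝓝 0] φ ∘ h := f1.mono fun y hy => hy.1
    have hφ2 : ContDiffAt ℝ 2 φ (h 0) := by
      rw [e1]
      exact hφ.smooth.contDiffAt_two φ.open_source hx
    have h2 := fderiv_fderiv_comp hφ2 hh u w'
    rw [h1.fderiv.fderiv_eq, h2, e1, d1.fderiv, hB.fderiv]
    change fderiv ℝ (fderiv ℝ φ) x (T u) (T w') + _ = _
    rw [hTw']
    rfl
  have hBU : B U = P • C u₁ := by rw [hU', map_smul, hBT]
  have hBV : B V = Q • C u₂ := by rw [hV', map_smul, hBT]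
  have k1 : inner ℝ (B (fderiv ℝ (fderiv ℝ h) 0 u₁ w')) (B V) = (0 : ℝ) := by
    rw [hVB _ (hmem u₁ hw1 w' hw')]
    exact hvan _ u₁ hw1 (fun y hy => hy.2.2)
      (fun y hy => ((mem_edgeSpace_iff right_angle_pos right_angle_lt).1 hy).2.2) hq' w' hw'
  have k2 : inner ℝ (B (fderiv ℝ (fderiv ℝ h) 0 u₂ w')) (B U) = (0 : ℝ) := by
    rw [hUB _ (hmem u₂ hw2 w' hw')]
    exact hvan _ u₂ hw2 (fun y hy => hy.2.1)
      (fun y hy => ((mem_edgeSpace_iff right_angle_pos right_angle_lt).1 hy).2.1) hp' w' hw'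
  have k3 : inner ℝ (fderiv ℝ (fderiv ℝ φ) x (T u₁) w) (B V) =
      Q * inner ℝ (fderiv ℝ (fderiv ℝ χ) 0 u₁ w') (C u₂) := by
    rw [← inner_smul_right, ← hBV, hsnd, inner_add_left, k1, add_zero]
  have k4 : inner ℝ (fderiv ℝ (fderiv ℝ φ) x (T u₂) w) (B U) =
      P * inner ℝ (fderiv ℝ (fderiv ℝ χ) 0 u₂ w') (C u₁) := by
    rw [← inner_smul_right, ← hBU, hsnd, inner_add_left, k2, add_zero]
  have k5 : fderiv ℝ (fderiv ℝ φ) x U w = P • fderiv ℝ (fderiv ℝ φ) x (T u₁) w := by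
    rw [hU']; simp
  have k6 : fderiv ℝ (fderiv ℝ φ) x V w = Q • fderiv ℝ (fderiv ℝ φ) x (T u₂) w := by
    rw [hV']; simp
  rw [k5, k6, real_inner_smul_left, real_inner_smul_left, k3, k4, hf w' hw']
  ring

end RightAngleTransfer

/-! ### The bracket condition and the corrected squared norm in a chart -/

section DistanceFunction

variable {L : ℕ}

lemma inner_raiseIndex_comm (m : ℕ) (B : E L ≃L[ℝ] E L) (a b : E L) :
    inner ℝ a (raiseIndex m (B : E L →L[ℝ] E L) b) =
      inner ℝ b (raiseIndex m (B : E L →L[ℝ] E L) a) := by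
  rw [← inner_raiseIndex m B a (raiseIndex_mem m B b), real_inner_comm,
    inner_raiseIndex m B b (raiseIndex_mem m B a)]

lemma inner_raiseIndex_self_pos {m : ℕ} (B : E L ≃L[ℝ] E L) {a : E L}
    (ha : a ∈ coordSubspace L m) (ha0 : a ≠ 0) :
    0 < inner ℝ a (raiseIndex m (B : E L →L[ℝ] E L) a) := by
  rw [← inner_raiseIndex m B a (raiseIndex_mem m B a)]
  refine real_inner_self_pos.2 fun h => ha0 ?_
  have h1 := inner_raiseIndex m B a ha
  rw [h, inner_zero_right] at h1
  exact inner_self_eq_zero.1 h1.symm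

/-- If the mixed second fundamental forms of two orthogonal hypersurfaces agree, then the bracket of
the gradients of their equations is normal to the intersection. -/
lemma bracket_eq_combination {m : ℕ} {φ : OpenPartialHomeomorph (E L) (E L)}
    (h1 : ContDiffOn ℝ ∞ φ φ.source) (h2 : ContDiffOn ℝ ∞ φ.symm φ.target) {x : E L}
    (hx : x ∈ φ.source) {a b : E L} (ha : a ∈ coordSubspace L m) (hb : b ∈ coordSubspace L m)
    (ha0 : a ≠ 0) (hb0 : b ≠ 0) {U V : E L → E L}
    (hU : U = fun y => raiseIndex m (fderiv ℝ φ y) a)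
    (hV : V = fun y => raiseIndex m (fderiv ℝ φ y) b)
    (hγ : inner ℝ b (U x) = (0 : ℝ))
    (hform : ∀ w ∈ coordSubspace L m, inner ℝ a w = (0 : ℝ) → inner ℝ b w = (0 : ℝ) →
      (inner ℝ (fderiv ℝ (fderiv ℝ φ) x (U x) w) (fderiv ℝ φ x (V x)) : ℝ) =
        inner ℝ (fderiv ℝ (fderiv ℝ φ) x (V x) w) (fderiv ℝ φ x (U x))) :
    ∃ k l : ℝ, fderiv ℝ V x (U x) - fderiv ℝ U x (V x) = k • U x + l • V x := by
  obtain ⟨B, hB, -⟩ := exists_equiv_hasFDerivAt h1 h2 hx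
  have hrs := contDiffOn_raiseIndex m h1 h2
  have hUs : ContDiffOn ℝ ∞ U φ.source := by
    rw [hU]; exact hrs.clm_apply contDiffOn_const
  have hVs : ContDiffOn ℝ ∞ V φ.source := by
    rw [hV]; exact hrs.clm_apply contDiffOn_const
  have hUd := (hUs.differentiableAt_of_isOpen φ.open_source hx).hasFDerivAt
  have hVd := (hVs.differentiableAt_of_isOpen φ.open_source hx).hasFDerivAt
  have hφ2 := h1.contDiffAt_two φ.open_source hx
  have hUx : U x = raiseIndex m (B : E L →L[ℝ] E L) a := by rw [hU, ← hB.fderiv]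
  have hVx : V x = raiseIndex m (B : E L →L[ℝ] E L) b := by rw [hV, ← hB.fderiv]
  have hUK : U x ∈ coordSubspace L m := hUx ▸ raiseIndex_mem m B a
  have hVK : V x ∈ coordSubspace L m := hVx ▸ raiseIndex_mem m B b
  rw [hB.fderiv] at hform
  -- The derivative of a field which is metrically orthogonal to a constant vector.
  have key : ∀ (c : E L) (W : E L → E L), (W = fun y => raiseIndex m (fderiv ℝ φ y) c) →
      HasFDerivAt W (fderiv ℝ W x) x → ∀ w ∈ coordSubspace L m, ∀ v,
      inner ℝ (fderiv ℝ (fderiv ℝ φ) x v w) (B (W x)) +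
        inner ℝ (B w) (fderiv ℝ (fderiv ℝ φ) x v (W x) + B (fderiv ℝ W x v)) = (0 : ℝ) := by
    intro c W hW hWd w hw v
    have hff := hasFDerivAt_fderiv hφ2
    have d1 : HasFDerivAt (fun y => fderiv ℝ φ y w) _ x :=
      hff.clm_apply (hasFDerivAt_const w x)
    have d2 : HasFDerivAt (fun y => fderiv ℝ φ y (W y)) _ x := hff.clm_apply hWd
    have d3 := d1.inner ℝ d2
    have hconst : (fun y => inner ℝ (fderiv ℝ φ y w) (fderiv ℝ φ y (W y))) =ᶠ[𝓝 x]
        fun _ => (inner ℝ c w : ℝ) := by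
      filter_upwards [φ.open_source.mem_nhds hx] with y hy
      obtain ⟨B', hB', -⟩ := exists_equiv_hasFDerivAt h1 h2 hy
      have hWy : W y = raiseIndex m (B' : E L →L[ℝ] E L) c := by rw [hW, ← hB'.fderiv]
      rw [hB'.fderiv, hWy]
      exact inner_raiseIndex m B' c hw
    have d4 := d3.unique ((hasFDerivAt_const (inner ℝ c w : ℝ) x).congr_of_eventuallyEq hconst)
    have d5 := congrArg (fun A : E L →L[ℝ] ℝ => A v) d4
    simp [hB.fderiv] at d5
    rw [add_comm, add_comm (fderiv ℝ (fderiv ℝ φ) x v (W x))]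
    exact d5
  have hKd : ∀ (c : E L) (W : E L → E L), (W = fun y => raiseIndex m (fderiv ℝ φ y) c) →
      HasFDerivAt W (fderiv ℝ W x) x → ∀ v, fderiv ℝ W x v ∈ coordSubspace L m := by
    intro c W hW hWd v
    have hWK : ∀ y ∈ φ.source, W y ∈ coordSubspace L m := by
      intro y hy
      obtain ⟨B', hB', -⟩ := exists_equiv_hasFDerivAt h1 h2 hy
      have hWy : W y = raiseIndex m (B' : E L →L[ℝ] E L) c := by rw [hW, ← hB'.fderiv]
      rw [hWy]
      exact raiseIndex_mem m B' c
    refine hasFDerivAt_mem_of_isClosed (v := v) (C := (coordSubspace L m : Set (E L))) hWd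
      (isClosed_coordSubspace m) (fun y hy c _ => Submodule.smul_mem _ c hy) ?_
    have hs : Tendsto (fun s : ℝ => x + s • v) (𝓝[>] 0) (𝓝 x) := by
      have : Continuous fun s : ℝ => x + s • v := by fun_prop
      simpa using (this.tendsto 0).mono_left nhdsWithin_le_nhds
    filter_upwards [hs.eventually (φ.open_source.mem_nhds hx)] with s hs
    exact sub_mem (hWK _ hs) (hWK _ hx)
  set N := fderiv ℝ V x (U x) - fderiv ℝ U x (V x)
  have hNK : N ∈ coordSubspace L m := sub_mem (hKd b V hV hVd _) (hKd a U hU hUd _)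
  have hsymm : fderiv ℝ (fderiv ℝ φ) x (U x) (V x) = fderiv ℝ (fderiv ℝ φ) x (V x) (U x) :=
    (hφ2.isSymmSndFDerivAt (by simp)).eq _ _
  -- Subtract the two instances of `key`: the symmetric second derivatives of `φ` cancel, and the
  -- remaining mixed terms agree by hypothesis. Hence the bracket `N` is metrically orthogonal to
  -- the edge.
  have hN : ∀ w ∈ coordSubspace L m, inner ℝ a w = (0 : ℝ) → inner ℝ b w = (0 : ℝ) →
      inner ℝ (B w) (B N) = (0 : ℝ) := by
    intro w hw haw hbw
    have e1 := key b V hV hVd w hw (U x)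
    have e2 := key a U hU hUd w hw (V x)
    have e3 := hform w hw haw hbw
    rw [inner_add_right] at e1 e2
    rw [hsymm] at e1
    change inner ℝ (fderiv ℝ (fderiv ℝ φ) x (U x) w) (B (V x)) = (inner ℝ _ (B (U x)) : ℝ) at e3
    have e4 : inner ℝ (B w) (B N) = (inner ℝ (B w) (B (fderiv ℝ V x (U x))) : ℝ) -
        inner ℝ (B w) (B (fderiv ℝ U x (V x))) := by
      rw [← inner_sub_right, ← map_sub]
    rw [e4]
    linarith
  have hα : 0 < inner ℝ a (U x) := hUx ▸ inner_raiseIndex_self_pos B ha ha0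
  have hβ : 0 < inner ℝ b (V x) := hVx ▸ inner_raiseIndex_self_pos B hb hb0
  have hγ' : inner ℝ a (V x) = (0 : ℝ) := by
    rw [hVx, inner_raiseIndex_comm, ← hUx, hγ]
  have hUB : ∀ v ∈ coordSubspace L m, inner ℝ (B v) (B (U x)) = inner ℝ a v := fun v hv =>
    hUx ▸ inner_raiseIndex m B a hv
  have hVB : ∀ v ∈ coordSubspace L m, inner ℝ (B v) (B (V x)) = inner ℝ b v := fun v hv =>
    hVx ▸ inner_raiseIndex m B b hv
  refine ⟨inner ℝ a N / inner ℝ a (U x), inner ℝ b N / inner ℝ b (V x), ?_⟩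
  set k := inner ℝ a N / inner ℝ a (U x)
  set l := inner ℝ b N / inner ℝ b (V x)
  have hk : k * inner ℝ a (U x) = inner ℝ a N := div_mul_cancel₀ _ hα.ne'
  have hl : l * inner ℝ b (V x) = inner ℝ b N := div_mul_cancel₀ _ hβ.ne'
  have hZK : N - (k • U x + l • V x) ∈ coordSubspace L m :=
    sub_mem hNK (add_mem (Submodule.smul_mem _ _ hUK) (Submodule.smul_mem _ _ hVK))
  have hZa : inner ℝ a (N - (k • U x + l • V x)) = (0 : ℝ) := by
    rw [inner_sub_right, inner_add_right, inner_smul_right, inner_smul_right, hγ', hk]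
    ring
  have hZb : inner ℝ b (N - (k • U x + l • V x)) = (0 : ℝ) := by
    rw [inner_sub_right, inner_add_right, inner_smul_right, inner_smul_right, hγ, hl]
    ring
  -- The remainder is an edge vector by the choice of `k` and `l`. It is metrically orthogonal to
  -- `N`, `U` and `V`, hence to itself.
  have hZ : inner ℝ (B (N - (k • U x + l • V x))) (B (N - (k • U x + l • V x))) = (0 : ℝ) := by
    have e : B (N - (k • U x + l • V x)) = B N - (k • B (U x) + l • B (V x)) := by
      simp only [map_sub, map_add, map_smul]
    nth_rewrite 2 [e]
    rw [inner_sub_right, inner_add_right, inner_smul_right, inner_smul_right, hN _ hZK hZa hZb,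
      hUB _ hZK, hVB _ hZK, hZa, hZb]
    ring
  rw [inner_self_eq_zero, map_eq_zero_iff B B.injective] at hZ
  exact sub_eq_zero.1 hZ

lemma fderiv_isLocalModel_raiseIndex {m : ℕ} {M Ω : Set (E L)} {p : E L}
    {φ : OpenPartialHomeomorph (E L) (E L)} (hφ : IsLocalModel M Ω p φ) {c : E L}
    (hc : c ∈ coordSubspace L m) : raiseIndex m (fderiv ℝ φ 0) c = c := by
  obtain ⟨B, hB, -⟩ := hφ.exists_equiv
  rw [hB.fderiv]
  exact raiseIndex_isometry m B hc

/-- Orthogonal projection does not increase the norm. The extension of `C` at a right angle needs a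
domain stable under the projections onto both hyperplanes. -/
lemma sub_inner_smul_mem_ball {a x : E L} {r : ℝ} (ha : inner ℝ a a = (1 : ℝ))
    (hx : x ∈ Metric.ball (0 : E L) r) : x - (inner ℝ a x : ℝ) • a ∈ Metric.ball (0 : E L) r := by
  rw [mem_ball_zero_iff] at hx ⊢
  refine lt_of_le_of_lt ?_ hx
  refine le_of_sq_le_sq ?_ (norm_nonneg x)
  rw [← real_inner_self_eq_norm_sq, ← real_inner_self_eq_norm_sq]
  simp only [inner_sub_left, inner_sub_right, real_inner_smul_left, inner_smul_right, ha,
    real_inner_comm a x]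
  nlinarith [sq_nonneg (inner ℝ a x : ℝ)]

/-- In a suitable chart there is a small perturbation of the squared norm whose gradient is tangent
to the boundary. -/
lemma exists_chart_with_function {n : ℕ} (hn : 2 ≤ n) (hL : n + 1 ≤ L) {M : Set (E L)}
    (hangle : AngleCondition (n + 1) M) {p : E L} (hp : p ∈ edge (n + 1) M) :
    ∃ (θ : ℝ) (φ : OpenPartialHomeomorph (E L) (E L)) (r : ℝ) (R : E L → ℝ),
      0 < θ ∧ θ < Real.pi ∧ IsLocalModel M (wedge L (n + 1) θ) p φ ∧ 0 < r ∧
      Metric.ball 0 r ⊆ φ.source ∧ ContDiffOn ℝ ∞ R (Metric.ball 0 r) ∧ IsTwoFlat R ∧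
      ∀ s : ℝ, (s = 1 ∨ s = -1) → ∀ x ∈ Metric.ball (0 : E L) r, x ∈ coordSubspace L (n + 1) →
        inner ℝ (faceNormal L θ s) x = (0 : ℝ) →
        2 * inner ℝ x (raiseIndex (n + 1) (fderiv ℝ φ x) (faceNormal L θ s)) +
          fderiv ℝ R x (raiseIndex (n + 1) (fderiv ℝ φ x) (faceNormal L θ s)) = 0 := by
  have hL2 : 2 ≤ L := by omega
  have hp' : p ∈ connectedComponentIn (edge (n + 1) M) p := mem_connectedComponentIn hp
  -- The part which is common to both cases.
  have common : ∀ (θ : ℝ) (φ : OpenPartialHomeomorph (E L) (E L)), 0 < θ → θ < Real.pi →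
      IsLocalModel M (wedge L (n + 1) θ) p φ →
      ∃ U V : E L → E L, (U = fun x => raiseIndex (n + 1) (fderiv ℝ φ x) (faceNormal L θ 1)) ∧
        (V = fun x => raiseIndex (n + 1) (fderiv ℝ φ x) (faceNormal L θ (-1))) ∧
        ContDiffOn ℝ ∞ U φ.source ∧ ContDiffOn ℝ ∞ V φ.source ∧
        U 0 = faceNormal L θ 1 ∧ V 0 = faceNormal L θ (-1) ∧
        ∀ᶠ x in 𝓝 0, x ∈ φ.source ∧ inner ℝ (faceNormal L θ 1) (U x) ≠ (0 : ℝ) ∧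
          inner ℝ (faceNormal L θ (-1)) (V x) ≠ (0 : ℝ) ∧
          (inner ℝ (faceNormal L θ 1) (U x) * inner ℝ (faceNormal L θ (-1)) (V x) -
            inner ℝ (faceNormal L θ (-1)) (U x) * inner ℝ (faceNormal L θ 1) (V x) : ℝ) ≠ 0 ∧
          (θ < Real.pi / 2 → inner ℝ (faceNormal L θ (-1)) (U x) ≠ (0 : ℝ) ∧
            inner ℝ (faceNormal L θ 1) (V x) ≠ (0 : ℝ)) := by
    intro θ φ h0 hπ hφ
    have hrs := contDiffOn_raiseIndex (n + 1) hφ.smooth hφ.smooth_symm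
    have hU : ContDiffOn ℝ ∞ (fun x => raiseIndex (n + 1) (fderiv ℝ φ x) (faceNormal L θ 1))
      φ.source := hrs.clm_apply contDiffOn_const
    have hV : ContDiffOn ℝ ∞ (fun x => raiseIndex (n + 1) (fderiv ℝ φ x) (faceNormal L θ (-1)))
      φ.source := hrs.clm_apply contDiffOn_const
    have hU0 : raiseIndex (n + 1) (fderiv ℝ φ 0) (faceNormal L θ 1) = faceNormal L θ 1 :=
      fderiv_isLocalModel_raiseIndex hφ (faceNormal_mem (by omega) θ 1)
    have hV0 : raiseIndex (n + 1) (fderiv ℝ φ 0) (faceNormal L θ (-1)) = faceNormal L θ (-1) :=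
      fderiv_isLocalModel_raiseIndex hφ (faceNormal_mem (by omega) θ (-1))
    have cU := (hU.differentiableAt_of_isOpen φ.open_source hφ.zero_mem).continuousAt
    have cV := (hV.differentiableAt_of_isOpen φ.open_source hφ.zero_mem).continuousAt
    have ci : ∀ (c : E L) {W : E L → E L}, ContinuousAt W 0 →
        ContinuousAt (fun x => (inner ℝ c (W x) : ℝ)) 0 := fun c W hW => by fun_prop
    have e1 := inner_faceNormal_self hL2 θ (s := 1) (by norm_num)
    have e2 := inner_faceNormal_self hL2 θ (s := -1) (by norm_num)
    have e3 := inner_faceNormal_neg hL2 θ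
    have e4 := e3
    rw [real_inner_comm] at e4
    refine ⟨_, _, rfl, rfl, hU, hV, hU0, hV0, ?_⟩
    have hsin := Real.sin_pos_of_pos_of_lt_pi h0 hπ
    have a1 := (ci (faceNormal L θ 1) cU).eventually_ne (y := 0) (by rw [hU0, e1]; norm_num)
    have a2 := (ci (faceNormal L θ (-1)) cV).eventually_ne (y := 0) (by rw [hV0, e2]; norm_num)
    -- At the centre the determinant is `1 - cos² θ = sin² θ`.
    have a3 := (((ci (faceNormal L θ 1) cU).mul (ci (faceNormal L θ (-1)) cV)).sub
      ((ci (faceNormal L θ (-1)) cU).mul (ci (faceNormal L θ 1) cV))).eventually_ne (y := 0) (by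
        simp only [Pi.mul_apply, Pi.sub_apply]
        rw [hU0, hV0, e1, e2, e3, e4]
        nlinarith [Real.sin_sq_add_cos_sq θ])
    have a4 : ∀ᶠ x in 𝓝 (0 : E L), θ < Real.pi / 2 →
        inner ℝ (faceNormal L θ (-1)) (raiseIndex (n + 1) (fderiv ℝ φ x) (faceNormal L θ 1)) ≠
          (0 : ℝ) ∧
        inner ℝ (faceNormal L θ 1) (raiseIndex (n + 1) (fderiv ℝ φ x) (faceNormal L θ (-1))) ≠
          (0 : ℝ) := by
      by_cases hθ : θ < Real.pi / 2
      · have hcos : Real.cos θ ≠ 0 := (Real.cos_pos_of_mem_Ioo ⟨by linarith, hθ⟩).ne'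
        have b1 := (ci (faceNormal L θ (-1)) cU).eventually_ne (y := 0)
          (by rw [hU0, e4]; exact neg_ne_zero.2 hcos)
        have b2 := (ci (faceNormal L θ 1) cV).eventually_ne (y := 0)
          (by rw [hV0, e3]; exact neg_ne_zero.2 hcos)
        filter_upwards [b1, b2] with x h1 h2 _ using ⟨h1, h2⟩
      · exact Eventually.of_forall fun x h => absurd h hθ
    filter_upwards [φ.open_source.mem_nhds hφ.zero_mem, a1, a2, a3, a4] with x k0 k1 k2 k3 k4
    exact ⟨k0, k1, k2, k3, k4⟩
  rcases hangle p hp with h | h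
  · obtain ⟨θ, hθ, h0, hπ, φ, hφ⟩ := h p hp'
    have hπ' : θ < Real.pi := hθ.trans right_angle_lt
    obtain ⟨U, V, hUd, hVd, hU, hV, hU0, hV0, hev⟩ := common θ φ h0 hπ' hφ
    obtain ⟨r, hr, hball⟩ := Metric.eventually_nhds_iff_ball.1 hev
    have hsrc : Metric.ball 0 r ⊆ φ.source := fun x hx => (hball x hx).1
    obtain ⟨R, hR, hflat, hRU, hRV⟩ := exists_twoFlat_of_oblique Metric.isOpen_ball
      (Metric.mem_ball_self hr) (hU.mono hsrc) (hV.mono hsrc) hU0 hV0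
      (fun x hx => (hball x hx).2.2.2.1) (fun x hx => (hball x hx).2.1)
      (fun x hx => (hball x hx).2.2.1) (fun x hx => ((hball x hx).2.2.2.2 hθ).1)
      (fun x hx => ((hball x hx).2.2.2.2 hθ).2)
    refine ⟨θ, φ, r, R, h0, hπ', hφ, hr, hsrc, hR, hflat, ?_⟩
    rintro s (rfl | rfl) x hx - hax
    · have := hRU x hx hax
      rwa [hUd] at this
    · have := hRV x hx hax
      rwa [hVd] at this
  · obtain ⟨φ, hφ, -⟩ := h p hp'
    obtain ⟨U, V, hUd, hVd, hU, hV, hU0, hV0, hev⟩ :=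
      common (Real.pi / 2) φ right_angle_pos right_angle_lt hφ
    obtain ⟨r, hr, hball⟩ := Metric.eventually_nhds_iff_ball.1 hev
    have hsrc : Metric.ball 0 r ⊆ φ.source := fun x hx => (hball x hx).1
    have e1 := inner_faceNormal_self hL2 (Real.pi / 2) (s := 1) (by norm_num)
    have e2 := inner_faceNormal_self hL2 (Real.pi / 2) (s := -1) (by norm_num)
    have ha := faceNormal_mem (L := L) (show 2 ≤ n + 1 by omega) (Real.pi / 2) 1
    have hb := faceNormal_mem (L := L) (show 2 ≤ n + 1 by omega) (Real.pi / 2) (-1)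
    have hedge : ∀ x ∈ Metric.ball (0 : E L) r, x ∈ coordSubspace L (n + 1) →
        inner ℝ (faceNormal L (Real.pi / 2) 1) x = (0 : ℝ) →
        inner ℝ (faceNormal L (Real.pi / 2) (-1)) x = (0 : ℝ) →
        inner ℝ (faceNormal L (Real.pi / 2) (-1)) (U x) = (0 : ℝ) ∧
        inner ℝ (faceNormal L (Real.pi / 2) 1) (V x) = (0 : ℝ) ∧
        ∃ l m : ℝ, fderiv ℝ V x (U x) - fderiv ℝ U x (V x) = l • U x + m • V x := by
      intro x hx hxK hax hbx
      have hxe : x ∈ edgeSpace L (n + 1) :=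
        (mem_edgeSpace_iff right_angle_pos right_angle_lt).2 ⟨hxK, hax, hbx⟩
      -- The condition is needed at all edge points in the ball, not only at `p`; they lie in the
      -- component of `p` because the chart joins them to `p` by segments in the edge.
      have hq := h _ (mem_connectedComponentIn_edge hn hL right_angle_pos right_angle_lt hφ hsrc
        hx hxe)
      obtain ⟨B, hB, -⟩ := exists_equiv_hasFDerivAt hφ.smooth hφ.smooth_symm (hsrc hx)
      have hUx : U x = raiseIndex (n + 1) (B : E L →L[ℝ] E L) (faceNormal L (Real.pi / 2) 1) := by
        rw [hUd, ← hB.fderiv]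
      have hVx : V x = raiseIndex (n + 1) (B : E L →L[ℝ] E L) (faceNormal L (Real.pi / 2) (-1)) := by
        rw [hVd, ← hB.fderiv]
      obtain ⟨k1, k2⟩ := right_angle_in_chart hn hL hφ (hsrc hx) hxe hq hB (U := U x) (V := V x)
        (hUx ▸ raiseIndex_mem _ B _) (hVx ▸ raiseIndex_mem _ B _)
        (fun v hv => hUx ▸ inner_raiseIndex _ B _ hv)
        (fun v hv => hVx ▸ inner_raiseIndex _ B _ hv)
      refine ⟨k1, by rw [hVx, inner_raiseIndex_comm, ← hUx, k1], ?_⟩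
      refine bracket_eq_combination hφ.smooth hφ.smooth_symm (hsrc hx) ha hb ?_ ?_ hUd hVd k1 ?_
      · intro h; rw [h] at e1; simp at e1
      · intro h; rw [h] at e2; simp at e2
      · intro w hw haw hbw
        rw [hB.fderiv]
        exact k2 w ((mem_edgeSpace_iff right_angle_pos right_angle_lt).2 ⟨hw, haw, hbw⟩)
    obtain ⟨R, hR, hflat, hRU, hRV⟩ := exists_twoFlat_of_right_angle Metric.isOpen_ball
      (Metric.mem_ball_self hr) (hU.mono hsrc) (hV.mono hsrc) hU0 hV0
      (fun x hx => (hball x hx).2.2.2.1) (fun x hx => (hball x hx).2.1)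
      (fun x hx => (hball x hx).2.2.1) e2 (inner_faceNormal_right_angle hL2)
      (fun x hx => sub_inner_smul_mem_ball e1 hx) (fun x hx => sub_inner_smul_mem_ball e2 hx)
      hb hedge
    refine ⟨_, φ, r, R, right_angle_pos, right_angle_lt, hφ, hr, hsrc, hR, hflat, ?_⟩
    rintro s (rfl | rfl) x hx hxK hax
    · have := hRU x hx hxK hax
      rwa [hUd] at this
    · have := hRV x hx hxK hax
      rwa [hVd] at this

end DistanceFunction

/-! ### Estimates for a small perturbation of the squared norm -/

section Estimates

variable {X : Type*} [NormedAddCommGroup X] [InnerProductSpace ℝ X]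

/-- Estimates for a function with vanishing `2`-jet. -/
lemma IsTwoFlat.exists_estimates {R : X → ℝ} {r : ℝ} (hr : 0 < r)
    (hR : ContDiffOn ℝ ∞ R (Metric.ball 0 r)) (hflat : IsTwoFlat R) :
    ∃ ρ, 0 < ρ ∧ ρ ≤ r ∧ ∀ x ∈ Metric.ball (0 : X) ρ, ‖fderiv ℝ (fderiv ℝ R) x‖ ≤ 1 / 2 ∧
      ‖fderiv ℝ R x‖ ≤ 1 / 2 * ‖x‖ ∧ |R x| ≤ 1 / 2 * ‖x‖ ^ 2 := by
  have h1 : ContDiffAt ℝ 1 (fderiv ℝ R) 0 := hflat.contDiffAt.fderiv_right (by norm_num)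
  have h2 : ContinuousAt (fderiv ℝ (fderiv ℝ R)) 0 :=
    (h1.fderiv_right (m := 0) (by norm_num)).continuousAt
  have h3 : ∀ᶠ x in 𝓝 (0 : X), ‖fderiv ℝ (fderiv ℝ R) x‖ < 1 / 2 := by
    refine (ContinuousAt.norm (E := X →L[ℝ] X →L[ℝ] ℝ) h2).eventually_lt_const ?_
    have h0 : ‖fderiv ℝ (fderiv ℝ R) 0‖ = 0 := by
      rw [hflat.fderiv_fderiv_zero]
      exact norm_zero (E := X →L[ℝ] X →L[ℝ] ℝ)
    exact h0.trans_lt (by norm_num)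
  obtain ⟨ρ, hρ, hball⟩ := Metric.eventually_nhds_iff_ball.1
    (h3.and (Metric.ball_mem_nhds (0 : X) hr))
  have hsub : Metric.ball (0 : X) (min ρ r) ⊆ Metric.ball 0 ρ :=
    Metric.ball_subset_ball (min_le_left _ _)
  have hsubr : Metric.ball (0 : X) (min ρ r) ⊆ Metric.ball 0 r :=
    Metric.ball_subset_ball (min_le_right _ _)
  have h0 : (0 : X) ∈ Metric.ball (0 : X) (min ρ r) := Metric.mem_ball_self (lt_min hρ hr)
  -- The bound on the second derivative is integrated once here. It is integrated again below on the
  -- closed ball of radius `‖x‖`, where the first derivative is at most `‖x‖ / 2`.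
  have hD : ∀ x ∈ Metric.ball (0 : X) (min ρ r), ‖fderiv ℝ R x‖ ≤ 1 / 2 * ‖x‖ := by
    intro x hx
    have := (convex_ball (0 : X) (min ρ r)).norm_image_sub_le_of_norm_fderiv_le
      (f := fderiv ℝ R) (𝕜 := ℝ) (fun y hy => differentiableAt_fderiv
        (hR.contDiffAt_two Metric.isOpen_ball (hsubr hy)))
      (fun y hy => (hball y (hsub hy)).1.le) h0 hx
    simpa [hflat.fderiv_zero] using this
  refine ⟨min ρ r, lt_min hρ hr, min_le_right _ _, fun x hx =>
    ⟨(hball x (hsub hx)).1.le, hD x hx, ?_⟩⟩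
  have hcl : Metric.closedBall (0 : X) ‖x‖ ⊆ Metric.ball 0 (min ρ r) :=
    Metric.closedBall_subset_ball (mem_ball_zero_iff.1 hx)
  have := (convex_closedBall (0 : X) ‖x‖).norm_image_sub_le_of_norm_fderiv_le
    (f := R) (𝕜 := ℝ) (C := 1 / 2 * ‖x‖)
    (fun y hy => hR.differentiableAt_of_isOpen Metric.isOpen_ball (hsubr (hcl hy)))
    (fun y hy => (hD y (hcl hy)).trans (by
      have := mem_closedBall_zero_iff.1 hy
      linarith)) (Metric.mem_closedBall_self (norm_nonneg x))
    (mem_closedBall_zero_iff.2 le_rfl)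
  rw [hflat.map_zero] at this
  simp only [sub_zero, Real.norm_eq_abs] at this
  linarith [sq ‖x‖, mul_assoc (1 / 2) ‖x‖ ‖x‖]

lemma hasFDerivAt_norm_sq_add {R : X → ℝ} {x : X} (hR : DifferentiableAt ℝ R x) :
    HasFDerivAt (fun y => ‖y‖ ^ 2 + R y) (2 • innerSL ℝ x + fderiv ℝ R x) x :=
  (hasStrictFDerivAt_norm_sq x).hasFDerivAt.add hR.hasFDerivAt

lemma fderiv_fderiv_norm_sq_add {R : X → ℝ} {x : X} (hR : ContDiffAt ℝ 2 R x) (u v : X) :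
    fderiv ℝ (fderiv ℝ (fun y => ‖y‖ ^ 2 + R y)) x u v =
      2 * inner ℝ u v + fderiv ℝ (fderiv ℝ R) x u v := by
  let I : X →L[ℝ] X →L[ℝ] ℝ := innerSL ℝ
  have hI : ∀ y w, I y w = inner ℝ y w := fun _ _ => rfl
  have h1 : fderiv ℝ (fun y => ‖y‖ ^ 2 + R y) =ᶠ[𝓝 x]
      fun y => (2 : ℝ) • I y + fderiv ℝ R y := by
    filter_upwards [hR.eventually (by simp)] with y hy
    rw [(hasFDerivAt_norm_sq_add (hy.differentiableAt (by simp))).fderiv, two_smul, two_smul]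
  have h2 : HasFDerivAt (fun y => (2 : ℝ) • I y + fderiv ℝ R y)
      ((2 : ℝ) • I + fderiv ℝ (fderiv ℝ R) x) x :=
    (I.hasFDerivAt.const_smul (2 : ℝ)).add (hasFDerivAt_fderiv hR)
  rw [h1.fderiv_eq, h2.fderiv]
  simp [hI]

end Estimates

/-! ### The squared distance function and its convexity -/

section SquaredDistance

variable {L : ℕ}

/-- The metric gradient of `F` in the chart `φ`, for the metric on `ℝ^m × 0` induced by `φ`. -/
noncomputable def chartGradient (m : ℕ) (φ : E L → E L) (F : E L → ℝ) (x : E L) : E L :=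
  raiseIndex m (fderiv ℝ φ x) ((InnerProductSpace.toDual ℝ (E L)).symm (fderiv ℝ F x))

lemma inner_chartGradient (m : ℕ) {φ : E L → E L} {B : E L ≃L[ℝ] E L} (F : E L → ℝ) {x : E L}
    (hB : HasFDerivAt φ (B : E L →L[ℝ] E L) x) {v : E L} (hv : v ∈ coordSubspace L m) :
    inner ℝ (B v) (B (chartGradient m φ F x)) = fderiv ℝ F x v := by
  rw [chartGradient, hB.fderiv, inner_raiseIndex m B _ hv, InnerProductSpace.toDual_symm_apply]

lemma chartGradient_mem (m : ℕ) {φ : E L → E L} {B : E L ≃L[ℝ] E L} (F : E L → ℝ) {x : E L}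
    (hB : HasFDerivAt φ (B : E L →L[ℝ] E L) x) : chartGradient m φ F x ∈ coordSubspace L m := by
  rw [chartGradient, hB.fderiv]
  exact raiseIndex_mem m B _

/-- A function on a ball in a chart whose level sets are convex and orthogonal to the boundary
for the induced metric. -/
structure IsSquaredDistance (n : ℕ) (θ : ℝ) (φ : OpenPartialHomeomorph (E L) (E L)) (r : ℝ)
    (F : E L → ℝ) : Prop where
  subset_source : Metric.ball 0 r ⊆ φ.source
  contDiffOn : ContDiffOn ℝ ∞ F (Metric.ball 0 r)
  map_zero : F 0 = 0
  le : ∀ x ∈ Metric.ball (0 : E L) r, 1 / 2 * ‖x‖ ^ 2 ≤ F x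
  fderiv_self_pos : ∀ x ∈ Metric.ball (0 : E L) r, x ≠ 0 → 0 < fderiv ℝ F x x
  fderiv_normal : ∀ s : ℝ, (s = 1 ∨ s = -1) → ∀ x ∈ Metric.ball (0 : E L) r,
    x ∈ coordSubspace L (n + 1) → inner ℝ (faceNormal L θ s) x = (0 : ℝ) →
      fderiv ℝ F x (raiseIndex (n + 1) (fderiv ℝ φ x) (faceNormal L θ s)) = 0
  convex : ∀ x ∈ Metric.ball (0 : E L) r, ∀ v ≠ 0,
    inner ℝ (fderiv ℝ (fderiv ℝ φ) x v v) (fderiv ℝ φ x (chartGradient (n + 1) φ F x)) <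
      fderiv ℝ (fderiv ℝ F) x v v

lemma exists_isSquaredDistance {n : ℕ} (hn : 2 ≤ n) (hL : n + 1 ≤ L) {M : Set (E L)}
    (hangle : AngleCondition (n + 1) M) {p : E L} (hp : p ∈ edge (n + 1) M) :
    ∃ (θ : ℝ) (φ : OpenPartialHomeomorph (E L) (E L)) (r : ℝ) (F : E L → ℝ),
      0 < θ ∧ θ < Real.pi ∧ IsLocalModel M (wedge L (n + 1) θ) p φ ∧ 0 < r ∧
      IsSquaredDistance n θ φ r F := by
  obtain ⟨θ, φ, r, R, h0, hπ, hφ, hr, hsrc, hR, hflat, hN⟩ :=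
    exists_chart_with_function hn hL hangle hp
  obtain ⟨r₁, hr₁, hr₁r, hest⟩ := hflat.exists_estimates hr hR
  set F : E L → ℝ := fun y => ‖y‖ ^ 2 + R y with hF
  have hFs : ContDiffOn ℝ ∞ F (Metric.ball 0 r) := (contDiff_norm_sq ℝ).contDiffOn.add hR
  have hRd : ∀ x ∈ Metric.ball (0 : E L) r, DifferentiableAt ℝ R x := fun x hx =>
    hR.differentiableAt_of_isOpen Metric.isOpen_ball hx
  have hDF : ∀ x ∈ Metric.ball (0 : E L) r, ∀ v,
      fderiv ℝ F x v = 2 * inner ℝ x v + fderiv ℝ R x v := by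
    intro x hx v
    rw [(hasFDerivAt_norm_sq_add (hRd x hx)).fderiv]
    simp
  have hb0 : (0 : E L) ∈ Metric.ball (0 : E L) r := Metric.mem_ball_self hr
  have hDF0 : fderiv ℝ F 0 = 0 := by
    ext v
    rw [hDF 0 hb0, hflat.fderiv_zero]
    simp
  have hc1 : ContinuousAt (fderiv ℝ φ) 0 := by
    have h2 := hφ.smooth.contDiffAt_two φ.open_source hφ.zero_mem
    exact (h2.fderiv_right (m := 1) (by norm_num)).continuousAt
  have hc2 : ContinuousAt (fderiv ℝ (fderiv ℝ φ)) 0 := by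
    have h2 := hφ.smooth.contDiffAt_two φ.open_source hφ.zero_mem
    exact ((h2.fderiv_right (m := 1) (by norm_num)).fderiv_right (m := 0) (by norm_num)).continuousAt
  have hcG : ContinuousAt (chartGradient (n + 1) φ F) 0 := by
    have k1 := ((contDiffOn_raiseIndex (n + 1) hφ.smooth hφ.smooth_symm).contDiffAt
      (φ.open_source.mem_nhds hφ.zero_mem)).continuousAt
    have k2 : ContinuousAt (fderiv ℝ F) 0 :=
      ((hFs.contDiffAt_two Metric.isOpen_ball hb0).fderiv_right (m := 1) (by norm_num)).continuousAt
    exact k1.clm_apply ((LinearIsometryEquiv.continuous _).continuousAt.comp k2)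
  have hG0 : chartGradient (n + 1) φ F 0 = 0 := by
    rw [chartGradient, hDF0, map_zero, map_zero]
  -- The gradient vanishes at `0`, so near `0` the second derivative of the chart contributes at
  -- most `‖v‖²/2` to the Hessian along the level sets, whereas the second derivative of `F` is at
  -- least `2‖v‖² - ‖v‖²/2`.
  have hev : ∀ᶠ x in 𝓝 (0 : E L), ‖fderiv ℝ (fderiv ℝ φ) x‖ *
      ‖fderiv ℝ φ x (chartGradient (n + 1) φ F x)‖ < 1 / 2 := by
    refine ((ContinuousAt.norm (E := E L →L[ℝ] E L →L[ℝ] E L) hc2).mul (hc1.clm_apply hcG).norm).eventually_lt_const ?_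
    simp [hG0]
  obtain ⟨r₂, hr₂, hball⟩ := Metric.eventually_nhds_iff_ball.1 hev
  have s1 : Metric.ball (0 : E L) (min r₁ r₂) ⊆ Metric.ball 0 r₁ :=
    Metric.ball_subset_ball (min_le_left _ _)
  have s2 : Metric.ball (0 : E L) (min r₁ r₂) ⊆ Metric.ball 0 r₂ :=
    Metric.ball_subset_ball (min_le_right _ _)
  have sr : Metric.ball (0 : E L) (min r₁ r₂) ⊆ Metric.ball 0 r :=
    s1.trans (Metric.ball_subset_ball hr₁r)
  refine ⟨θ, φ, min r₁ r₂, F, h0, hπ, hφ, lt_min hr₁ hr₂, sr.trans hsrc, hFs.mono sr, ?_, ?_, ?_,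
    ?_, ?_⟩
  · simp [hF, hflat.map_zero]
  · intro x hx
    have := neg_le_of_abs_le (hest x (s1 hx)).2.2
    simp only [hF]
    linarith
  · intro x hx hx0
    have k1 := (fderiv ℝ R x).le_of_opNorm_le (hest x (s1 hx)).2.1 x
    have k2 := neg_le_of_abs_le k1
    have k3 : 0 < ‖x‖ * ‖x‖ := mul_pos (norm_pos_iff.2 hx0) (norm_pos_iff.2 hx0)
    rw [hDF x (sr hx), real_inner_self_eq_norm_mul_norm]
    nlinarith
  · intro s hs x hx hxK hxs
    rw [hDF x (sr hx)]
    exact hN s hs x (sr hx) hxK hxs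
  · intro x hx v hv
    have k3 : 0 < ‖v‖ * ‖v‖ := mul_pos (norm_pos_iff.2 hv) (norm_pos_iff.2 hv)
    rw [hF, fderiv_fderiv_norm_sq_add (hR.contDiffAt_two Metric.isOpen_ball (sr hx)), ← hF,
      real_inner_self_eq_norm_mul_norm]
    have k1 := (fderiv ℝ (fderiv ℝ R) x).le_opNorm₂ v v
    have k2 := neg_le_of_abs_le k1
    have k4 := (hest x (s1 hx)).1
    have k5 : inner ℝ (fderiv ℝ (fderiv ℝ φ) x v v)
        (fderiv ℝ φ x (chartGradient (n + 1) φ F x)) ≤ 1 / 2 * (‖v‖ * ‖v‖) := by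
      refine (real_inner_le_norm _ _).trans ?_
      have k6 := (fderiv ℝ (fderiv ℝ φ) x).le_opNorm₂ v v
      calc _ ≤ (‖fderiv ℝ (fderiv ℝ φ) x‖ * ‖v‖ * ‖v‖) *
            ‖fderiv ℝ φ x (chartGradient (n + 1) φ F x)‖ := by gcongr
        _ = ‖fderiv ℝ (fderiv ℝ φ) x‖ * ‖fderiv ℝ φ x (chartGradient (n + 1) φ F x)‖ *
            (‖v‖ * ‖v‖) := by ring
        _ ≤ _ := by
          have := (hball x (s2 hx)).le
          gcongr
    have k7 : ‖fderiv ℝ (fderiv ℝ R) x‖ * ‖v‖ * ‖v‖ ≤ 1 / 2 * (‖v‖ * ‖v‖) := by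
      rw [mul_assoc]; gcongr
    linarith

end SquaredDistance

/-! ### Local models and curvature of the level sets -/

section LevelSets

variable {L : ℕ}

lemma fderiv_fderiv_eq_zero_of_eventually_const {X Y : Type*} [NormedAddCommGroup X]
    [NormedSpace ℝ X] [NormedAddCommGroup Y] [NormedSpace ℝ Y] {f : X → Y} {e : X}
    (hf : ContDiffAt ℝ 2 f 0) (h : ∀ᶠ s in 𝓝 (0 : ℝ), f (s • e) = f 0) :
    fderiv ℝ (fderiv ℝ f) 0 e e = 0 := by
  have hd := hasDerivAt_fderiv_apply hf e e
  have hc : Tendsto (fun t : ℝ => t • e) (𝓝 0) (𝓝 0) := by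
    have : Continuous fun t : ℝ => t • e := by fun_prop
    simpa using this.tendsto 0
  have h1 : (fun s : ℝ => fderiv ℝ f (0 + s • e) e) =ᶠ[𝓝 0] fun _ => 0 := by
    filter_upwards [h.eventually_nhds, hc.eventually (hf.eventually (by simp))] with t ht1 ht2
    rw [zero_add]
    have k1 : HasDerivAt (fun s : ℝ => s • e) e t := by
      simpa using (hasDerivAt_id t).smul_const e
    have k2 : HasDerivAt (fun s : ℝ => f (s • e)) (fderiv ℝ f (t • e) e) t :=
      HasFDerivAt.comp_hasDerivAt t (f := fun s : ℝ => s • e)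
        (ht2.differentiableAt (by simp)).hasFDerivAt k1
    exact k2.unique ((hasDerivAt_const t (f 0)).congr_of_eventuallyEq ht1)
  exact hd.unique ((hasDerivAt_const (0 : ℝ) (0 : Y)).congr_of_eventuallyEq h1)

/-- Coordinates on `ℝ^m × 0` in which a function is affine. -/
lemma exists_straightening {m : ℕ} {F : E L → ℝ} {x₀ e : E L} (he : e ∈ coordSubspace L m)
    (he1 : inner ℝ e e = (1 : ℝ)) (hx₀ : x₀ ∈ coordSubspace L m)
    (hF : ∀ᶠ x in 𝓝 x₀, ContDiffAt ℝ ∞ F x) (Λ : E L ≃L[ℝ] E L) {c : ℝ}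
    (hΛ : ∀ v, Λ v ∈ coordSubspace L m ↔ v ∈ coordSubspace L m)
    (hΛe : ∀ v ∈ coordSubspace L m, inner ℝ e (Λ v) = c * fderiv ℝ F x₀ v) :
    ∃ g : E L → E L, g 0 = x₀ ∧ (∀ᶠ y in 𝓝 0, ContDiffAt ℝ ∞ g y) ∧
      HasFDerivAt g (Λ.symm : E L →L[ℝ] E L) 0 ∧
      ∀ᶠ y in 𝓝 0, (∃ a : ℝ, y = Λ (g y - x₀) + a • e) ∧
        (g y ∈ coordSubspace L m ↔ y ∈ coordSubspace L m) ∧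
        (g y ∈ coordSubspace L m → inner ℝ e y = c * (F (g y) - F x₀)) := by
  -- Composing with the projection restricts attention to the values of `F` on the coordinate
  -- subspace, the only place where `F` has to become affine.
  let π : E L →L[ℝ] E L := (coordSubspace L m).starProjection
  have hπ : ∀ x ∈ coordSubspace L m, π x = x := fun x hx =>
    Submodule.starProjection_eq_self_iff.2 hx
  let h : E L → ℝ := fun x => F (π x) - F x₀ - fderiv ℝ F x₀ (π (x - x₀))
  -- The first-order Taylor remainder `h` of `F` is added in the direction `e` only. It has zero
  -- derivative at `x₀`, so `Λ` remains the differential, and a cone invariant under translation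
  -- along `e` is not affected.
  let Θ : E L → E L := fun x => Λ (x - x₀) + (c * h x) • e
  have hhx₀ : h x₀ = 0 := by simp [h, hπ x₀ hx₀]
  have hΘx₀ : Θ x₀ = 0 := by simp [Θ, hhx₀]
  have hπx₀ : Tendsto π (𝓝 x₀) (𝓝 x₀) := by
    simpa [hπ x₀ hx₀] using π.continuous.tendsto x₀
  have hh : ∀ᶠ x in 𝓝 x₀, ContDiffAt ℝ ∞ h x := by
    filter_upwards [hπx₀.eventually hF] with x hx
    have k1 : ContDiffAt ℝ ∞ (fun x => F (π x)) x := hx.comp x π.contDiff.contDiffAt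
    have k2 : ContDiff ℝ ∞ fun x => fderiv ℝ F x₀ (π (x - x₀)) := by fun_prop
    exact (k1.sub contDiffAt_const).sub k2.contDiffAt
  have hΘ : ∀ᶠ x in 𝓝 x₀, ContDiffAt ℝ ∞ Θ x := by
    filter_upwards [hh] with x hx
    have k2 : ContDiff ℝ ∞ fun x => Λ (x - x₀) := by fun_prop
    exact k2.contDiffAt.add ((contDiffAt_const.mul hx).smul contDiffAt_const)
  have hdh : HasFDerivAt h (0 : E L →L[ℝ] ℝ) x₀ := by
    have k0 : HasFDerivAt F (fderiv ℝ F x₀) (π x₀) := by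
      rw [hπ x₀ hx₀]
      exact (hF.self_of_nhds.differentiableAt (by simp)).hasFDerivAt
    have k1 : HasFDerivAt (fun x => F (π x)) ((fderiv ℝ F x₀).comp π) x₀ :=
      k0.comp x₀ π.hasFDerivAt
    have k2 : HasFDerivAt (fun x => fderiv ℝ F x₀ (π (x - x₀))) ((fderiv ℝ F x₀).comp π) x₀ :=
      ((fderiv ℝ F x₀).comp π).hasFDerivAt.comp x₀ ((hasFDerivAt_id x₀).sub_const x₀)
    exact ((k1.sub_const (F x₀)).sub k2).congr_fderiv (sub_self _)
  have hdΘ : HasFDerivAt Θ (Λ : E L →L[ℝ] E L) x₀ := by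
    have k1 : HasFDerivAt (fun x => Λ (x - x₀)) (Λ : E L →L[ℝ] E L) x₀ :=
      (Λ : E L →L[ℝ] E L).hasFDerivAt.comp x₀ ((hasFDerivAt_id x₀).sub_const x₀)
    have k2 : HasFDerivAt (fun x => (c * h x) • e) (0 : E L →L[ℝ] E L) x₀ := by
      simpa using (hdh.const_mul c).smul_const e
    exact (k1.add k2).congr_fderiv (add_zero _)
  obtain ⟨τ, hτ, hx₀τ, -, h1, h2⟩ := exists_smooth_openPartialHomeomorph univ_mem hΘ hdΘ
  have hτx₀ : τ x₀ = 0 := by rw [hτ, hΘx₀]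
  have h0t : (0 : E L) ∈ τ.target := hτx₀ ▸ τ.map_source hx₀τ
  have hg0 : τ.symm 0 = x₀ := by rw [← hτx₀, τ.left_inv hx₀τ]
  obtain ⟨B, hB, hB'⟩ := exists_equiv_hasFDerivAt h1 h2 hx₀τ
  have hBΛ : B = Λ := by
    rw [hτ] at hB
    exact ContinuousLinearEquiv.coe_injective (hB.unique hdΘ)
  rw [hτx₀, hBΛ] at hB'
  refine ⟨τ.symm, hg0, ?_, hB', ?_⟩
  · filter_upwards [τ.open_target.mem_nhds h0t] with y hy
    exact h2.contDiffAt (τ.open_target.mem_nhds hy)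
  · filter_upwards [τ.open_target.mem_nhds h0t] with y hy
    have hy' : y = Λ (τ.symm y - x₀) + (c * h (τ.symm y)) • e := by
      conv_lhs => rw [← τ.right_inv hy, hτ]
    refine ⟨⟨_, hy'⟩, ?_, fun hK => ?_⟩
    · conv_rhs => rw [hy']
      rw [Submodule.add_mem_iff_left _ (Submodule.smul_mem _ _ he), hΛ,
        Submodule.sub_mem_iff_left _ hx₀]
    · conv_lhs => rw [hy']
      rw [inner_add_right, inner_smul_right, he1, hΛe _ (sub_mem hK hx₀)]
      simp only [h, hπ _ hK, hπ _ (sub_mem hK hx₀)]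
      ring

/-- Simultaneous local models, with the same differential and the same type, of `M` and of a level
set of a squared distance function. -/
lemma IsSquaredDistance.exists_localModels {n : ℕ} (hn : 2 ≤ n) (hL : n + 1 ≤ L) {M S : Set (E L)}
    {p : E L} {θ r : ℝ} {φ : OpenPartialHomeomorph (E L) (E L)} {F : E L → ℝ} (h0 : 0 < θ)
    (hπ : θ < Real.pi) (hφ : IsLocalModel M (wedge L (n + 1) θ) p φ)
    (hF : IsSquaredDistance n θ φ r F) {x₀ : E L} (hx₀ : x₀ ∈ Metric.ball (0 : E L) r)
    (hw : x₀ ∈ wedge L (n + 1) θ) (hne : x₀ ≠ 0)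
    (hS : ∀ᶠ x in 𝓝 x₀, φ x ∈ S ↔ x ∈ wedge L (n + 1) θ ∧ F x = F x₀) :
    ∃ (B : E L ≃L[ℝ] E L) (o : Option ℝ) (O : E L ≃ₗᵢ[ℝ] E L)
      (χ ψ : OpenPartialHomeomorph (E L) (E L)),
      HasFDerivAt φ.symm (B.symm : E L →L[ℝ] E L) (φ x₀) ∧ IsAngle o ∧
      IsLocalModel M (modelCone L (n + 1) o) (φ x₀) χ ∧
      HasFDerivAt χ (O.toContinuousLinearEquiv : E L →L[ℝ] E L) 0 ∧
      IsLocalModel S (modelCone L n o) (φ x₀) ψ ∧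
      HasFDerivAt ψ (O.toContinuousLinearEquiv : E L →L[ℝ] E L) 0 ∧
      fderiv ℝ F x₀ (B.symm (O (basisVec L n))) < 0 ∧
      ∀ i < n, 0 < secondFundForm ψ (O (basisVec L n)) (basisVec L i) (basisVec L i) := by
  have hsrc := hF.subset_source hx₀
  have hxK : x₀ ∈ coordSubspace L (n + 1) := hw.1
  obtain ⟨B, hB, hB'⟩ := exists_equiv_hasFDerivAt hφ.smooth hφ.smooth_symm hsrc
  set T := chartGradient (n + 1) φ F x₀ with hT
  have hTK : T ∈ coordSubspace L (n + 1) := chartGradient_mem _ F hB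
  have hTB : ∀ v ∈ coordSubspace L (n + 1), inner ℝ (B v) (B T) = fderiv ℝ F x₀ v :=
    fun v hv => inner_chartGradient _ F hB hv
  have hBT : B T ≠ 0 := by
    intro h
    have k1 := hTB x₀ hxK
    rw [h, inner_zero_right] at k1
    exact (hF.fderiv_self_pos x₀ hx₀ hne).ne k1
  have hN : 0 < ‖B T‖ := norm_pos_iff.2 hBT
  -- The last frame vector is `c • B T`, the unit normal pointing against the gradient, in the
  -- direction of decreasing `F`.
  set c : ℝ := -‖B T‖⁻¹ with hc
  have hc0 : c < 0 := neg_lt_zero.2 (inv_pos.2 hN)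
  have hνK : B.symm (c • B T) ∈ coordSubspace L (n + 1) := by
    rw [map_smul, B.symm_apply_apply]
    exact Submodule.smul_mem _ _ hTK
  have hν1 : ‖c • B T‖ = 1 := by
    rw [norm_smul, hc, norm_neg, norm_inv, norm_norm, inv_mul_cancel₀ hN.ne']
  have hUν : ∀ s : ℝ, (s = 1 ∨ s = -1) → inner ℝ (faceNormal L θ s) x₀ = (0 : ℝ) →
      inner ℝ (B (raiseIndex (n + 1) (B : E L →L[ℝ] E L) (faceNormal L θ s))) (c • B T) =
        (0 : ℝ) := by
    intro s hs hxs
    have k1 := hF.fderiv_normal s hs x₀ hx₀ hxK hxs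
    rw [hB.fderiv] at k1
    rw [real_inner_smul_right, hTB _ (raiseIndex_mem _ _ _), k1, mul_zero]
  obtain ⟨o, O, ho, hOn, hOK, hloc, -⟩ := exists_adapted_frame hn hL h0 hπ B
    (raiseIndex_mem _ _ _) (raiseIndex_mem _ _ _)
    (fun v hv => inner_raiseIndex (n + 1) B (faceNormal L θ 1) hv)
    (fun v hv => inner_raiseIndex (n + 1) B (faceNormal L θ (-1)) hv) hw hνK hν1
    (hUν 1 (Or.inl rfl)) (hUν (-1) (Or.inr rfl))
  obtain ⟨χ, hχ, hχO⟩ := exists_localModel_of_frame hφ hsrc hB O hloc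
  set e := basisVec L n with he
  have heK : e ∈ coordSubspace L (n + 1) := basisVec_mem (by omega)
  have he1 : inner ℝ e e = (1 : ℝ) := by
    simpa using inner_basisVec_basisVec (L := L) (i := n) (by omega) n
  set Λ : E L ≃L[ℝ] E L := B.trans O.symm.toContinuousLinearEquiv with hΛdef
  have hΛ : ∀ v, Λ v = O.symm (B v) := fun _ => rfl
  have hΛs : ∀ v, Λ.symm v = B.symm (O v) := fun _ => rfl
  have hΛK : ∀ v, Λ v ∈ coordSubspace L (n + 1) ↔ v ∈ coordSubspace L (n + 1) := by
    intro v
    rw [← hOK, hΛ]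
    simp
  have hΛe : ∀ v ∈ coordSubspace L (n + 1), inner ℝ e (Λ v) = c * fderiv ℝ F x₀ v := by
    intro v hv
    rw [← hTB v hv, ← real_inner_smul_right, ← hOn, hΛ, ← O.inner_map_map]
    rw [O.apply_symm_apply, real_inner_comm]
  have hball : Metric.ball (0 : E L) r ∈ 𝓝 x₀ := Metric.isOpen_ball.mem_nhds hx₀
  have hFs : ∀ x ∈ Metric.ball (0 : E L) r, ContDiffAt ℝ ∞ F x := fun x hx =>
    hF.contDiffOn.contDiffAt (Metric.isOpen_ball.mem_nhds hx)
  obtain ⟨g, hg0, hgs, hgd, hg⟩ := exists_straightening heK he1 hxK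
    (by filter_upwards [hball] with x hx using hFs x hx) Λ hΛK hΛe
  have hgt : Tendsto g (𝓝 0) (𝓝 x₀) := by simpa [hg0] using hgd.continuousAt.tendsto
  have hφx₀ : ContDiffAt ℝ ∞ φ (g 0) := by
    rw [hg0]; exact hφ.smooth.contDiffAt (φ.open_source.mem_nhds hsrc)
  have hψs : ∀ᶠ y in 𝓝 0, ContDiffAt ℝ ∞ (φ ∘ g) y := by
    filter_upwards [hgs, hgt.eventually (φ.open_source.mem_nhds hsrc)] with y hy1 hy2
    exact (hφ.smooth.contDiffAt (φ.open_source.mem_nhds hy2)).comp y hy1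
  have hψd : HasFDerivAt (φ ∘ g) (O.toContinuousLinearEquiv : E L →L[ℝ] E L) 0 := by
    rw [← hg0] at hB
    refine (hB.comp 0 hgd).congr_fderiv ?_
    ext1 y
    simp [hΛs]
  have hsub : Tendsto (fun y => g y - x₀) (𝓝 0) (𝓝 0) := by simpa using hgt.sub_const x₀
  have hiff : ∀ᶠ y in 𝓝 0, (φ ∘ g) y ∈ S ↔ y ∈ modelCone L n o := by
    filter_upwards [hg, hgt.eventually hS, hsub.eventually hloc] with y ⟨⟨a, ha⟩, hyK, hye⟩ hyS hyw
    rw [add_sub_cancel] at hyw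
    rw [mem_modelCone_succ, ← he, Function.comp_apply, hyS]
    -- Here `y` and the frame coordinates of `g y - x₀` differ by a multiple of `basisVec L n`,
    -- along which the model cone is invariant.
    have k1 : y ∈ modelCone L (n + 1) o ↔ g y ∈ wedge L (n + 1) θ := by
      rw [hyw, ← hΛ]
      conv_lhs => rw [ha]
      exact add_smul_basisVec_mem_modelCone_iff hn _ _
    rw [k1]
    refine and_congr_right fun hgw => ?_
    rw [hye hgw.1, mul_eq_zero_iff_left hc0.ne, sub_eq_zero]
  obtain ⟨ψ, hψ, hψe⟩ := exists_isLocalModel (p := φ x₀) O hψs hψd (by simp [hg0]) hiff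
  refine ⟨B, o, O, χ, ψ, hB', ho, hχ, hχO, hψ, by rw [hψe]; exact hψd, ?_, ?_⟩
  · rw [hOn, map_smul, B.symm_apply_apply, map_smul, ← hTB T hTK, smul_eq_mul]
    exact mul_neg_of_neg_of_pos hc0 (real_inner_self_pos.2 hBT)
  · intro i hi
    set ei := basisVec L i
    have heiK : ei ∈ coordSubspace L (n + 1) := basisVec_mem (by omega)
    have hei : ei ≠ 0 := by
      intro h
      have := inner_basisVec_basisVec (L := L) (i := i) (by omega) i
      rw [show basisVec L i = 0 from h] at this
      simp at this
    have heei : inner ℝ e ei = (0 : ℝ) := by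
      have := inner_basisVec_basisVec (L := L) (i := n) (by omega) i
      rwa [if_neg (by omega)] at this
    set v := Λ.symm ei with hv
    have hv0 : v ≠ 0 := by simpa [hv] using hei
    have hg2 : ContDiffAt ℝ 2 g 0 := hgs.self_of_nhds.of_le (WithTop.coe_le_coe.2 (le_top : (2 : ℕ∞) ≤ ⊤))
    have hφ2 : ContDiffAt ℝ 2 φ (g 0) := hφx₀.of_le (WithTop.coe_le_coe.2 (le_top : (2 : ℕ∞) ≤ ⊤))
    have hF2 : ContDiffAt ℝ 2 F (g 0) := by
      rw [hg0]; exact (hFs x₀ hx₀).of_le (WithTop.coe_le_coe.2 (le_top : (2 : ℕ∞) ≤ ⊤))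
    have hline : Tendsto (fun s : ℝ => s • ei) (𝓝 0) (𝓝 0) := by
      have : Continuous fun s : ℝ => s • ei := by fun_prop
      simpa using this.tendsto 0
    have hgK : ∀ᶠ s in 𝓝 (0 : ℝ), g (s • ei) ∈ coordSubspace L (n + 1) := by
      filter_upwards [hline.eventually hg] with s hs
      exact hs.2.1.2 (Submodule.smul_mem _ _ heiK)
    set π : E L →L[ℝ] E L :=
      ContinuousLinearMap.id ℝ (E L) - (coordSubspace L (n + 1)).starProjection with hπdef
    have hπ0 : ∀ x, π x = 0 ↔ x ∈ coordSubspace L (n + 1) := by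
      intro x
      rw [← Submodule.starProjection_eq_self_iff (K := coordSubspace L (n + 1)), hπdef]
      simp only [sub_apply, ContinuousLinearMap.id_apply]
      rw [sub_eq_zero, eq_comm]
    -- The curve `s ↦ g (s • ei)` stays in the coordinate subspace, so its acceleration does too,
    -- and the gradient identity `hTB` applies to it.
    have hg''K : fderiv ℝ (fderiv ℝ g) 0 ei ei ∈ coordSubspace L (n + 1) := by
      rw [← hπ0, ← fderiv_fderiv_clm_comp π hg2]
      refine fderiv_fderiv_eq_zero_of_eventually_const (π.contDiff.contDiffAt.comp 0 hg2) ?_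
      filter_upwards [hgK] with s hs
      rw [(hπ0 _).2 hs, hg0, (hπ0 _).2 hxK]
    -- Along the same curve `F` is constant. Its second derivative gives `D²F(v, v) + DF(g'') = 0`,
    -- which expresses the acceleration term of the curvature by the Hessian of `F`.
    have hFg : fderiv ℝ (fderiv ℝ (F ∘ g)) 0 ei ei = 0 := by
      refine fderiv_fderiv_eq_zero_of_eventually_const (hF2.comp 0 hg2) ?_
      filter_upwards [hgK, hline.eventually hg] with s hs hs'
      have k1 := hs'.2.2 hs
      rw [inner_smul_right, heei, mul_zero, eq_comm, mul_eq_zero_iff_left hc0.ne] at k1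
      rw [Function.comp_apply, Function.comp_apply, hg0]
      exact sub_eq_zero.1 k1
    rw [fderiv_fderiv_comp hF2 hg2, hgd.fderiv, hg0] at hFg
    rw [secondFundForm, hψe, fderiv_fderiv_comp hφ2 hg2, hgd.fderiv, hg0, hOn,
      real_inner_smul_right, inner_add_left, hB.fderiv]
    have k2 := hF.convex x₀ hx₀ v hv0
    rw [hB.fderiv, ← hT] at k2
    have k3 : inner ℝ (B (fderiv ℝ (fderiv ℝ g) 0 ei ei)) (B T) = _ := hTB _ hg''K
    -- The pairing with `B T` equals `⟨D²φ(v, v), B T⟩ - D²F(v, v)`, which is negative by `convex`.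
    refine mul_pos_of_neg_of_neg hc0 ?_
    change inner ℝ (fderiv ℝ (fderiv ℝ φ) x₀ v v) (B T) +
      inner ℝ (B (fderiv ℝ (fderiv ℝ g) 0 ei ei)) (B T) < 0
    change fderiv ℝ (fderiv ℝ F) x₀ v v + _ = 0 at hFg
    change inner ℝ (fderiv ℝ (fderiv ℝ φ) x₀ v v) (B T) < _ at k2
    linarith

end LevelSets

/-! ### Orthogonality, compactness and non-emptiness of the level sets -/

section Assembly

variable {L : ℕ}

/-- If `M` and the hypersurface `S` have local models of the same type and with the same differential
at a point, then the normals of the boundary of `M` are tangent to `S` there. -/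
lemma mem_tangentSpan_of_isFaceNormal {n : ℕ} (hn : 2 ≤ n) (hL : n + 1 ≤ L) {M S : Set (E L)}
    {q ν : E L} {o : Option ℝ} (ho : IsAngle o) {O : E L ≃ₗᵢ[ℝ] E L}
    {χ ψ : OpenPartialHomeomorph (E L) (E L)} (hχ : IsLocalModel M (modelCone L (n + 1) o) q χ)
    (hχO : HasFDerivAt χ (O.toContinuousLinearEquiv : E L →L[ℝ] E L) 0)
    (hψ : IsLocalModel S (modelCone L n o) q ψ)
    (hψO : HasFDerivAt ψ (O.toContinuousLinearEquiv : E L →L[ℝ] E L) 0)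
    (hν : IsFaceNormal (n + 1) M q ν) : ν ∈ tangentSpan S q := by
  obtain ⟨θ, χ', h0, hπ, hχ', hν⟩ := hν
  obtain ⟨T, hT, hTd⟩ := hχ.exists_isometry hχ' (isClosedCone_modelCone _ _)
    (isClosedCone_wedge _ _)
  rw [tangentSpan_eq_map hψ (isClosedCone_modelCone _ _),
    span_modelCone (by omega) (by omega) ho, hψO.fderiv]
  have hTK : ∀ v ∈ coordSubspace L (n + 1), T v ∈ coordSubspace L (n + 1) := by
    have k1 : Submodule.span ℝ (wedge L (n + 1) θ) ≤
        (coordSubspace L (n + 1)).comap (T.toLinearEquiv : E L →ₗ[ℝ] E L) :=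
      Submodule.span_le.2 fun v hv => modelCone_subset _ _ ((hT v).2 hv)
    rw [span_wedge (by omega) (by omega) h0 hπ] at k1
    exact fun v hv => k1 hv
  -- The model of `M` contains the line spanned by `basisVec L n`, so the wedge contains its
  -- preimage under `T`. A linear function that is nonnegative on a line vanishes on it, so both
  -- face normals are orthogonal to that line.
  have hcone : ∀ c : ℝ, c • T.symm (basisVec L n) ∈ wedge L (n + 1) θ := by
    intro c
    rw [← hT, map_smul, T.apply_symm_apply, ← zero_add (c • basisVec L n),
      add_smul_basisVec_mem_modelCone_iff hn]
    exact (isClosedCone_modelCone _ _).zero_mem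
  have key : ∀ s : ℝ, (s = 1 ∨ s = -1) → T (faceNormal L θ s) ∈ coordSubspace L n := by
    intro s hs
    have hTn := hTK _ (faceNormal_mem (L := L) (show 2 ≤ n + 1 by omega) θ s)
    have hpos : ∀ c : ℝ, 0 ≤ c * inner ℝ (faceNormal L θ s) (T.symm (basisVec L n)) := by
      intro c
      rw [← real_inner_smul_right]
      rcases hs with rfl | rfl
      · exact (hcone c).2.1
      · exact (hcone c).2.2
    have hzero : inner ℝ (faceNormal L θ s) (T.symm (basisVec L n)) = (0 : ℝ) :=
      le_antisymm (by linarith [hpos (-1)]) (by linarith [hpos 1])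
    rw [← T.inner_map_map, T.apply_symm_apply, real_inner_comm] at hzero
    exact mem_coordSubspace_succ.2 ⟨hTn, hzero⟩
  rcases hν with rfl | rfl
  · rw [hTd, hχO.fderiv]
    exact ⟨_, key 1 (Or.inl rfl), rfl⟩
  · rw [hTd, hχO.fderiv]
    exact ⟨_, key (-1) (Or.inr rfl), rfl⟩

lemma isUnitNormal_of_localModels {n : ℕ} (hn : 2 ≤ n) (hL : n + 1 ≤ L) {M S : Set (E L)}
    {q : E L} {o : Option ℝ} (ho : IsAngle o) {O : E L ≃ₗᵢ[ℝ] E L}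
    {χ ψ : OpenPartialHomeomorph (E L) (E L)} (hχ : IsLocalModel M (modelCone L (n + 1) o) q χ)
    (hχO : HasFDerivAt χ (O.toContinuousLinearEquiv : E L →L[ℝ] E L) 0)
    (hψ : IsLocalModel S (modelCone L n o) q ψ)
    (hψO : HasFDerivAt ψ (O.toContinuousLinearEquiv : E L →L[ℝ] E L) 0) :
    IsUnitNormal M S q (O (basisVec L n)) := by
  rw [IsUnitNormal, tangentSpan_eq_map hψ (isClosedCone_modelCone _ _),
    span_modelCone (by omega) (by omega) ho, hψO.fderiv,
    tangentSpan_eq_map hχ (isClosedCone_modelCone _ _),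
    span_modelCone (by omega) (by omega) ho, hχO.fderiv]
  refine ⟨?_, ⟨_, basisVec_mem (by omega), rfl⟩, ?_⟩
  · rw [O.norm_map, ← sq_eq_sq₀ (norm_nonneg _) zero_le_one, ← real_inner_self_eq_norm_sq]
    simpa using inner_basisVec_basisVec (L := L) (i := n) (by omega) n
  · rintro _ ⟨y, hy, rfl⟩
    exact (O.inner_map_map _ _).trans ((mem_coordSubspace.1 hy) n le_rfl)

/-- The function `√F` in the chart `φ`. -/
noncomputable def chartDistance (φ : OpenPartialHomeomorph (E L) (E L)) (F : E L → ℝ) (q : E L) : ℝ :=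
  √(F (φ.symm q))

variable {n : ℕ} {θ r : ℝ} {M : Set (E L)} {p : E L}
  {φ : OpenPartialHomeomorph (E L) (E L)} {F : E L → ℝ}

lemma IsSquaredDistance.nonneg (hF : IsSquaredDistance n θ φ r F) {x : E L}
    (hx : x ∈ Metric.ball (0 : E L) r) : 0 ≤ F x :=
  le_trans (by positivity) (hF.le x hx)

lemma IsSquaredDistance.eq_zero_iff (hF : IsSquaredDistance n θ φ r F) {x : E L}
    (hx : x ∈ Metric.ball (0 : E L) r) : F x = 0 ↔ x = 0 := by
  constructor
  · intro h
    have k1 := hF.le x hx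
    rw [h] at k1
    have k2 : ‖x‖ ^ 2 = 0 := le_antisymm (by linarith) (sq_nonneg _)
    exact norm_eq_zero.1 (pow_eq_zero_iff two_ne_zero |>.1 k2)
  · rintro rfl
    exact hF.map_zero

lemma IsSquaredDistance.chartDistance_apply (hF : IsSquaredDistance n θ φ r F) {x : E L}
    (hx : x ∈ Metric.ball (0 : E L) r) : chartDistance φ F (φ x) = √(F x) := by
  rw [chartDistance, φ.left_inv (hF.subset_source hx)]

lemma IsSquaredDistance.apply_mem_levelSet_iff (hF : IsSquaredDistance n θ φ r F)
    (hφ : IsLocalModel M (wedge L (n + 1) θ) p φ) {x : E L} (hx : x ∈ Metric.ball (0 : E L) r)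
    {t : ℝ} (ht : 0 < t) :
    φ x ∈ levelSet M (φ '' Metric.ball 0 r) (chartDistance φ F) t ↔
      x ∈ wedge L (n + 1) θ ∧ F x = t ^ 2 := by
  have k1 : φ x ∈ φ '' Metric.ball 0 r := mem_image_of_mem _ hx
  rw [levelSet, Set.mem_ofPred_eq, mem_inter_iff, hF.chartDistance_apply hx,
    hφ.mem_iff (hF.subset_source hx), Real.sqrt_eq_iff_eq_sq (hF.nonneg hx) ht.le]
  simp [k1]

/-- From `‖x‖² / 2 ≤ F x = t²` and `t < r/4` it follows that `‖x‖ ≤ r/2`. The level set therefore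
stays away from the boundary of the ball, whence its compactness. -/
lemma IsSquaredDistance.levelSet_eq (hF : IsSquaredDistance n θ φ r F)
    (hφ : IsLocalModel M (wedge L (n + 1) θ) p φ) (hr : 0 < r) {t : ℝ} (ht : 0 < t)
    (htr : t < r / 4) :
    levelSet M (φ '' Metric.ball 0 r) (chartDistance φ F) t =
      φ '' (wedge L (n + 1) θ ∩ (Metric.closedBall 0 (r / 2) ∩ F ⁻¹' {t ^ 2})) := by
  have hsub : Metric.closedBall (0 : E L) (r / 2) ⊆ Metric.ball 0 r :=
    Metric.closedBall_subset_ball (by linarith)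
  ext q
  constructor
  · intro hq
    obtain ⟨x, hx, rfl⟩ := hq.1.2
    obtain ⟨hxw, hxF⟩ := (hF.apply_mem_levelSet_iff hφ hx ht).1 hq
    refine ⟨x, ⟨hxw, mem_closedBall_zero_iff.2 ?_, hxF⟩, rfl⟩
    have k1 := hF.le x hx
    refine le_of_sq_le_sq ?_ (by positivity)
    nlinarith
  · rintro ⟨x, ⟨hxw, hxb, hxF⟩, rfl⟩
    exact (hF.apply_mem_levelSet_iff hφ (hsub hxb) ht).2 ⟨hxw, hxF⟩

lemma IsSquaredDistance.isCompact_levelSet (hF : IsSquaredDistance n θ φ r F)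
    (hφ : IsLocalModel M (wedge L (n + 1) θ) p φ) (hr : 0 < r) {t : ℝ} (ht : 0 < t)
    (htr : t < r / 4) :
    IsCompact (levelSet M (φ '' Metric.ball 0 r) (chartDistance φ F) t) := by
  have hsub : Metric.closedBall (0 : E L) (r / 2) ⊆ Metric.ball 0 r :=
    Metric.closedBall_subset_ball (by linarith)
  rw [hF.levelSet_eq hφ hr ht htr]
  have hclosed : IsClosed (Metric.closedBall (0 : E L) (r / 2) ∩ F ⁻¹' {t ^ 2}) :=
    (hF.contDiffOn.continuousOn.mono hsub).preimage_isClosed_of_isClosed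
      Metric.isClosed_closedBall isClosed_singleton
  have hcpt : IsCompact (wedge L (n + 1) θ ∩ (Metric.closedBall (0 : E L) (r / 2) ∩ F ⁻¹' {t ^ 2})) :=
    (isCompact_closedBall (0 : E L) (r / 2)).of_isClosed_subset
      ((isClosed_wedge _ _).inter hclosed) fun x hx => hx.2.1
  exact hcpt.image_of_continuousOn
    (φ.continuousOn.mono fun x hx => hF.subset_source (hsub hx.2.1))

/-- The intermediate value theorem along the edge ray spanned by `basisVec L n`, which stays in the
wedge: at distance `r/2` the value of `F` is at least `r²/8`, which exceeds `t²`. -/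
lemma IsSquaredDistance.levelSet_nonempty (hF : IsSquaredDistance n θ φ r F)
    (hφ : IsLocalModel M (wedge L (n + 1) θ) p φ) (hn : 2 ≤ n) (hL : n + 1 ≤ L) (hr : 0 < r)
    {t : ℝ} (ht : 0 < t) (htr : t < r / 4) :
    (levelSet M (φ '' Metric.ball 0 r) (chartDistance φ F) t).Nonempty := by
  have he : ‖basisVec L n‖ = 1 := by
    rw [← sq_eq_sq₀ (norm_nonneg _) zero_le_one, ← real_inner_self_eq_norm_sq]
    simpa using inner_basisVec_basisVec (L := L) (i := n) (by omega) n
  have hball : ∀ s ∈ Icc (0 : ℝ) (r / 2), s • basisVec L n ∈ Metric.closedBall (0 : E L) (r / 2) := by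
    intro s hs
    rw [mem_closedBall_zero_iff, norm_smul, he, mul_one, Real.norm_of_nonneg hs.1]
    exact hs.2
  have hsub : Metric.closedBall (0 : E L) (r / 2) ⊆ Metric.ball 0 r :=
    Metric.closedBall_subset_ball (by linarith)
  have hc : ContinuousOn (fun s : ℝ => F (s • basisVec L n)) (Icc 0 (r / 2)) :=
    (hF.contDiffOn.continuousOn.mono hsub).comp (by fun_prop) hball
  have hr2 : (0 : ℝ) ≤ r / 2 := by linarith
  have hend := hF.le _ (hsub (hball (r / 2) (right_mem_Icc.2 hr2)))
  rw [norm_smul, he, mul_one, Real.norm_of_nonneg hr2] at hend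
  have hmem : t ^ 2 ∈ Icc (F ((0 : ℝ) • basisVec L n)) (F ((r / 2) • basisVec L n)) := by
    rw [zero_smul, hF.map_zero]
    exact ⟨sq_nonneg t, by nlinarith⟩
  obtain ⟨s, hs, hst⟩ := intermediate_value_Icc hr2 hc hmem
  have hw : s • basisVec L n ∈ wedge L (n + 1) θ := by
    rw [← zero_add (s • basisVec L n), add_smul_basisVec_mem_wedge_iff hn]
    exact zero_mem_wedge _ _
  exact ⟨_, (hF.apply_mem_levelSet_iff hφ (hsub (hball s hs)) ht).2 ⟨hw, hst⟩⟩

lemma IsSquaredDistance.smoothOnSubset (hF : IsSquaredDistance n θ φ r F)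
    (hφ : IsLocalModel M (wedge L (n + 1) θ) p φ) :
    SmoothOnSubset (fun q => chartDistance φ F q ^ 2) (M ∩ φ '' Metric.ball 0 r) := by
  intro q hq
  refine ⟨φ '' Metric.ball 0 r,
    φ.isOpen_image_of_subset_source Metric.isOpen_ball hF.subset_source, hq.2, F ∘ φ.symm, ?_, ?_⟩
  · refine hF.contDiffOn.comp (hφ.smooth_symm.mono ?_) ?_
    · rintro _ ⟨x, hx, rfl⟩
      exact φ.map_source (hF.subset_source hx)
    · rintro _ ⟨x, hx, rfl⟩
      rwa [φ.left_inv (hF.subset_source hx)]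
  · rintro _ ⟨-, x, hx, rfl⟩
    simp only [Function.comp_apply, hF.chartDistance_apply hx, φ.left_inv (hF.subset_source hx)]
    rw [Real.sq_sqrt (hF.nonneg hx)]

lemma IsSquaredDistance.chartDistance_eq_zero_iff (hF : IsSquaredDistance n θ φ r F)
    (hφ : IsLocalModel M (wedge L (n + 1) θ) p φ) {q : E L}
    (hq : q ∈ φ '' Metric.ball 0 r) : chartDistance φ F q = 0 ↔ q = p := by
  obtain ⟨x, hx, rfl⟩ := hq
  rw [hF.chartDistance_apply hx, Real.sqrt_eq_zero (hF.nonneg hx), hF.eq_zero_iff hx,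
    ← hφ.map_zero, φ.injOn.eq_iff (hF.subset_source hx) hφ.zero_mem]

lemma hasMeanCurvature_sum {S : Set (E L)} {q ν : E L} {o : Option ℝ} (ho : IsAngle o)
    {ψ : OpenPartialHomeomorph (E L) (E L)} (hψ : IsLocalModel S (modelCone L n o) q ψ) :
    HasMeanCurvature n S q ν
      (∑ i ∈ Finset.range n, secondFundForm ψ ν (basisVec L i) (basisVec L i)) := by
  refine ⟨ψ, ?_, rfl⟩
  cases o with
  | none => exact Or.inl hψ
  | some θ => exact Or.inr ⟨θ, (ho θ rfl).1, (ho θ rfl).2, hψ⟩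

end Assembly

end WedgeShaped

theorem mainTheorem8 (n L : ℕ) (hn : 2 ≤ n) (hL : n + 1 ≤ L) (M : Set (E L))
    (hcompact : IsCompact M) (hconn : IsConnected M)
    (hM : IsLocallyWedgeShaped (n + 1) M) (hangle : AngleCondition (n + 1) M)
    (p : E L) (hp : p ∈ edge (n + 1) M) :
    ∃ r₀ : ℝ, 0 < r₀ ∧ ∃ U : Set (E L), IsOpen U ∧ p ∈ U ∧ ∃ d : E L → ℝ,
      SmoothOnSubset (fun q => d q ^ 2) (M ∩ U) ∧
      (∀ q ∈ M ∩ U, 0 ≤ d q ∧ (d q = 0 ↔ q = p)) ∧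
      ∀ t : ℝ, 0 < t → t < r₀ →
        (levelSet M U d t).Nonempty ∧
        IsCompact (levelSet M U d t) ∧
        IsLocallyWedgeShaped n (levelSet M U d t) ∧
        face n (levelSet M U d t) = levelSet M U d t ∩ face (n + 1) M ∧
        edge n (levelSet M U d t) = levelSet M U d t ∩ edge (n + 1) M ∧
        IsStrictlyMeanConvex n M (levelSet M U d t) d ∧
        MeetsBoundaryOrthogonally (n + 1) M (levelSet M U d t) := by
  obtain ⟨θ, φ, r, F, h0, hπ, hφ, hr, hF⟩ := exists_isSquaredDistance hn hL hangle hp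
  have hp0 : p ∈ φ '' Metric.ball 0 r := ⟨0, Metric.mem_ball_self hr, hφ.map_zero⟩
  refine ⟨r / 4, by positivity, φ '' Metric.ball 0 r,
    φ.isOpen_image_of_subset_source Metric.isOpen_ball hF.subset_source, hp0, chartDistance φ F,
    hF.smoothOnSubset hφ,
    fun q hq => ⟨Real.sqrt_nonneg _, hF.chartDistance_eq_zero_iff hφ hq.2⟩, ?_⟩
  intro t ht htr
  set S := levelSet M (φ '' Metric.ball 0 r) (chartDistance φ F) t
  -- One index `o` and one isometry `O` serve for `M` and `S` simultaneously. Equality of `o`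
  -- matches faces and edges, and equality of `O` gives the unit normal and the orthogonality.
  have models : ∀ q ∈ S, ∃ (o : Option ℝ) (O : E L ≃ₗᵢ[ℝ] E L)
      (χ ψ : OpenPartialHomeomorph (E L) (E L)), IsAngle o ∧
      IsLocalModel M (modelCone L (n + 1) o) q χ ∧
      HasFDerivAt χ (O.toContinuousLinearEquiv : E L →L[ℝ] E L) 0 ∧
      IsLocalModel S (modelCone L n o) q ψ ∧
      HasFDerivAt ψ (O.toContinuousLinearEquiv : E L →L[ℝ] E L) 0 ∧
      (∃ D : E L →L[ℝ] ℝ, HasFDerivWithinAt (chartDistance φ F) D M q ∧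
        D (O (basisVec L n)) < 0) ∧
      ∀ i < n, 0 < secondFundForm ψ (O (basisVec L n)) (basisVec L i) (basisVec L i) := by
    intro q hq
    obtain ⟨x, hx, rfl⟩ := hq.1.2
    obtain ⟨hxw, hxF⟩ := (hF.apply_mem_levelSet_iff hφ hx ht).1 hq
    have ht2 : 0 < t ^ 2 := by positivity
    have hx0 : x ≠ 0 := fun h => (hxF ▸ ht2.ne') ((hF.eq_zero_iff hx).2 h)
    have hS : ∀ᶠ y in nhds x, φ y ∈ S ↔ y ∈ wedge L (n + 1) θ ∧ F y = F x := by
      filter_upwards [Metric.isOpen_ball.mem_nhds hx] with y hy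
      rw [hxF]
      exact hF.apply_mem_levelSet_iff hφ hy ht
    obtain ⟨B, o, O, χ, ψ, hB, ho, hχ, hχO, hψ, hψO, hneg, hpos⟩ :=
      hF.exists_localModels hn hL h0 hπ hφ hx hxw hx0 hS
    refine ⟨o, O, χ, ψ, ho, hχ, hχO, hψ, hψO, ?_, hpos⟩
    have hFx : HasFDerivAt F (fderiv ℝ F x) (φ.symm (φ x)) := by
      rw [φ.left_inv (hF.subset_source hx)]
      exact (hF.contDiffOn.differentiableAt_of_isOpen Metric.isOpen_ball hx).hasFDerivAt
    have hne : F (φ.symm (φ x)) ≠ 0 := by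
      rw [φ.left_inv (hF.subset_source hx), hxF]
      exact ht2.ne'
    -- Away from `p` the square root is differentiable, and its derivative is a positive multiple of
    -- that of `F`.
    refine ⟨_, ((hFx.comp (φ x) hB).sqrt hne).hasFDerivWithinAt, ?_⟩
    refine mul_neg_of_pos_of_neg ?_ hneg
    rw [Function.comp_apply, φ.left_inv (hF.subset_source hx), hxF]
    positivity
  have hL2 : 2 ≤ L := by omega
  refine ⟨hF.levelSet_nonempty hφ hn hL hr ht htr, hF.isCompact_levelSet hφ hr ht htr, ?_, ?_, ?_,
    ?_, ?_⟩
  · intro q hq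
    obtain ⟨o, O, χ, ψ, ho, hχ, hχO, hψ, hψO, -, -⟩ := models q hq
    cases o with
    | none => exact Or.inl ⟨ψ, hψ⟩
    | some θ' => exact Or.inr ⟨θ', hψ.hasWedgeAngle ho⟩
  · ext q
    constructor
    · intro hq
      obtain ⟨o, O, χ, ψ, ho, hχ, hχO, hψ, hψO, -, -⟩ := models q hq.1
      exact ⟨hq.1, (hχ.mem_face_iff (by omega) hL2 ho).2 ((hψ.mem_face_iff hn hL2 ho).1 hq)⟩
    · rintro ⟨hqS, hq⟩
      obtain ⟨o, O, χ, ψ, ho, hχ, hχO, hψ, hψO, -, -⟩ := models q hqS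
      exact (hψ.mem_face_iff hn hL2 ho).2 ((hχ.mem_face_iff (by omega) hL2 ho).1 hq)
  · ext q
    constructor
    · intro hq
      obtain ⟨o, O, χ, ψ, ho, hχ, hχO, hψ, hψO, -, -⟩ := models q hq.1
      exact ⟨hq.1, (hχ.mem_edge_iff (by omega) hL2 ho).2 ((hψ.mem_edge_iff hn hL2 ho).1 hq)⟩
    · rintro ⟨hqS, hq⟩
      obtain ⟨o, O, χ, ψ, ho, hχ, hχO, hψ, hψO, -, -⟩ := models q hqS
      exact (hψ.mem_edge_iff hn hL2 ho).2 ((hχ.mem_edge_iff (by omega) hL2 ho).1 hq)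
  · intro q hq
    obtain ⟨o, O, χ, ψ, ho, hχ, hχO, hψ, hψO, hD, hpos⟩ := models q hq
    refine ⟨O (basisVec L n), isUnitNormal_of_localModels hn hL ho hχ hχO hψ hψO, hD, _,
      hasMeanCurvature_sum ho hψ, ?_⟩
    -- Each diagonal entry of the second fundamental form is positive, so the trace is a nonempty
    -- sum of positive terms.
    exact Finset.sum_pos (fun i hi => hpos i (Finset.mem_range.1 hi)) ⟨0, by simp; omega⟩
  · intro q hq ν hν
    obtain ⟨o, O, χ, ψ, ho, hχ, hχO, hψ, hψO, -, -⟩ := models q hq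
    exact mem_tangentSpan_of_isFaceNormal hn hL ho hχ hχO hψ hψO hν
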